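/- For $n\ge 1$ and a permutation $\sigma\in S_n$ let $k_j(\sigma)$ be the number of cycles of length $j$ of $\sigma$ and $w(\sigma)=\sum_{j\le n}k_j(\sigma)$ the number of all its cycles. For $\theta>0$ the Ewens measure on $S_n$ is $$\nu_n(A)=\frac{1}{\theta(\theta+1)\cdots(\theta+n-1)}\sum_{\sigma\in A}\theta^{w(\sigma)},\qquad A\subset S_n .$$ Given integers $a_{nj}$, $1\le j\le n$, let $h_n(\sigma)=\sum_{j\le n}a_{nj}k_j(\sigma)$ be the corresponding integer-valued additive functions. Write $x_{(r)}=x(x-1)\cdots(x-r+1)$, $r\ge1$, for the falling factorial, $a_{nj}(m)=\min\{\max\{a_{nj},0\},m\}$ for the truncated coefficients, and for natural numbers $l,m\ge 1$ put $$\Upsilon_n(l,m)=\sum_{u=1}^{l}\theta^u\sum_{\substack{r_1+\cdots+r_u=l\\ 1\le r_i\le m,\ i\le u}}\binom{l-1}{r_1-1}\binom{l-r_1-1}{r_2-1}\cdots\binom{l-r_1-\cdots-r_{u-1}-1}{r_u-1}\sum_{\substack{j_1,\dots,j_u\ge 1\\ j_1+\cdots+j_u<n}}\frac{a_{nj_1}(m)_{(r_1)}\cdots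 a_{nj_u}(m)_{(r_u)}}{j_1\cdots j_u}\Big(1-\frac{j_1+\cdots+j_u}{n}\Big)^{\theta-1}.$$ **Theorem.** Let $\theta\ge1$, let $h_n$ be a sequence of integer-valued additive functions as above, and let $Y$ be a random variable with values in $\mathbb Z_+=\{0,1,2,\dots\}$ such that $\mathbf E Y^\alpha<\infty$ for some $\alpha\ge 2+\varepsilon$, where $\varepsilon>0$. If the distribution functions $\nu_n(h_n(\sigma)<x)$ converge weakly, as $n\to\infty$, to the distribution function $P(Y<x)$ of $Y$, then $$\lim_{n\to\infty}\sum_{j<n}\frac{\mathbf 1\{a_{nj}\le -1\}}{j}\Big(1-\frac jn\Big)^{\theta-1}=0,$$ and, for each natural number $1\le l\le\alpha-1-\varepsilon$, $$\lim_{m\to\infty}\limsup_{n\to\infty}\big|\Upsilon_n(l,m)-\mathbf E Y_{(l)}\big|=0 .$$ -/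

import Mathlib

open Filter Topology MeasureTheory

noncomputable section

namespace EwensAdditive

/-- `cycleCount j σ` is the number `k_j(σ)` of cycles of length `j` of `σ`; fixed points count as
cycles of length one. -/
def cycleCount {n : ℕ} (j : ℕ) (σ : Equiv.Perm (Fin n)) : ℕ :=
  σ.partition.parts.count j

/-- `numCycles σ` is the total number `w(σ)` of cycles of `σ`, fixed points included. -/
def numCycles {n : ℕ} (σ : Equiv.Perm (Fin n)) : ℕ :=
  Multiset.card σ.partition.parts

open Classical in
/-- The Ewens probability
`ν_n(A) = (θ (θ + 1) ⋯ (θ + n - 1))⁻¹ ∑_{σ ∈ A} θ ^ w(σ)` of a set `A` of permutations. -/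
def ewens (θ : ℝ) (n : ℕ) (A : Set (Equiv.Perm (Fin n))) : ℝ :=
  (∑ σ with σ ∈ A, θ ^ numCycles σ) / (ascPochhammer ℝ n).eval θ

/-- The completely additive function `h(σ) = ∑_{j ≤ n} a_j k_j(σ)` on `S_n` given by the
integers `a_1, …, a_n`. -/
def additiveFun (n : ℕ) (a : ℕ → ℤ) (σ : Equiv.Perm (Fin n)) : ℤ :=
  ∑ j ∈ Finset.Icc 1 n, a j * (cycleCount j σ : ℤ)

/-- The distribution function `T_n(x) = ν_n(h(σ) < x)` of the additive function given by `a`. -/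
def distrFun (θ : ℝ) (n : ℕ) (a : ℕ → ℤ) (x : ℝ) : ℝ :=
  ewens θ n {σ | (additiveFun n a σ : ℝ) < x}

/-- The distribution function `F_Y(x) = P(Y < x)` of a random variable `Y` with values in the
non-negative integers. -/
def limitDistrFun {Ω : Type*} [MeasurableSpace Ω] (P : Measure Ω) (Y : Ω → ℕ) (x : ℝ) : ℝ :=
  P.real {ω | (Y ω : ℝ) < x}

/-- Weak convergence of distribution functions: convergence at every continuity point of the
limit. -/
def WeaklyConverges (T : ℕ → ℝ → ℝ) (F : ℝ → ℝ) : Prop :=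
  ∀ x : ℝ, ContinuousAt F x → Tendsto (fun n => T n x) atTop (𝓝 (F x))

/-- The truncation `a(m) = min (max a 0) m` of an integer `a` to the interval `[0, m]`. -/
def trunc (m : ℕ) (a : ℤ) : ℕ := min a.toNat m

/-- The quantity `Υ_n(l, m)`: the sum over `1 ≤ u ≤ l`, over the `r_1, …, r_u ∈ {1, …, m}` with
sum `l` and over the `j_1, …, j_u ≥ 1` with sum less than `n`. The `i`-th binomial coefficient is
that of `l - r_1 - ⋯ - r_{i-1} - 1` over `r_i - 1`, and `(trunc m a).descFactorial r` is the
falling factorial `a(m) (a(m) - 1) ⋯ (a(m) - r + 1)`. -/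
def upsilon (θ : ℝ) (a : ℕ → ℤ) (n l m : ℕ) : ℝ :=
  ∑ u ∈ Finset.Icc 1 l, θ ^ u *
    ∑ r ∈ Fintype.piFinset (fun _ : Fin u => Finset.Icc 1 m) with ∑ i, r i = l,
      (∏ i, ((l - (∑ k ∈ Finset.Iio i, r k) - 1).choose (r i - 1) : ℝ)) *
        ∑ j ∈ Fintype.piFinset (fun _ : Fin u => Finset.Icc 1 n) with ∑ i, j i < n,
          (∏ i, ((trunc m (a (j i))).descFactorial (r i) : ℝ) / (j i : ℝ)) *
            (1 - (∑ i, (j i : ℝ)) / (n : ℝ)) ^ (θ - 1)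

/-- `ρ` is an error term `ρ_n(m)`, that is, `lim_{m → ∞} limsup_{n → ∞} |ρ_n(m)| = 0`. The inner
upper limit is taken in `[0, ∞]`. -/
def IsRho (ρ : ℕ → ℕ → ℝ) : Prop :=
  Tendsto (fun m : ℕ => limsup (fun n : ℕ => ENNReal.ofReal |ρ n m|) atTop) atTop (𝓝 0)

end EwensAdditive

end

/-! Weak convergence enters in two forms: the values of `h_n` lie in a fixed interval `[0, K]` up to
small probability (`TightNonneg`), and the probability of each integer value converges. The
difficulty is to turn tightness into information on the coefficients `a_{nj}`; after that the
factorial moments of the truncated function can be compared directly with those of `Y`.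

Coefficients. By tightness the mean of `exp (i t h_n)` stays away from zero for small `t`. A
Halász-type inequality (`exists_phase`) then makes `j ↦ exp (i t a_{nj})` close to some `j ↦ w ^ j`
in the measure with weights `1 / j`, and taking powers extends this to every frequency in `[0, 2 π]`
(`exists_phases`). Averaging over a fine grid of frequencies and using orthogonality of characters
of a cyclic group shows that `a_{nj} = s j` for some integer `s = s_n`, off a set of bounded
logarithmic weight (`exists_slope`). A lower bound sieve (`exists_le_mulCoeff`) says that avoiding
such a set has probability bounded below; on that event `h_n = s n`, so tightness forces `s = 0`.
Hence `∑ 1 / j` over `a_{nj} ≠ 0` is bounded (`exists_support_bound`).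

Negative coefficients. Given a cycle with a negative coefficient, the sieve shows that with
probability bounded below all other cycles have coefficient zero, and then `h_n < 0`. As the limit
law charges no negative integer, the expected number of such cycles tends to zero
(`tendsto_count_neg`), which gives the first assertion after comparing weights.

Moments. Marking cycles one at a time gives a recursion `facRec` for the factorial moments of a
truncated function, linear in the weight of the unmarked part. The weight `mass θ k` gives the
moments, while `(k / n) ^ (θ - 1)`, set to `0` at `k = 0`, gives `Υ_n(l, m)` (`upsilon_eq_facRec`).
The bounded support makes the recursion stable, so `Υ_n(l, m)` minus the normalized moment tends to
zero (`tendsto_upsilon_sub_moment`). For fixed `m` the moment of order `l + 1` is bounded in `n`;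
this uniform integrability bounds the `l`-th moment from above by about `E Y_(l)`
(`eventually_moment_le`). The bound from below, for large `m`, comes from finitely many values of
`Y` (`eventually_le_moment`). -/

namespace EwensAdditive

/-! ### Ewens weights as sums over partitions, and the recursion for multiplicative functions. -/

section Coefficients

open scoped Nat

/-- The product `∏_j j ^ {m_j} m_j!` for a multiset with multiplicities `m_j`; the size of the
centralizer of a permutation of that cycle type. -/
def centralizerSize (s : Multiset ℕ) : ℕ := s.prod * ∏ j ∈ s.toFinset, (s.count j)!

lemma centralizerSize_pos {s : Multiset ℕ} (hs : ∀ j ∈ s, 0 < j) : 0 < centralizerSize s := by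
  have : 0 < s.prod := Multiset.prod_pos hs
  unfold centralizerSize
  positivity

lemma prod_count_factorial_cons (j : ℕ) (s : Multiset ℕ) :
    ∏ i ∈ (j ::ₘ s).toFinset, ((j ::ₘ s).count i)! =
      ((j ::ₘ s).count j) * ∏ i ∈ s.toFinset, (s.count i)! := by
  have h1 : ∏ i ∈ s.toFinset, (s.count i)! = ∏ i ∈ (j ::ₘ s).toFinset, (s.count i)! := by
    apply Finset.prod_subset
    · intro i hi; simp at hi ⊢; exact Or.inr hi
    · intro i _ hi; simp at hi; simp [hi]
  rw [h1, ← Finset.mul_prod_erase _ _ (show j ∈ (j ::ₘ s).toFinset by simp),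
    ← Finset.mul_prod_erase _ _ (show j ∈ (j ::ₘ s).toFinset by simp), ← mul_assoc]
  congr 1
  · rw [Multiset.count_cons_self, Nat.factorial_succ]
  · apply Finset.prod_congr rfl
    intro i hi
    rw [Multiset.count_cons_of_ne (Finset.ne_of_mem_erase hi)]

lemma centralizerSize_cons (j : ℕ) (s : Multiset ℕ) :
    centralizerSize (j ::ₘ s) = j * (j ::ₘ s).count j * centralizerSize s := by
  unfold centralizerSize
  rw [prod_count_factorial_cons, Multiset.prod_cons]
  ring

lemma prod_count_factorial_add_replicate (m : Multiset ℕ) (hm : ∀ a ∈ m, 2 ≤ a) (k : ℕ) :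
    centralizerSize (m + Multiset.replicate k 1) = k ! * centralizerSize m := by
  have h1 : m.count 1 = 0 := Multiset.count_eq_zero.2 fun h => by have := hm 1 h; omega
  induction k with
  | zero => simp
  | succ k ih =>
    rw [Multiset.replicate_succ, Multiset.add_cons, centralizerSize_cons, ih]
    simp [h1, Nat.factorial_succ]
    ring

/-- The known count is by `cycleType`, which omits fixed points. A partition is its parts that are
at least two together with ones, and the ones supply the factor `k !` for the fixed points. -/
lemma card_partition_eq (n : ℕ) (p : n.Partition) :
    (Finset.univ.filter fun σ : Equiv.Perm (Fin n) => σ.partition.parts = p.parts).card *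
      centralizerSize p.parts = n ! := by
  set m := p.parts.filter (2 ≤ ·) with hm
  set k := p.parts.count 1 with hk
  have hm2 : ∀ a ∈ m, 2 ≤ a := fun a ha => (Multiset.mem_filter.1 ha).2
  have hp : p.parts = m + Multiset.replicate k 1 := by
    conv_lhs => rw [← Multiset.filter_add_not (2 ≤ ·) p.parts]
    congr 1
    rw [hk, ← Multiset.filter_eq' p.parts 1]
    apply Multiset.filter_congr
    intro x hx
    have := p.parts_pos hx
    omega
  have hsum : m.sum + k = n := by
    have := p.parts_sum
    rw [hp] at this
    simpa using this
  have hset : (Finset.univ.filter fun σ : Equiv.Perm (Fin n) => σ.partition.parts = p.parts) =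
      Finset.univ.filter fun σ : Equiv.Perm (Fin n) => σ.cycleType = m := by
    ext σ
    simp only [Finset.mem_filter, Finset.mem_univ, true_and]
    constructor
    · intro h
      rw [← Equiv.Perm.filter_parts_partition_eq_cycleType, h]
    · intro h
      rw [Equiv.Perm.parts_partition, h, hp, ← Equiv.Perm.sum_cycleType, h, Fintype.card_fin]
      congr 2
      omega
  have := Equiv.Perm.card_of_cycleType_mul_eq (Fin n) m
  rw [if_pos ⟨by simp; omega, hm2⟩, Fintype.card_fin, show n - m.sum = k by omega] at this
  rw [hset, hp, prod_count_factorial_add_replicate m hm2, centralizerSize, ← mul_assoc (k !)]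
  exact this

variable {E : Type*} [AddCommGroup E] [Module ℝ E]

/-- The sum `(1 / n!) ∑_{σ ∈ S_n} θ ^ w(σ) G(σ)` for a function `G` of the multiset of cycle
lengths, written as a sum over the partitions of `n`. -/
noncomputable def ewensSum (θ : ℝ) (n : ℕ) (G : Multiset ℕ → E) : E :=
  ∑ p : n.Partition, (θ ^ Multiset.card p.parts / centralizerSize p.parts) • G p.parts

lemma sum_perm_eq_ewensSum (θ : ℝ) (n : ℕ) (G : Multiset ℕ → E) :
    ∑ σ : Equiv.Perm (Fin n), θ ^ numCycles σ • G σ.partition.parts =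
      (n ! : ℝ) • ewensSum θ n G := by
  have key : ∀ σ : Equiv.Perm (Fin n), θ ^ numCycles σ • G σ.partition.parts =
      ∑ p : n.Partition, if σ.partition.parts = p.parts then
        θ ^ Multiset.card p.parts • G p.parts else 0 := by
    intro σ
    have hs : σ.partition.parts.sum = n := by rw [σ.partition.parts_sum, Fintype.card_fin]
    let q : n.Partition := ⟨σ.partition.parts, fun h => σ.partition.parts_pos h, hs⟩
    rw [Finset.sum_eq_single q]
    · simp [q, numCycles]
    · intro b _ hb
      rw [if_neg]
      intro h
      exact hb (Nat.Partition.ext h.symm)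
    · simp
  simp_rw [key]
  rw [Finset.sum_comm, ewensSum, Finset.smul_sum]
  refine Finset.sum_congr rfl fun p _ => ?_
  rw [← Finset.sum_filter, Finset.sum_const, ← Nat.cast_smul_eq_nsmul ℝ, smul_smul, smul_smul]
  congr 1
  have h := card_partition_eq n p
  have hz : (centralizerSize p.parts : ℝ) ≠ 0 := by
    exact_mod_cast (centralizerSize_pos fun j hj => p.parts_pos hj).ne'
  field_simp
  rw [← h]
  push_cast
  ring

/-- Summation over a distinguished cycle: the cycle and the remaining permutation. -/
lemma ewensSum_sum_erase (θ : ℝ) (n : ℕ) (G : ℕ → Multiset ℕ → E) :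
    ewensSum θ n (fun s => (s.map fun j => G j (s.erase j)).sum) =
      ∑ j ∈ Finset.Icc 1 n, (θ / j) • ewensSum θ (n - j) (G j) := by
  have h1 : ∀ p : n.Partition, (p.parts.map fun j => G j (p.parts.erase j)).sum =
      ∑ j ∈ Finset.Icc 1 n, if j ∈ p.parts then p.parts.count j • G j (p.parts.erase j) else 0 := by
    intro p
    rw [Finset.sum_multiset_map_count, ← Finset.sum_filter]
    apply Finset.sum_congr _ fun _ _ => rfl
    ext j
    simp only [Multiset.mem_toFinset, Finset.mem_filter, Finset.mem_Icc]
    exact ⟨fun h => ⟨⟨p.parts_pos h, p.le_of_mem_parts h⟩, h⟩, fun h => h.2⟩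
  simp only [ewensSum, h1, Finset.smul_sum]
  rw [Finset.sum_comm]
  refine Finset.sum_congr rfl fun j hj => ?_
  rw [Finset.mem_Icc] at hj
  simp only [smul_ite, smul_zero]
  have hθ : ∀ q : (n - j).Partition, (θ / j) •
      (θ ^ Multiset.card q.parts / centralizerSize q.parts) • G j q.parts =
      (θ ^ Multiset.card (j ::ₘ q.parts) / centralizerSize (j ::ₘ q.parts)) •
        (j ::ₘ q.parts).count j • G j ((j ::ₘ q.parts).erase j) := by
    intro q
    rw [Multiset.erase_cons_head, ← Nat.cast_smul_eq_nsmul ℝ, smul_smul, smul_smul]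
    congr 1
    have hz : (centralizerSize q.parts : ℝ) ≠ 0 := by
      exact_mod_cast (centralizerSize_pos fun j hj => q.parts_pos hj).ne'
    have hj0 : (j : ℝ) ≠ 0 := by exact_mod_cast (by omega : j ≠ 0)
    have hc : (((j ::ₘ q.parts).count j : ℕ) : ℝ) ≠ 0 := by simp; positivity
    rw [centralizerSize_cons, Multiset.card_cons]
    push_cast at hc ⊢
    field_simp
    ring
  simp_rw [hθ]
  rw [← Finset.sum_filter]
  symm
  refine Finset.sum_bij (fun q _ =>
    ((Nat.Partition.partitionWithPartEquiv hj.1 hj.2).symm q).1) ?_ ?_ ?_ ?_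
  · intro q _
    simp
  · intro q _ q' _ h
    exact (Nat.Partition.partitionWithPartEquiv hj.1 hj.2).symm.injective (Subtype.ext h)
  · intro p hp
    refine ⟨Nat.Partition.partitionWithPartEquiv hj.1 hj.2
      ⟨p, (Finset.mem_filter.1 hp).2⟩, Finset.mem_univ _, ?_⟩
    rw [Equiv.symm_apply_apply]
  · intro q _
    rw [Nat.Partition.partitionWithPartEquiv_symm_apply_parts]

lemma ewensSum_congr {θ : ℝ} {n : ℕ} {G G' : Multiset ℕ → E}
    (h : ∀ s : Multiset ℕ, s.sum = n → (∀ j ∈ s, 0 < j) → G s = G' s) :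
    ewensSum θ n G = ewensSum θ n G' :=
  Finset.sum_congr rfl fun p _ => by rw [h p.parts p.parts_sum fun _ hj => p.parts_pos hj]

lemma ewensSum_add (θ : ℝ) (n : ℕ) (G G' : Multiset ℕ → E) :
    ewensSum θ n (fun s => G s + G' s) = ewensSum θ n G + ewensSum θ n G' := by
  simp [ewensSum, Finset.sum_add_distrib]

lemma ewensSum_sum {ι : Type*} (θ : ℝ) (n : ℕ) (t : Finset ι) (G : ι → Multiset ℕ → E) :
    ewensSum θ n (fun s => ∑ i ∈ t, G i s) = ∑ i ∈ t, ewensSum θ n (G i) := by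
  simp only [ewensSum, Finset.smul_sum]
  exact Finset.sum_comm

lemma ewensSum_const_mul {A : Type*} [Ring A] [Algebra ℝ A] (θ : ℝ) (n : ℕ) (c : A)
    (G : Multiset ℕ → A) : ewensSum θ n (fun s => c * G s) = c * ewensSum θ n G := by
  simp only [ewensSum, Finset.mul_sum, mul_smul_comm]

lemma weight_nonneg {θ : ℝ} (hθ : 0 ≤ θ) {n : ℕ} (p : n.Partition) :
    0 ≤ θ ^ Multiset.card p.parts / (centralizerSize p.parts : ℝ) := by positivity

lemma ewensSum_mono {θ : ℝ} (hθ : 0 ≤ θ) {n : ℕ} {G G' : Multiset ℕ → ℝ}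
    (h : ∀ s : Multiset ℕ, s.sum = n → (∀ j ∈ s, 0 < j) → G s ≤ G' s) :
    ewensSum θ n G ≤ ewensSum θ n G' :=
  Finset.sum_le_sum fun p _ => smul_le_smul_of_nonneg_left
    (h p.parts p.parts_sum fun _ hj => p.parts_pos hj) (weight_nonneg hθ p)

lemma ewensSum_nonneg {θ : ℝ} (hθ : 0 ≤ θ) {n : ℕ} {G : Multiset ℕ → ℝ}
    (h : ∀ s, 0 ≤ G s) : 0 ≤ ewensSum θ n G :=
  Finset.sum_nonneg fun p _ => smul_nonneg (weight_nonneg hθ p) (h _)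

lemma norm_ewensSum_le {θ : ℝ} (hθ : 0 ≤ θ) {n : ℕ} (G : Multiset ℕ → ℂ) :
    ‖ewensSum θ n G‖ ≤ ewensSum θ n fun s => ‖G s‖ := by
  refine (norm_sum_le _ _).trans_eq (Finset.sum_congr rfl fun p _ => ?_)
  rw [norm_smul, Real.norm_of_nonneg (weight_nonneg hθ p), smul_eq_mul]

lemma ewensSum_ofReal (θ : ℝ) (n : ℕ) (G : Multiset ℕ → ℝ) :
    ewensSum θ n (fun s => (G s : ℂ)) = (ewensSum θ n G : ℝ) := by
  simp [ewensSum]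

lemma ewensSum_zero (θ : ℝ) (G : Multiset ℕ → E) : ewensSum θ 0 G = G 0 := by
  rw [ewensSum, Fintype.sum_unique]
  simp [centralizerSize]

/-- The coefficients `c_n` of `exp (θ ∑_j f(j) z ^ j / j)`, that is, the sums over `S_n` of the
multiplicative function given by `f`. -/
noncomputable def mulCoeff {A : Type*} [CommRing A] [Module ℝ A] (θ : ℝ) (f : ℕ → A) (n : ℕ) : A :=
  ewensSum θ n fun s => (s.map f).prod

lemma sum_map_natCast {R : Type*} [CommRing R] (s : Multiset ℕ) :
    (s.map (Nat.cast : ℕ → R)).sum = (s.sum : R) := by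
  induction s using Multiset.induction_on with
  | empty => simp
  | cons a s ih => rw [Multiset.map_cons, Multiset.sum_cons, Multiset.sum_cons, Nat.cast_add, ih]

section mulCoeff

variable {A : Type*} [CommRing A] [Algebra ℝ A]

lemma mulCoeff_zero (θ : ℝ) (f : ℕ → A) : mulCoeff θ f 0 = 1 := by
  simp [mulCoeff, ewensSum_zero]

/-- Writing `n` as the sum of the cycle lengths singles out one cycle; its length cancels the `1 /
j` of `ewensSum_sum_erase`. This is the coefficient form of `z F' = θ (∑ f(j) z ^ j) F`. -/
lemma natCast_mul_mulCoeff (θ : ℝ) (f : ℕ → A) (n : ℕ) :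
    (n : A) * mulCoeff θ f n = ∑ j ∈ Finset.Icc 1 n, θ • (f j * mulCoeff θ f (n - j)) := by
  have h := ewensSum_sum_erase θ n (fun j s => (j : A) * f j * (s.map f).prod)
  rw [mulCoeff, ← ewensSum_const_mul]
  rw [ewensSum_congr (G' := fun s => (n : A) * (s.map f).prod)] at h
  · rw [h]
    refine Finset.sum_congr rfl fun j hj => ?_
    have hj0 : (j : ℝ) ≠ 0 := by
      have := (Finset.mem_Icc.1 hj).1
      exact_mod_cast (by omega : j ≠ 0)
    rw [ewensSum_const_mul, mulCoeff, mul_assoc, ← nsmul_eq_mul, ← Nat.cast_smul_eq_nsmul ℝ,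
      smul_smul, div_mul_cancel₀ _ hj0]
  · intro s hs _
    show (s.map _).sum = _
    rw [← hs, ← sum_map_natCast, ← Multiset.sum_map_mul_right]
    congr 1
    refine Multiset.map_congr rfl fun j hj => ?_
    rw [mul_assoc, ← Multiset.prod_cons, ← Multiset.map_cons, Multiset.cons_erase hj]

lemma natCast_mul_mulCoeff_range (θ : ℝ) (f : ℕ → A) (n : ℕ) :
    (n : A) * mulCoeff θ f n = ∑ k ∈ Finset.range n, θ • (f (n - k) * mulCoeff θ f k) := by
  rw [natCast_mul_mulCoeff]
  refine Finset.sum_bij' (fun j _ => n - j) (fun k _ => n - k) ?_ ?_ ?_ ?_ ?_ <;>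
    simp only [Finset.mem_Icc, Finset.mem_range]
  · intros; omega
  · intros; omega
  · intros; omega
  · intros; omega
  · intro j hj
    rw [show n - (n - j) = j by omega]

lemma mulCoeff_congr {θ : ℝ} {f g : ℕ → A} {n : ℕ} (h : ∀ j, 1 ≤ j → j ≤ n → f j = g j) :
    mulCoeff θ f n = mulCoeff θ g n := by
  refine ewensSum_congr fun s hs hp => ?_
  congr 1
  exact Multiset.map_congr rfl fun j hj =>
    h j (hp j hj) (hs ▸ Multiset.le_sum_of_mem hj)

end mulCoeff

lemma mulCoeff_nonneg {θ : ℝ} (hθ : 0 ≤ θ) {f : ℕ → ℝ} (hf : ∀ j, 0 ≤ f j) (n : ℕ) :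
    0 ≤ mulCoeff θ f n :=
  ewensSum_nonneg hθ fun _ => Multiset.prod_nonneg (by simpa using fun j _ => hf j)

lemma mulCoeff_mono {θ : ℝ} (hθ : 0 ≤ θ) {f g : ℕ → ℝ} (hf : ∀ j, 0 ≤ f j)
    (hfg : ∀ j, f j ≤ g j) (n : ℕ) : mulCoeff θ f n ≤ mulCoeff θ g n :=
  ewensSum_mono hθ fun _ _ _ => Multiset.prod_map_le_prod_map₀ _ _
    (fun j _ => hf j) (fun j _ => hfg j)

lemma norm_mulCoeff_le {θ : ℝ} (hθ : 0 ≤ θ) {f : ℕ → ℂ} {g : ℕ → ℝ}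
    (hfg : ∀ j, ‖f j‖ ≤ g j) (n : ℕ) : ‖mulCoeff θ f n‖ ≤ mulCoeff θ g n := by
  refine (norm_ewensSum_le hθ _).trans (ewensSum_mono hθ fun s _ _ => ?_)
  rw [show ‖(s.map f).prod‖ = (s.map fun j => ‖f j‖).prod from
    (map_multiset_prod (normHom : ℂ →*₀ ℝ) _).trans (by simp)]
  exact Multiset.prod_map_le_prod_map₀ _ _ (fun j _ => norm_nonneg _) (fun j _ => hfg j)

/-- The coefficients of `(1 - z) ^ (-θ)`, the total masses `θ (θ + 1) ⋯ (θ + n - 1) / n!`. -/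
noncomputable def mass (θ : ℝ) (n : ℕ) : ℝ := ewensSum θ n fun _ => (1 : ℝ)

lemma mass_eq_mulCoeff (θ : ℝ) (n : ℕ) : mass θ n = mulCoeff θ (fun _ => (1 : ℝ)) n := by
  simp [mass, mulCoeff]

lemma mass_zero (θ : ℝ) : mass θ 0 = 1 := by rw [mass, ewensSum_zero]

lemma natCast_mul_mass (θ : ℝ) (n : ℕ) :
    n * mass θ n = θ * ∑ k ∈ Finset.range n, mass θ k := by
  simp_rw [mass_eq_mulCoeff]
  rw [natCast_mul_mulCoeff_range, Finset.mul_sum]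
  simp

lemma mass_succ (θ : ℝ) (n : ℕ) : (n + 1) * mass θ (n + 1) = (θ + n) * mass θ n := by
  have h := natCast_mul_mass θ (n + 1)
  rw [Finset.sum_range_succ, mul_add, ← natCast_mul_mass] at h
  push_cast at h
  linarith

lemma mass_eq (θ : ℝ) (n : ℕ) : mass θ n = (ascPochhammer ℝ n).eval θ / n ! := by
  induction n with
  | zero => simp [mass_zero]
  | succ n ih =>
    have h := mass_succ θ n
    rw [ih] at h
    rw [ascPochhammer_succ_eval, Nat.factorial_succ]
    push_cast
    have : (n ! : ℝ) ≠ 0 := by positivity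
    have : (n : ℝ) + 1 ≠ 0 := by positivity
    field_simp at h ⊢
    linarith

lemma mass_pos {θ : ℝ} (hθ : 0 < θ) (n : ℕ) : 0 < mass θ n := by
  induction n with
  | zero => simp [mass_zero]
  | succ n ih =>
    have h := mass_succ θ n
    have h2 : 0 < (n + 1) * mass θ (n + 1) := by rw [h]; positivity
    exact pos_of_mul_pos_right h2 (by positivity)

lemma mass_mono {θ : ℝ} (hθ : 1 ≤ θ) : Monotone (mass θ) := by
  refine monotone_nat_of_le_succ fun n => ?_
  have h := mass_succ θ n
  have h2 := mass_pos (by linarith : 0 < θ) n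
  have h3 : ((n : ℝ) + 1) * mass θ n ≤ (n + 1) * mass θ (n + 1) := by
    rw [h]; nlinarith
  exact le_of_mul_le_mul_left h3 (by positivity)

lemma ewens_eq (θ : ℝ) (n : ℕ) (p : Multiset ℕ → Prop) [DecidablePred p] :
    ewens θ n {σ | p σ.partition.parts} =
      (ewensSum θ n fun s => if p s then (1 : ℝ) else 0) / mass θ n := by
  have h := sum_perm_eq_ewensSum θ n (fun s => if p s then (1 : ℝ) else 0)
  have hn : (n ! : ℝ) ≠ 0 := by positivity
  rw [ewens, mass_eq, Finset.sum_filter]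
  simp only [Set.mem_ofPred_eq]
  simp only [smul_eq_mul, mul_ite, mul_one, mul_zero] at h
  rw [div_div_eq_mul_div, mul_comm (ewensSum _ _ _), ← h]
  congr 1
  exact Finset.sum_congr rfl fun σ _ => by congr

/-- The value `∑_{j ∈ s} a_j` of the additive function given by `a`. -/
def additiveSum (a : ℕ → ℤ) (s : Multiset ℕ) : ℤ := (s.map a).sum

lemma additiveFun_eq (n : ℕ) (a : ℕ → ℤ) (σ : Equiv.Perm (Fin n)) :
    additiveFun n a σ = additiveSum a σ.partition.parts := by
  rw [additiveFun, additiveSum, Finset.sum_multiset_map_count]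
  have hs : σ.partition.parts.sum = n := by rw [σ.partition.parts_sum, Fintype.card_fin]
  symm
  apply Finset.sum_subset_zero_on_sdiff
  · intro j hj
    rw [Multiset.mem_toFinset] at hj
    rw [Finset.mem_Icc]
    exact ⟨σ.partition.parts_pos hj, hs ▸ Multiset.le_sum_of_mem hj⟩
  · intro j hj
    simp only [Finset.mem_sdiff, Multiset.mem_toFinset] at hj
    simp [cycleCount, hj.2]
  · intro j _
    simp [cycleCount, mul_comm]

lemma distrFun_eq (θ : ℝ) (n : ℕ) (a : ℕ → ℤ) (x : ℝ) :
    distrFun θ n a x =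
      (ewensSum θ n fun s => if (additiveSum a s : ℝ) < x then (1 : ℝ) else 0) / mass θ n := by
  rw [distrFun]
  simp_rw [additiveFun_eq]
  exact ewens_eq θ n fun s => (additiveSum a s : ℝ) < x

attribute [irreducible] ewensSum mulCoeff mass

/-! ### The exponential generating function. -/

/-- The logarithm `∑_{j ≤ n} f(j) z ^ j / j` of the generating function, up to the factor `θ`. -/
noncomputable def logSeries (f : ℕ → ℂ) (n : ℕ) (z : ℂ) : ℂ := ∑ j ∈ Finset.Icc 1 n, f j * z ^ j / j

lemma hasDerivAt_logSeries (f : ℕ → ℂ) (n : ℕ) (z : ℂ) :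
    HasDerivAt (logSeries f n) (∑ j ∈ Finset.range n, f (j + 1) * z ^ j) z := by
  have h : ∀ j ∈ Finset.Icc 1 n, HasDerivAt (fun z : ℂ => f j * z ^ j / j)
      (f j * z ^ (j - 1)) z := by
    intro j hj
    have hj0 : (j : ℂ) ≠ 0 := by
      have := (Finset.mem_Icc.1 hj).1
      exact_mod_cast (by omega : j ≠ 0)
    refine (((hasDerivAt_pow j z).const_mul (f j)).div_const (j : ℂ)).congr_deriv ?_
    field_simp
  refine (HasDerivAt.fun_sum h).congr_deriv ?_
  refine Finset.sum_bij' (fun j _ => j - 1) (fun j _ => j + 1) ?_ ?_ ?_ ?_ ?_ <;>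
    simp only [Finset.mem_Icc, Finset.mem_range]
  · intros; omega
  · intros; omega
  · intros; omega
  · intros; omega
  · intro j hj
    rw [show j - 1 + 1 = j by omega]

lemma iteratedDeriv_derivLogSeries {f : ℕ → ℂ} {n : ℕ} (hf : ∀ j, n < j → f j = 0) (i : ℕ) :
    iteratedDeriv i (fun z : ℂ => ∑ j ∈ Finset.range n, f (j + 1) * z ^ j) 0 = i ! * f (i + 1) := by
  rw [iteratedDeriv_fun_sum fun j _ => by fun_prop]
  simp_rw [iteratedDeriv_const_mul_field, iteratedDeriv_fun_pow_zero]
  by_cases hi : i < n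
  · rw [Finset.sum_eq_single_of_mem i (Finset.mem_range.2 hi)]
    · simp [mul_comm]
    · intro b _ hb
      simp [hb.symm]
  · rw [hf (i + 1) (by omega), mul_zero]
    refine Finset.sum_eq_zero fun j hj => ?_
    have := Finset.mem_range.1 hj
    simp [show i ≠ j by omega]

/-- The Leibniz rule applied to `F' = θ P' F` reproduces the recursion `natCast_mul_mulCoeff_range`.
Since `f` vanishes beyond `n`, `P` is a polynomial and `F` is entire, so no radius of convergence
intervenes. -/
lemma iteratedDeriv_exp_logSeries {θ : ℝ} {f : ℕ → ℂ} {n : ℕ} (hf : ∀ j, n < j → f j = 0)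
    (k : ℕ) : iteratedDeriv k (fun z => Complex.exp (θ * logSeries f n z)) 0 =
      k ! * mulCoeff θ f k := by
  induction k using Nat.strong_induction_on with
  | _ k ih =>
  cases k with
  | zero =>
    rw [iteratedDeriv_zero, mulCoeff_zero, logSeries, Finset.sum_eq_zero]
    · simp
    · intro j hj
      have := (Finset.mem_Icc.1 hj).1
      simp [show j ≠ 0 by omega]
  | succ k =>
    have hd : deriv (fun z => Complex.exp (θ * logSeries f n z)) = fun z =>
        Complex.exp (θ * logSeries f n z) *
          (θ * ∑ j ∈ Finset.range n, f (j + 1) * z ^ j) := by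
      funext z
      exact (((hasDerivAt_logSeries f n z).const_mul (θ : ℂ)).cexp).deriv
    have hP : ContDiff ℂ k (logSeries f n) := by unfold logSeries; fun_prop
    rw [iteratedDeriv_succ', hd, iteratedDeriv_fun_mul (by fun_prop) (by fun_prop),
      Nat.factorial_succ]
    have := natCast_mul_mulCoeff_range θ f (k + 1)
    push_cast at this ⊢
    rw [mul_assoc, mul_left_comm, this, Finset.mul_sum]
    refine Finset.sum_congr rfl fun i hi => ?_
    have hi : i ≤ k := by simpa [Nat.lt_succ_iff] using hi
    rw [ih i (by omega), iteratedDeriv_const_mul_field, iteratedDeriv_derivLogSeries hf,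
      ← Nat.choose_mul_factorial_mul_factorial hi, show k + 1 - i = k - i + 1 by omega]
    rw [Complex.real_smul]
    push_cast
    ring

lemma hasSum_mulCoeff {θ : ℝ} {f : ℕ → ℂ} {n : ℕ} (hf : ∀ j, n < j → f j = 0) (z : ℂ) :
    HasSum (fun k => mulCoeff θ f k * z ^ k) (Complex.exp (θ * logSeries f n z)) := by
  have hP : Differentiable ℂ (logSeries f n) := fun z =>
    (hasDerivAt_logSeries f n z).differentiableAt
  have h := Complex.hasSum_taylorSeries_of_entire
    (f := fun z => Complex.exp (θ * logSeries f n z)) (by fun_prop) 0 z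
  refine h.congr_fun fun k => ?_
  rw [iteratedDeriv_exp_logSeries hf]
  have : (k ! : ℂ) ≠ 0 := by exact_mod_cast k.factorial_ne_zero
  simp only [sub_zero, smul_eq_mul]
  field_simp

lemma mulCoeff_ofReal (θ : ℝ) (f : ℕ → ℝ) (k : ℕ) :
    mulCoeff θ (fun j => (f j : ℂ)) k = (mulCoeff θ f k : ℝ) := by
  rw [mulCoeff, mulCoeff, ← ewensSum_ofReal]
  refine ewensSum_congr fun s _ _ => ?_
  rw [show ((s.map f).prod : ℂ) = Complex.ofRealHom (s.map f).prod from rfl, map_multiset_prod]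
  simp

lemma hasSum_mulCoeff_real {θ : ℝ} {f : ℕ → ℝ} {n : ℕ} (hf : ∀ j, n < j → f j = 0) :
    HasSum (mulCoeff θ f) (Real.exp (θ * ∑ j ∈ Finset.Icc 1 n, f j / j)) := by
  have h := hasSum_mulCoeff (θ := θ) (f := fun j => (f j : ℂ)) (n := n)
    (fun j hj => by simp [hf j hj]) 1
  rw [← Complex.hasSum_ofReal]
  convert h using 2
  · simp [mulCoeff_ofReal]
  · simp [logSeries]

/-! ### Parseval's identity on the circle. -/

section Parseval

open AddCircle

lemma integral_norm_sq_of_hasSum {T : ℝ} [hT : Fact (0 < T)] {c : ℕ → ℂ}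
    {F : C(AddCircle T, ℂ)}
    (hF : HasSum (fun k : ℕ => c k • (fourier (k : ℤ) : C(AddCircle T, ℂ))) F) :
    HasSum (fun k => ‖c k‖ ^ 2) (∫ x, ‖F x‖ ^ 2 ∂(haarAddCircle (T := T))) := by
  set f : Lp ℂ 2 (haarAddCircle (T := T)) := ContinuousMap.toLp 2 haarAddCircle ℂ F with hf
  have h1 : HasSum
      (fun k : ℕ => c k • (fourierLp 2 (k : ℤ) : Lp ℂ 2 (haarAddCircle (T := T)))) f := by
    have := hF.mapL (ContinuousMap.toLp (E := ℂ) 2 (haarAddCircle (T := T)) ℂ)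
    simpa only [map_smul] using this
  have h2 : ∀ i : ℤ, fourierCoeff (T := T) f i = if 0 ≤ i then c i.toNat else 0 := by
    intro i
    rw [← fourierBasis_repr]
    have hL : HasSum (fun k : ℕ => if (k : ℤ) = i then c k else 0)
        ((fourierBasis (T := T)).repr f i) := by
      let Λ : Lp ℂ 2 (haarAddCircle (T := T)) →L[ℂ] ℂ :=
        (lp.evalCLM ℂ (fun _ : ℤ => ℂ) 2 i).comp
          (fourierBasis (T := T)).repr.toContinuousLinearEquiv.toContinuousLinearMap
      have hΛ : ∀ g, Λ g = (fourierBasis (T := T)).repr g i := fun _ => rfl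
      refine (h1.mapL Λ).congr_fun fun k => ?_
      rw [map_smul, hΛ, ← coe_fourierBasis, HilbertBasis.repr_self, lp.single_apply,
        Pi.single_apply]
      by_cases h : (k : ℤ) = i
      · simp [h]
      · simp [h, Ne.symm h]
    refine hL.unique ?_
    split_ifs with hi
    · convert hasSum_ite_eq i.toNat (c i.toNat) using 2 with k
      by_cases hk : k = i.toNat
      · simp [hk, hi]
      · rw [if_neg hk, if_neg (by omega)]
    · convert hasSum_zero using 2 with k
      rw [if_neg (by omega)]
  have h3 := hasSum_sq_fourierCoeff f
  have h4 : (∫ x, ‖f x‖ ^ 2 ∂(haarAddCircle (T := T))) =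
      ∫ x, ‖F x‖ ^ 2 ∂(haarAddCircle (T := T)) := by
    refine integral_congr_ae ?_
    filter_upwards [ContinuousMap.coeFn_toLp (p := 2) (𝕜 := ℂ) haarAddCircle F] with x hx
    rw [hf, hx]
  rw [h4] at h3
  have hinj : Function.Injective (fun k : ℕ => (k : ℤ)) := Nat.cast_injective
  rw [← hinj.hasSum_iff] at h3
  · convert h3 using 2 with k
    simp [h2]
  · intro i hi
    rw [h2, if_neg]
    · simp
    · intro h
      exact hi ⟨i.toNat, by simp [h]⟩

end Parseval

/-! ### Growth of the total masses, and a mean square estimate. -/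

lemma prod_range_add_eq_mass (β : ℝ) (n : ℕ) :
    ∏ j ∈ Finset.range n, (β + j) = mass β n * n ! := by
  induction n with
  | zero => simp [mass_zero]
  | succ n ih =>
    rw [Finset.prod_range_succ, ih, Nat.factorial_succ]
    have := mass_succ β n
    push_cast
    linear_combination -((n ! : ℝ)) * this

/-- This is Euler's limit formula for the Gamma function, up to the factor `n / (n + β)` coming from
its additional last term. -/
lemma tendsto_mass_div_rpow {β : ℝ} (hβ : 0 < β) :
    Tendsto (fun n : ℕ => mass β n / (n : ℝ) ^ (β - 1)) atTop (𝓝 (Real.Gamma β)⁻¹) := by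
  have h1 := (Real.GammaSeq_tendsto_Gamma β).inv₀ (Real.Gamma_pos_of_pos hβ).ne'
  have h2 : Tendsto (fun n : ℕ => (n : ℝ) / (n + β)) atTop (𝓝 1) :=
    tendsto_natCast_div_add_atTop β
  have h3 := h1.mul h2
  rw [mul_one] at h3
  refine h3.congr' ?_
  filter_upwards [eventually_gt_atTop 0] with n hn
  have hn' : (0 : ℝ) < n := by exact_mod_cast hn
  rw [Real.GammaSeq, Finset.prod_range_succ, prod_range_add_eq_mass, Real.rpow_sub_one hn'.ne']
  have := Real.rpow_pos_of_pos hn' β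
  have : (n ! : ℝ) ≠ 0 := by positivity
  field_simp
  ring

/-- A convergent sequence of positive numbers with positive limit is bounded above and away from
zero. The shift `n + 1` lets the bounds include `n = 0`. -/
lemma exists_mass_bounds {β : ℝ} (hβ : 0 < β) : ∃ c C : ℝ, 0 < c ∧ 0 < C ∧ ∀ n : ℕ,
    c * ((n : ℝ) + 1) ^ (β - 1) ≤ mass β n ∧ mass β n ≤ C * ((n : ℝ) + 1) ^ (β - 1) := by
  have h0 : Tendsto (fun n : ℕ => ((n : ℝ) / (n + 1)) ^ (β - 1)) atTop (𝓝 1) := by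
    have := (tendsto_natCast_div_add_atTop (1 : ℝ)).rpow_const (p := β - 1) (Or.inl one_ne_zero)
    simpa using this
  have hG := (Real.Gamma_pos_of_pos hβ).ne'
  have h1 : Tendsto (fun n : ℕ => mass β n / ((n : ℝ) + 1) ^ (β - 1)) atTop
      (𝓝 (Real.Gamma β)⁻¹) := by
    have := (tendsto_mass_div_rpow hβ).mul h0
    rw [mul_one] at this
    refine this.congr' ?_
    filter_upwards [eventually_gt_atTop 0] with n hn
    have hn' : (0 : ℝ) < n := by exact_mod_cast hn
    rw [Real.div_rpow hn'.le (by positivity)]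
    have := Real.rpow_pos_of_pos hn' (β - 1)
    field_simp
  obtain ⟨C, hC⟩ := h1.bddAbove_range
  obtain ⟨D, hD⟩ := (h1.inv₀ (inv_ne_zero hG)).bddAbove_range
  have hpos : ∀ n : ℕ, 0 < mass β n / ((n : ℝ) + 1) ^ (β - 1) := fun n =>
    div_pos (mass_pos hβ n) (by positivity)
  have hC' : ∀ n : ℕ, mass β n / ((n : ℝ) + 1) ^ (β - 1) ≤ C := fun n => hC ⟨n, rfl⟩
  have hD' : ∀ n : ℕ, (mass β n / ((n : ℝ) + 1) ^ (β - 1))⁻¹ ≤ D := fun n => hD ⟨n, rfl⟩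
  have hD0 : 0 < D := (inv_pos.2 (hpos 0)).trans_le (hD' 0)
  refine ⟨D⁻¹, C, inv_pos.2 hD0, (hpos 0).trans_le (hC' 0), fun n => ⟨?_, ?_⟩⟩
  · rw [← le_div_iff₀ (by positivity)]
    exact inv_le_of_inv_le₀ (hpos n) (hD' n)
  · rw [← div_le_iff₀ (by positivity)]
    exact hC' n

lemma add_one_rpow_le {n : ℕ} (hn : 1 ≤ n) (e : ℝ) :
    ((n : ℝ) + 1) ^ e ≤ 2 ^ |e| * (n : ℝ) ^ e := by
  have hn' : (1 : ℝ) ≤ n := by exact_mod_cast hn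
  rw [← div_le_iff₀ (by positivity), ← Real.div_rpow (by positivity) (by positivity)]
  have h1 : (1 : ℝ) ≤ (n + 1) / n := by rw [le_div_iff₀ (by positivity)]; linarith
  have h2 : ((n : ℝ) + 1) / n ≤ 2 := by rw [div_le_iff₀ (by positivity)]; linarith
  exact (Real.rpow_le_rpow_of_exponent_le h1 (le_abs_self e)).trans
    (Real.rpow_le_rpow (by positivity) h2 (abs_nonneg e))

/-- The indicator function of `{j | j ≤ n}`. -/
noncomputable def cutoff (n j : ℕ) : ℝ := if j ≤ n then 1 else 0

lemma cutoff_nonneg (n j : ℕ) : 0 ≤ cutoff n j := by unfold cutoff; split_ifs <;> simp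

lemma cutoff_le_one (n j : ℕ) : cutoff n j ≤ 1 := by unfold cutoff; split_ifs <;> simp

lemma cutoff_of_lt {n j : ℕ} (h : n < j) : cutoff n j = 0 := if_neg (by omega)

lemma cutoff_of_le {n j : ℕ} (h : j ≤ n) : cutoff n j = 1 := if_pos h

lemma sum_inv_le_one_add_log {n : ℕ} : ∑ j ∈ Finset.Icc 1 n, 1 / (j : ℝ) ≤ 1 + Real.log n := by
  have := harmonic_le_one_add_log n
  rw [harmonic_eq_sum_Icc] at this
  push_cast at this
  simpa using this

lemma hasSum_mulCoeff_cutoff (β : ℝ) (n : ℕ) : HasSum (mulCoeff β (cutoff n))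
    (Real.exp (β * ∑ j ∈ Finset.Icc 1 n, 1 / (j : ℝ))) := by
  have := hasSum_mulCoeff_real (θ := β) (f := cutoff n) (n := n) (fun j hj => cutoff_of_lt hj)
  convert this using 4 with j hj
  rw [cutoff_of_le (Finset.mem_Icc.1 hj).2]

lemma mulCoeff_le_mass {β : ℝ} (hβ : 0 ≤ β) {f : ℕ → ℝ} (hf : ∀ j, 0 ≤ f j) (hf1 : ∀ j, f j ≤ 1)
    (n : ℕ) : mulCoeff β f n ≤ mass β n := by
  rw [mass_eq_mulCoeff]
  exact mulCoeff_mono hβ hf hf1 n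

/-- The square sum of the coefficients of `exp (β ∑_{j ≤ n} z ^ j / j)`. -/
lemma exists_sum_sq_mulCoeff_cutoff_le {β : ℝ} (hβ : 1 / 2 < β) : ∃ C : ℝ, 0 < C ∧ ∀ n : ℕ, 1 ≤ n →
    ∀ M : ℕ, ∑ k ∈ Finset.range M, mulCoeff β (cutoff n) k ^ 2 ≤ C * (n : ℝ) ^ (2 * β - 1) := by
  have hβ0 : 0 < β := by linarith
  obtain ⟨c₁, C₁, hc₁, hC₁, hb₁⟩ := exists_mass_bounds hβ0
  obtain ⟨c₂, C₂, hc₂, hC₂, hb₂⟩ := exists_mass_bounds (β := 2 * β - 1) (by linarith)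
  have hcoef : ∀ n k, 0 ≤ mulCoeff β (cutoff n) k := fun n k =>
    mulCoeff_nonneg hβ0.le (cutoff_nonneg n) k
  -- For indices below `n` the coefficient is at most `mass β k`, whose square is of the order of
  -- `mass (2 * β - 1) k`; these are summed exactly by `natCast_mul_mass`. Here `1 / 2 < β` is
  -- needed.
  have hsmall : ∃ D : ℝ, 0 < D ∧ ∀ n : ℕ, 1 ≤ n →
      ∑ k ∈ Finset.range n, mulCoeff β (cutoff n) k ^ 2 ≤ D * (n : ℝ) ^ (2 * β - 1) := by
    have hγ : 0 < 2 * β - 1 := by linarith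
    refine ⟨C₁ ^ 2 * c₂⁻¹ * (2 * β - 1)⁻¹ * C₂ * 2 ^ |2 * β - 1 - 1|, by positivity,
      fun n hn => ?_⟩
    have hn' : (0 : ℝ) < n := by exact_mod_cast hn
    have hterm : ∀ k ∈ Finset.range n, mulCoeff β (cutoff n) k ^ 2 ≤
        C₁ ^ 2 * c₂⁻¹ * mass (2 * β - 1) k := by
      intro k _
      have h1 : mulCoeff β (cutoff n) k ≤ C₁ * ((k : ℝ) + 1) ^ (β - 1) :=
        (mulCoeff_le_mass hβ0.le (cutoff_nonneg n) (cutoff_le_one n) k).trans (hb₁ k).2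
      have h2 := (hb₂ k).1
      have h3 : (((k : ℝ) + 1) ^ (β - 1)) ^ 2 = ((k : ℝ) + 1) ^ (2 * β - 1 - 1) := by
        rw [← Real.rpow_natCast, ← Real.rpow_mul (by positivity)]
        congr 1
        push_cast
        ring
      calc mulCoeff β (cutoff n) k ^ 2 ≤ (C₁ * ((k : ℝ) + 1) ^ (β - 1)) ^ 2 :=
            pow_le_pow_left₀ (hcoef n k) h1 2
        _ = C₁ ^ 2 * c₂⁻¹ * (c₂ * ((k : ℝ) + 1) ^ (2 * β - 1 - 1)) := by
            rw [mul_pow, h3]; field_simp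
        _ ≤ _ := by gcongr
    refine (Finset.sum_le_sum hterm).trans ?_
    rw [← Finset.mul_sum]
    have h4 := natCast_mul_mass (2 * β - 1) n
    have h5 : ∑ k ∈ Finset.range n, mass (2 * β - 1) k =
        (2 * β - 1)⁻¹ * (n * mass (2 * β - 1) n) := by rw [h4]; field_simp
    have h6 : (n : ℝ) ^ (2 * β - 1) = n * (n : ℝ) ^ (2 * β - 1 - 1) := by
      rw [Real.rpow_sub_one hn'.ne' (2 * β - 1)]; field_simp
    rw [h5, h6]
    calc _ ≤ C₁ ^ 2 * c₂⁻¹ * ((2 * β - 1)⁻¹ *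
          (n * (C₂ * (2 ^ |2 * β - 1 - 1| * (n : ℝ) ^ (2 * β - 1 - 1))))) := by
          gcongr
          refine (hb₂ n).2.trans ?_
          gcongr
          exact add_one_rpow_le hn _
      _ = _ := by ring
  -- From `n` on, the recursion bounds `k` times the coefficient by `β` times the sum of all
  -- coefficients, which is at most `(e n) ^ β`; then `∑ 1 / k ^ 2` over `k ≥ n` is at most `2 / n`.
  have hlarge : ∃ D : ℝ, 0 < D ∧ ∀ n : ℕ, 1 ≤ n → ∀ M,
      ∑ k ∈ Finset.Ioo (n - 1) M, mulCoeff β (cutoff n) k ^ 2 ≤ D * (n : ℝ) ^ (2 * β - 1) := by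
    refine ⟨(β * Real.exp β) ^ 2 * 2, by positivity, fun n hn M => ?_⟩
    have hn' : (0 : ℝ) < n := by exact_mod_cast hn
    have hterm : ∀ k ∈ Finset.Ioo (n - 1) M, mulCoeff β (cutoff n) k ^ 2 ≤
        (β * Real.exp β * (n : ℝ) ^ β) ^ 2 * ((k : ℝ) ^ 2)⁻¹ := by
      intro k hk
      have hk1 : 1 ≤ k := by have := (Finset.mem_Ioo.1 hk).1; omega
      have hk' : (0 : ℝ) < k := by exact_mod_cast hk1
      have h1 : k * mulCoeff β (cutoff n) k ≤ β * Real.exp β * (n : ℝ) ^ β := by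
        rw [natCast_mul_mulCoeff_range]
        calc ∑ i ∈ Finset.range k, β • (cutoff n (k - i) * mulCoeff β (cutoff n) i)
            ≤ ∑ i ∈ Finset.range k, β * mulCoeff β (cutoff n) i := by
              refine Finset.sum_le_sum fun i _ => ?_
              rw [smul_eq_mul]
              have := cutoff_le_one n (k - i)
              have := hcoef n i
              gcongr
              nlinarith
          _ = β * ∑ i ∈ Finset.range k, mulCoeff β (cutoff n) i := by rw [Finset.mul_sum]
          _ ≤ β * Real.exp (β * ∑ j ∈ Finset.Icc 1 n, 1 / (j : ℝ)) := by
              gcongr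
              exact sum_le_hasSum _ (fun i _ => hcoef n i) (hasSum_mulCoeff_cutoff β n)
          _ ≤ β * Real.exp (β * (1 + Real.log n)) := by
              gcongr
              exact sum_inv_le_one_add_log
          _ = _ := by
              rw [mul_add, mul_one, Real.exp_add, Real.rpow_def_of_pos hn', mul_comm β (Real.log n)]
              ring
      rw [← div_eq_mul_inv, ← div_pow]
      have := hcoef n k
      gcongr
      rw [le_div_iff₀ hk']
      linarith
    refine (Finset.sum_le_sum hterm).trans ?_
    rw [← Finset.mul_sum]
    have h2 := sum_Ioo_inv_sq_le (α := ℝ) (n - 1) M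
    have h3 : (((n - 1 : ℕ) : ℝ) + 1) = n := by
      rw [← Nat.cast_add_one, Nat.sub_add_cancel hn]
    rw [h3] at h2
    have h4 : (n : ℝ) ^ (2 * β - 1) = ((n : ℝ) ^ β) ^ 2 / n := by
      rw [Real.rpow_sub_one hn'.ne', mul_comm 2 β, Real.rpow_mul hn'.le, Real.rpow_two]
    calc _ ≤ (β * Real.exp β * (n : ℝ) ^ β) ^ 2 * (2 / n) := by gcongr
      _ = _ := by rw [h4]; ring
  obtain ⟨D, hD, h1⟩ := hsmall
  obtain ⟨D', hD', h2⟩ := hlarge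
  refine ⟨D + D', by positivity, fun n hn M => ?_⟩
  have h3 : Finset.range M ⊆ Finset.range n ∪ Finset.Ioo (n - 1) M := by
    intro k hk
    simp only [Finset.mem_union, Finset.mem_range, Finset.mem_Ioo] at hk ⊢
    omega
  calc _ ≤ ∑ k ∈ Finset.range n ∪ Finset.Ioo (n - 1) M, mulCoeff β (cutoff n) k ^ 2 :=
        Finset.sum_le_sum_of_subset_of_nonneg h3 fun _ _ _ => sq_nonneg _
    _ ≤ ∑ k ∈ Finset.range n, mulCoeff β (cutoff n) k ^ 2 +
        ∑ k ∈ Finset.Ioo (n - 1) M, mulCoeff β (cutoff n) k ^ 2 := by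
        rw [← Finset.sum_union_inter]
        exact le_add_of_nonneg_right (Finset.sum_nonneg fun _ _ => sq_nonneg _)
    _ ≤ _ := by rw [add_mul]; exact add_le_add (h1 n hn) (h2 n hn M)

/-! ### A Halász-type inequality. -/

section Halasz

open AddCircle

instance : Fact (0 < 2 * Real.pi) := ⟨Real.two_pi_pos⟩

/-- The function `exp (θ P)` on the unit circle, with `P` the logarithm of the generating
function. -/
noncomputable def circleSeries (θ : ℝ) (f : ℕ → ℂ) (n : ℕ) : C(AddCircle (2 * Real.pi), ℂ) where
  toFun x := Complex.exp (θ * logSeries f n (fourier 1 x))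
  continuous_toFun := by
    have h1 : Continuous (logSeries f n) := by unfold logSeries; fun_prop
    have h2 : Continuous fun x : AddCircle (2 * Real.pi) => (fourier 1 x : ℂ) :=
      (fourier 1).continuous
    fun_prop

lemma norm_circleSeries (θ : ℝ) (f : ℕ → ℂ) (n : ℕ) (x : AddCircle (2 * Real.pi)) :
    ‖circleSeries θ f n x‖ = Real.exp (θ * (logSeries f n (fourier 1 x)).re) := by
  show ‖Complex.exp _‖ = _
  rw [Complex.norm_exp, Complex.re_ofReal_mul]

lemma hasSum_sq_mulCoeff {θ : ℝ} (hθ : 0 ≤ θ) {f : ℕ → ℂ} {n : ℕ} (hf : ∀ j, ‖f j‖ ≤ cutoff n j) :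
    HasSum (fun k => ‖mulCoeff θ f k‖ ^ 2) (∫ x, ‖circleSeries θ f n x‖ ^ 2 ∂haarAddCircle) := by
  have hf0 : ∀ j, n < j → f j = 0 := fun j hj => by
    have := hf j
    rw [cutoff_of_lt hj] at this
    exact norm_le_zero_iff.1 this
  apply integral_norm_sq_of_hasSum
  have hsum : Summable fun k : ℕ => mulCoeff θ f k •
      (fourier (k : ℤ) : C(AddCircle (2 * Real.pi), ℂ)) := by
    refine Summable.of_norm_bounded (hasSum_mulCoeff_cutoff θ n).summable fun k => ?_
    rw [norm_smul, fourier_norm, mul_one]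
    exact norm_mulCoeff_le hθ hf k
  convert hsum.hasSum
  ext x
  have h1 := hsum.hasSum.mapL (ContinuousMap.evalCLM ℂ x)
  refine (hasSum_mulCoeff hf0 (fourier 1 x)).unique (h1.congr_fun fun k => ?_)
  simp [fourier_apply, AddCircle.toCircle_nsmul]

/-- Halász's inequality for permutations: if the mean value of a multiplicative function `f` with
`|f| ≤ 1` is not small, then `f` is close to `j ↦ exp (-i t j)` for some `t`. -/
theorem exists_phase {θ : ℝ} (hθ : 1 ≤ θ) {c : ℝ} (hc : 0 < c) : ∃ C : ℝ, ∀ n : ℕ, 1 ≤ n →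
    ∀ f : ℕ → ℂ, (∀ j, ‖f j‖ ≤ 1) → c * mass θ n ≤ ‖mulCoeff θ f n‖ →
    ∃ t : ℝ, ∑ j ∈ Finset.Icc 1 n, (1 - (f j * Complex.exp (t * Complex.I) ^ j).re) / j ≤ C := by
  have hθ0 : 0 < θ := by linarith
  obtain ⟨c₁, C₁, hc₁, hC₁, hb₁⟩ := exists_mass_bounds hθ0
  -- The square of `|exp (θ P)|` is `exp ((θ / 2) Re P)` times the square of `|exp ((3 θ / 4) P)|`:
  -- the first factor will be bounded pointwise, the second in mean. As `θ ≥ 1`, the exponent `3 θ /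
  -- 4` exceeds `1 / 2`.
  obtain ⟨D, hD, hDb⟩ := exists_sum_sq_mulCoeff_cutoff_le (β := 3 * θ / 4) (by linarith)
  set κ : ℝ := (c * c₁ / θ) ^ 2 / D with hκ
  have hκ0 : 0 < κ := by positivity
  refine ⟨1 - Real.log κ * (2 / θ) + 1, fun n hn f hf hcf => ?_⟩
  have hn' : (0 : ℝ) < n := by exact_mod_cast hn
  set g : ℕ → ℂ := fun j => if j ≤ n then f j else 0 with hg
  have hgn : ∀ j, ‖g j‖ ≤ cutoff n j := by
    intro j
    by_cases h : j ≤ n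
    · simp [hg, h, cutoff_of_le h, hf j]
    · simp [hg, h, cutoff_nonneg]
  have hg1 : ∀ j, ‖g j‖ ≤ 1 := fun j => (hgn j).trans (cutoff_le_one n j)
  have hgf : mulCoeff θ f n = mulCoeff θ g n := mulCoeff_congr fun j _ hj => by simp [hg, hj]
  -- the lower bound for the mean square
  have hlow : (c * c₁ / θ) ^ 2 * (n : ℝ) ^ (2 * θ - 1) ≤
      ∑ k ∈ Finset.range n, ‖mulCoeff θ g k‖ ^ 2 := by
    have h1 : n * ‖mulCoeff θ g n‖ ≤ θ * ∑ k ∈ Finset.range n, ‖mulCoeff θ g k‖ := by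
      have h := natCast_mul_mulCoeff_range θ g n
      rw [← Complex.norm_natCast, ← norm_mul, h, Finset.mul_sum]
      refine (norm_sum_le _ _).trans (Finset.sum_le_sum fun k _ => ?_)
      rw [norm_smul, norm_mul, Real.norm_of_nonneg hθ0.le]
      gcongr
      exact mul_le_of_le_one_left (norm_nonneg _) (hg1 _)
    -- Cauchy–Schwarz: a large `n`-th coefficient forces a large sum of the earlier ones, hence a
    -- large sum of squares.
    have h2 := sq_sum_le_card_mul_sum_sq (s := Finset.range n) (f := fun k => ‖mulCoeff θ g k‖)
    rw [Finset.card_range] at h2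
    have h3 : c * c₁ / θ * (n : ℝ) ^ (θ - 1) * n ≤ ∑ k ∈ Finset.range n, ‖mulCoeff θ g k‖ := by
      have h4 : (n : ℝ) ^ (θ - 1) ≤ ((n : ℝ) + 1) ^ (θ - 1) :=
        Real.rpow_le_rpow hn'.le (by linarith) (by linarith)
      have h5 : c * (c₁ * (n : ℝ) ^ (θ - 1)) ≤ ‖mulCoeff θ g n‖ := by
        rw [← hgf]
        refine le_trans ?_ hcf
        gcongr
        exact le_trans (by gcongr) (hb₁ n).1
      have h6 : n * (c * (c₁ * (n : ℝ) ^ (θ - 1))) ≤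
          θ * ∑ k ∈ Finset.range n, ‖mulCoeff θ g k‖ :=
        le_trans (by gcongr) h1
      rw [div_mul_eq_mul_div, div_mul_eq_mul_div, div_le_iff₀ hθ0]
      linarith
    have h7 := pow_le_pow_left₀ (by positivity) h3 2
    have h8 : (n : ℝ) ^ (2 * θ - 1) = ((n : ℝ) ^ (θ - 1)) ^ 2 * n := by
      rw [← Real.rpow_natCast, ← Real.rpow_mul hn'.le, ← Real.rpow_add_one hn'.ne']
      congr 1
      push_cast
      ring
    rw [h8]
    have h9 := h7.trans h2
    have : n * ((c * c₁ / θ) ^ 2 * (((n : ℝ) ^ (θ - 1)) ^ 2 * n)) ≤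
        n * ∑ k ∈ Finset.range n, ‖mulCoeff θ g k‖ ^ 2 := by
      refine le_trans (le_of_eq ?_) h9
      ring
    exact le_of_mul_le_mul_left this hn'
  -- the upper bound
  have hup : ∀ V : ℝ, (∀ x, (logSeries g n (fourier 1 (x : AddCircle (2 * Real.pi)))).re ≤ V) →
      ∑ k ∈ Finset.range n, ‖mulCoeff θ g k‖ ^ 2 ≤
        Real.exp (θ / 2 * V) * (D * (n : ℝ) ^ (2 * (3 * θ / 4) - 1)) := by
    intro V hV
    have hS1 := hasSum_sq_mulCoeff hθ0.le hgn
    have hS2 := hasSum_sq_mulCoeff (θ := 3 * θ / 4) (by positivity) hgn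
    refine (sum_le_hasSum _ (fun _ _ => sq_nonneg _) hS1).trans ?_
    have hint : ∫ x, ‖circleSeries θ g n x‖ ^ 2 ∂haarAddCircle ≤
        ∫ x, Real.exp (θ / 2 * V) * ‖circleSeries (3 * θ / 4) g n x‖ ^ 2 ∂haarAddCircle := by
      have hcont : ∀ b : ℝ, Continuous fun x => ‖circleSeries b g n x‖ ^ 2 := fun b =>
        (circleSeries b g n).continuous.norm.pow 2
      refine integral_mono ?_ ?_ fun x => ?_
      · exact (hcont θ).integrable_of_hasCompactSupport
          (HasCompactSupport.of_compactSpace _)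
      · exact ((hcont _).const_mul _).integrable_of_hasCompactSupport
          (HasCompactSupport.of_compactSpace _)
      · simp only [norm_circleSeries, ← Real.exp_nat_mul, ← Real.exp_add]
        apply Real.exp_le_exp.2
        have := mul_le_mul_of_nonneg_left (hV x) (by positivity : 0 ≤ θ / 2)
        push_cast
        linarith
    refine hint.trans ?_
    rw [integral_const_mul]
    gcongr
    refine le_of_tendsto' hS2.tendsto_sum_nat fun M => ?_
    refine le_trans (Finset.sum_le_sum fun k _ => ?_) (hDb n hn M)
    have := norm_mulCoeff_le (θ := 3 * θ / 4) (by positivity) hgn k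
    gcongr
  -- If `Re P` stayed below this level on the whole circle, the two bounds would differ by the
  -- factor `exp (-(θ / 2)) < 1`, which the `- 1` provides. So `Re P` nearly attains `log n` at some
  -- point, and that point is the phase.
  obtain ⟨x, hx⟩ : ∃ x : AddCircle (2 * Real.pi),
      Real.log n + Real.log κ * (2 / θ) - 1 < (logSeries g n (fourier 1 x)).re := by
    by_contra! hcon
    have h1 := hlow.trans (hup _ hcon)
    have h2 : Real.exp (θ / 2 * (Real.log n + Real.log κ * (2 / θ) - 1)) =
        (n : ℝ) ^ (θ / 2) * κ * Real.exp (-(θ / 2)) := by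
      rw [Real.rpow_def_of_pos hn', ← Real.exp_log hκ0, ← Real.exp_add, ← Real.exp_add,
        Real.log_exp]
      congr 1
      field_simp
      ring
    have h3 : (n : ℝ) ^ (2 * θ - 1) =
        (n : ℝ) ^ (θ / 2) * (n : ℝ) ^ (2 * (3 * θ / 4) - 1) := by
      rw [← Real.rpow_add hn']
      congr 1
      ring
    have h4 : κ * D = (c * c₁ / θ) ^ 2 := by rw [hκ]; field_simp
    have h5 : Real.exp (-(θ / 2)) < 1 := by
      rw [Real.exp_lt_one_iff]
      linarith
    have h6 : 0 < (c * c₁ / θ) ^ 2 * (n : ℝ) ^ (2 * θ - 1) := by positivity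
    have h7 : Real.exp (θ / 2 * (Real.log n + Real.log κ * (2 / θ) - 1)) *
        (D * (n : ℝ) ^ (2 * (3 * θ / 4) - 1)) =
        (c * c₁ / θ) ^ 2 * (n : ℝ) ^ (2 * θ - 1) * Real.exp (-(θ / 2)) := by
      rw [h2, ← h4, h3]
      ring
    rw [h7] at h1
    nlinarith
  obtain ⟨t, rfl⟩ := QuotientAddGroup.mk_surjective x
  refine ⟨t, ?_⟩
  have hfour : (fourier 1 (t : AddCircle (2 * Real.pi)) : ℂ) = Complex.exp (t * Complex.I) := by
    rw [fourier_coe_apply]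
    congr 1
    have : (Real.pi : ℂ) ≠ 0 := by exact_mod_cast Real.pi_ne_zero
    push_cast
    field_simp
  have hre : (logSeries g n (fourier 1 (t : AddCircle (2 * Real.pi)))).re =
      ∑ j ∈ Finset.Icc 1 n, (f j * Complex.exp (t * Complex.I) ^ j).re / j := by
    rw [hfour, logSeries, Complex.re_sum]
    refine Finset.sum_congr rfl fun j hj => ?_
    rw [Complex.div_natCast_re]
    simp [hg, (Finset.mem_Icc.1 hj).2]
  have hx' : Real.log n + Real.log κ * (2 / θ) - 1 <
      ∑ j ∈ Finset.Icc 1 n, (f j * Complex.exp (t * Complex.I) ^ j).re / j := by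
    rw [← hre]; exact hx
  simp_rw [sub_div]
  rw [Finset.sum_sub_distrib]
  have := sum_inv_le_one_add_log (n := n)
  linarith

end Halasz

end Coefficients

/-! ### A lower bound sieve for cycle lengths. -/

section Sieve

/-- Pigeonhole over scales. With `v_i = m / 16 / 32 ^ i`, a deficit above `v_i` up to `16 v_i`
leaves at least `v_i / 2` of it beyond `16 v_{i+1} ≤ v_i / 2`, where `1 / j ≥ 1 / (16 v_i)`. Each
bad scale thus costs `1 / 32` of logarithmic weight, and there is not room for `T` of them. -/
lemma exists_scale_deficit_le {f : ℕ → ℝ} (hf0 : ∀ j, 0 ≤ f j) (hf1 : ∀ j, f j ≤ 1) {C : ℝ} {T : ℕ}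
    (hT : 32 * C ≤ T) {m : ℕ} (hC : ∑ j ∈ Finset.Icc 1 m, (1 - f j) / j < C) :
    ∃ i < T, ∑ j ∈ Finset.Icc 1 (16 * (m / 16 / 32 ^ i)), (1 - f j) ≤ (m / 16 / 32 ^ i : ℕ) := by
  by_contra! hcon
  set v : ℕ → ℕ := fun i => m / 16 / 32 ^ i with hv
  set H : ℕ → ℝ := fun x => ∑ j ∈ Finset.Icc 1 x, (1 - f j) / j with hH
  have hterm : ∀ j, 0 ≤ (1 - f j) / j := fun j =>
    div_nonneg (by linarith [hf1 j]) (by positivity)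
  have hstep : ∀ i < T, 1 / 32 ≤ H (16 * v i) - H (16 * v (i + 1)) := by
    intro i hi
    have hlt := hcon i hi
    have hv1 : v (i + 1) = v i / 32 := by
      simp only [hv, pow_succ, ← Nat.div_div_eq_div_mul]
    have hle : 16 * v (i + 1) ≤ 16 * v i := by omega
    have hpos : 0 < v i := by
      rcases Nat.eq_zero_or_pos (v i) with h | h
      · simp only [hv] at h
        simp [h] at hlt
      · exact h
    have hsub : Finset.Icc 1 (16 * v (i + 1)) ⊆ Finset.Icc 1 (16 * v i) :=
      Finset.Icc_subset_Icc le_rfl hle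
    have h1 : H (16 * v i) - H (16 * v (i + 1)) =
        ∑ j ∈ Finset.Icc 1 (16 * v i) \ Finset.Icc 1 (16 * v (i + 1)), (1 - f j) / j := by
      rw [hH, sub_eq_iff_eq_add, Finset.sum_sdiff hsub]
    have h2 : ∑ j ∈ Finset.Icc 1 (16 * v i) \ Finset.Icc 1 (16 * v (i + 1)), (1 - f j) ≤
        16 * v i * (H (16 * v i) - H (16 * v (i + 1))) := by
      rw [h1, Finset.mul_sum]
      refine Finset.sum_le_sum fun j hj => ?_
      simp only [Finset.mem_sdiff, Finset.mem_Icc] at hj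
      have hj1 : (0 : ℝ) < j := by exact_mod_cast (by omega : 0 < j)
      have hj2 : (j : ℝ) ≤ 16 * v i := by exact_mod_cast hj.1.2
      rw [mul_div_assoc', le_div_iff₀ hj1, mul_comm]
      exact mul_le_mul_of_nonneg_right hj2 (by linarith [hf1 j])
    have h3 : ∑ j ∈ Finset.Icc 1 (16 * v (i + 1)), (1 - f j) ≤ 16 * v (i + 1) := by
      refine (Finset.sum_le_sum fun j _ => (by linarith [hf0 j] : 1 - f j ≤ 1)).trans ?_
      simp
    have h4 : ((v (i + 1) : ℕ) : ℝ) * 32 ≤ v i := by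
      rw [hv1]; exact_mod_cast Nat.div_mul_le_self _ _
    have h5 := Finset.sum_sdiff (f := fun j => 1 - f j) hsub
    have hpos' : (0 : ℝ) < v i := by exact_mod_cast hpos
    by_contra! h6
    have h7 : 16 * v i * (H (16 * v i) - H (16 * v (i + 1))) ≤ 16 * v i * (1 / 32) := by
      gcongr
    have h8 : (v i : ℝ) < ∑ j ∈ Finset.Icc 1 (16 * v i), (1 - f j) := hlt
    linarith
  have hsum : ∑ i ∈ Finset.range T, (1 / 32 : ℝ) ≤
      ∑ i ∈ Finset.range T, (H (16 * v i) - H (16 * v (i + 1))) :=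
    Finset.sum_le_sum fun i hi => hstep i (Finset.mem_range.1 hi)
  rw [Finset.sum_range_sub', Finset.sum_const, Finset.card_range, nsmul_eq_mul] at hsum
  have h1 : 0 ≤ H (16 * v T) := Finset.sum_nonneg fun j _ => hterm j
  have h2 : H (16 * v 0) ≤ H m := by
    refine Finset.sum_le_sum_of_subset_of_nonneg (Finset.Icc_subset_Icc le_rfl ?_)
      fun j _ _ => hterm j
    simp only [hv, pow_zero, Nat.div_one]
    omega
  linarith

/-- Summing the recursion over `k`, each of the at most `y` admissible cycle lengths contributes at
most `θ` times the total `B`. -/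
lemma sum_mul_mulCoeff_le {θ : ℝ} (hθ : 0 ≤ θ) {f : ℕ → ℝ} (hf0 : ∀ j, 0 ≤ f j)
    {y : ℕ} (hfy : ∀ j, f j ≤ cutoff y j) {B : ℝ} (hB : HasSum (mulCoeff θ f) B) (M : ℕ) :
    ∑ k ∈ Finset.range M, k * mulCoeff θ f k ≤ θ * (y * B) := by
  have hc := mulCoeff_nonneg hθ hf0
  have h1 : ∀ k ∈ Finset.range M, k * mulCoeff θ f k ≤
      ∑ j ∈ Finset.Icc 1 y, θ * if j ≤ k then mulCoeff θ f (k - j) else 0 := by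
    intro k _
    have hset : ∑ j ∈ Finset.Icc 1 y, θ * (if j ≤ k then mulCoeff θ f (k - j) else 0) =
        ∑ j ∈ Finset.Icc 1 k, θ * (cutoff y j * mulCoeff θ f (k - j)) := by
      rw [← Finset.sum_subset (s₁ := Finset.Icc 1 (min y k)) (s₂ := Finset.Icc 1 y),
        ← Finset.sum_subset (s₁ := Finset.Icc 1 (min y k)) (s₂ := Finset.Icc 1 k)]
      · refine Finset.sum_congr rfl fun j hj => ?_
        have := (Finset.mem_Icc.1 hj).2
        rw [if_pos (by omega), cutoff_of_le (by omega), one_mul]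
      · exact Finset.Icc_subset_Icc le_rfl (min_le_right _ _)
      · intro j hj hj'
        simp only [Finset.mem_Icc] at hj hj'
        rw [cutoff_of_lt (by omega), zero_mul, mul_zero]
      · exact Finset.Icc_subset_Icc le_rfl (min_le_left _ _)
      · intro j hj hj'
        simp only [Finset.mem_Icc] at hj hj'
        rw [if_neg (by omega), mul_zero]
    rw [natCast_mul_mulCoeff, hset]
    refine Finset.sum_le_sum fun j _ => ?_
    rw [smul_eq_mul]
    have := hc (k - j)
    have := hfy j
    gcongr
  refine (Finset.sum_le_sum h1).trans ?_
  rw [Finset.sum_comm]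
  have h2 : ∀ j ∈ Finset.Icc 1 y,
      ∑ k ∈ Finset.range M, θ * (if j ≤ k then mulCoeff θ f (k - j) else 0) ≤ θ * B := by
    intro j _
    rw [← Finset.mul_sum, ← Finset.sum_filter]
    gcongr
    rw [← Finset.sum_image (s := (Finset.range M).filter (j ≤ ·)) (g := fun k => k - j)
      (f := mulCoeff θ f)]
    · exact sum_le_hasSum _ (fun k _ => hc k) hB
    · intro a ha b hb hab
      simp only [Finset.coe_filter, Set.mem_ofPred_eq] at ha hb hab
      omega
  refine (Finset.sum_le_sum h2).trans (le_of_eq ?_)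
  simp
  ring

/-- Cut `f` off at `y`: the sum of all coefficients is then an explicit exponential `B`, at least
`exp (-θ C) y ^ θ`, and the first moment is at most `θ y B`. By Markov's inequality no more than
half of `B` lies at indices `≥ N`. -/
lemma le_sum_mulCoeff {θ : ℝ} (hθ : 0 < θ) {f : ℕ → ℝ} (hf0 : ∀ j, 0 ≤ f j) (hf1 : ∀ j, f j ≤ 1)
    {y N : ℕ} (hy : 1 ≤ y) (hN : 2 * θ * y ≤ N) {C : ℝ}
    (hC : ∑ j ∈ Finset.Icc 1 y, (1 - f j) / j ≤ C) :
    Real.exp (-(θ * C)) * (y : ℝ) ^ θ / 2 ≤ ∑ k ∈ Finset.range N, mulCoeff θ f k := by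
  set g : ℕ → ℝ := fun j => f j * cutoff y j with hg
  have hg0 : ∀ j, 0 ≤ g j := fun j => mul_nonneg (hf0 j) (cutoff_nonneg y j)
  have hgc : ∀ j, g j ≤ cutoff y j := fun j =>
    mul_le_of_le_one_left (cutoff_nonneg y j) (hf1 j)
  have hgf : ∀ j, g j ≤ f j := fun j => mul_le_of_le_one_right (hf0 j) (cutoff_le_one y j)
  have hc := mulCoeff_nonneg hθ.le hg0
  have hsum := hasSum_mulCoeff_real (θ := θ) (f := g) (n := y)
    (fun j hj => by simp [hg, cutoff_of_lt hj])
  set B := Real.exp (θ * ∑ j ∈ Finset.Icc 1 y, g j / j) with hB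
  have hy' : (0 : ℝ) < y := by exact_mod_cast hy
  have hBlow : Real.exp (-(θ * C)) * (y : ℝ) ^ θ ≤ B := by
    have h1 : ∑ j ∈ Finset.Icc 1 y, g j / (j : ℝ) =
        ∑ j ∈ Finset.Icc 1 y, 1 / (j : ℝ) - ∑ j ∈ Finset.Icc 1 y, (1 - f j) / j := by
      rw [← Finset.sum_sub_distrib]
      refine Finset.sum_congr rfl fun j hj => ?_
      rw [hg]
      simp only [cutoff_of_le (Finset.mem_Icc.1 hj).2]
      ring
    have h2 : Real.log y ≤ ∑ j ∈ Finset.Icc 1 y, 1 / (j : ℝ) := by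
      have := log_add_one_le_harmonic y
      rw [harmonic_eq_sum_Icc] at this
      push_cast at this
      simp only [one_div]
      exact (Real.log_le_log hy' (by linarith)).trans this
    rw [Real.rpow_def_of_pos hy', ← Real.exp_add, hB]
    apply Real.exp_le_exp.2
    rw [h1]
    nlinarith
  have hN0 : (0 : ℝ) < N := lt_of_lt_of_le (by positivity) hN
  have hmain : B / 2 ≤ ∑ k ∈ Finset.range N, mulCoeff θ g k := by
    have htail : ∀ M, ∑ k ∈ Finset.range M, mulCoeff θ g k ≤
        ∑ k ∈ Finset.range N, mulCoeff θ g k + B / 2 := by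
      intro M
      have h1 := sum_mul_mulCoeff_le hθ.le hg0 hgc hsum M
      have h2 : ∑ k ∈ Finset.range M, mulCoeff θ g k ≤
          ∑ k ∈ Finset.range N, mulCoeff θ g k +
            ∑ k ∈ Finset.range M, k * mulCoeff θ g k / N := by
        have h3 : ∑ k ∈ Finset.range M, mulCoeff θ g k ≤ ∑ k ∈ Finset.range M,
            ((if k < N then mulCoeff θ g k else 0) + k * mulCoeff θ g k / N) := by
          refine Finset.sum_le_sum fun k _ => ?_
          have := hc k
          split_ifs with h
          · have : 0 ≤ k * mulCoeff θ g k / N := by positivity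
            linarith
          · rw [zero_add, le_div_iff₀ hN0, mul_comm]
            gcongr
            omega
        refine h3.trans ?_
        rw [Finset.sum_add_distrib, ← Finset.sum_filter]
        refine add_le_add (Finset.sum_le_sum_of_subset_of_nonneg ?_ fun k _ _ => hc k) le_rfl
        intro k hk
        simp only [Finset.mem_filter] at hk
        exact Finset.mem_range.2 hk.2
      have hB0 : 0 < B := Real.exp_pos _
      have h4 : ∑ k ∈ Finset.range M, k * mulCoeff θ g k / N ≤ B / 2 := by
        rw [← Finset.sum_div, div_le_iff₀ hN0]
        nlinarith
      linarith
    have := le_of_tendsto' hsum.tendsto_sum_nat htail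
    linarith
  calc _ ≤ B / 2 := by linarith
    _ ≤ _ := hmain
    _ ≤ _ := Finset.sum_le_sum fun k _ => mulCoeff_mono hθ.le hg0 hgf k

variable {θ : ℝ} {f : ℕ → ℝ}

lemma sum_range_le_natCast_mul (hθ : 1 ≤ θ) (hf0 : ∀ j, 0 ≤ f j) (k : ℕ) :
    ∑ i ∈ Finset.range k, f (k - i) * mulCoeff θ f i ≤ k * mulCoeff θ f k := by
  rw [natCast_mul_mulCoeff_range]
  refine Finset.sum_le_sum fun i _ => ?_
  rw [smul_eq_mul]
  exact le_mul_of_one_le_left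
    (mul_nonneg (hf0 _) (mulCoeff_nonneg (by linarith) hf0 i)) hθ

lemma sum_one_sub_comp_le (hf1 : ∀ j, f j ≤ 1) {x : ℕ} {D : ℝ}
    (hD : ∑ j ∈ Finset.Icc 1 x, (1 - f j) ≤ D) {s : Finset ℕ} {φ : ℕ → ℕ}
    (hφ : Set.InjOn φ s) (hs : ∀ i ∈ s, 1 ≤ φ i ∧ φ i ≤ x) :
    ∑ i ∈ s, (1 - f (φ i)) ≤ D := by
  rw [← Finset.sum_image (f := fun j => 1 - f j) hφ]
  refine le_trans (Finset.sum_le_sum_of_subset_of_nonneg ?_ fun j _ _ => ?_) hD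
  · intro j hj
    obtain ⟨i, hi, rfl⟩ := Finset.mem_image.1 hj
    exact Finset.mem_Icc.2 (hs i hi)
  · linarith [hf1 j]

/-- Two applications of the recursion pass from the average over `i₀ ≤ 4 v` to the single index `k`.
There are at least `6 v` intermediate indices, and the two deficits remove at most `v` each, so
every `i₀` is reached with weight at least `4 v`. -/
lemma mulCoeff_ge_of_deficit_le (hθ : 1 ≤ θ) (hf0 : ∀ j, 0 ≤ f j) (hf1 : ∀ j, f j ≤ 1) {v : ℕ}
    (hv : 1 ≤ v) (hD : ∑ j ∈ Finset.Icc 1 (16 * v), (1 - f j) ≤ v) {k : ℕ} (hk : 12 * v ≤ k)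
    (hk' : k ≤ 16 * v) :
    (∑ i ∈ Finset.range (4 * v + 1), mulCoeff θ f i) / (64 * v) ≤ mulCoeff θ f k := by
  have hc := mulCoeff_nonneg (by linarith : 0 ≤ θ) hf0
  set b := mulCoeff θ f with hb
  have hv' : (1 : ℝ) ≤ v := by exact_mod_cast hv
  have h1 : ∑ i₀ ∈ Finset.range (4 * v + 1), b i₀ * (4 * v) ≤ k * (k * b k) := by
    calc ∑ i₀ ∈ Finset.range (4 * v + 1), b i₀ * (4 * v)
        ≤ ∑ i₀ ∈ Finset.range (4 * v + 1),
          b i₀ * ∑ i ∈ Finset.Ioo i₀ k, f (k - i) * f (i - i₀) := by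
          refine Finset.sum_le_sum fun i₀ hi₀ => ?_
          have hi₀ := Finset.mem_range.1 hi₀
          refine mul_le_mul_of_nonneg_left ?_ (hc i₀)
          have e1 : ∑ i ∈ Finset.Ioo i₀ k, (1 - f (k - i)) ≤ v := by
            refine sum_one_sub_comp_le (φ := fun i => k - i) hf1 hD ?_ ?_
            · intro a ha b hb hab
              simp only [Finset.coe_Ioo, Set.mem_Ioo] at ha hb hab
              omega
            · intro i hi
              simp only [Finset.mem_Ioo] at hi ⊢
              omega
          have e2 : ∑ i ∈ Finset.Ioo i₀ k, (1 - f (i - i₀)) ≤ v := by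
            refine sum_one_sub_comp_le (φ := fun i => i - i₀) hf1 hD ?_ ?_
            · intro a ha b hb hab
              simp only [Finset.coe_Ioo, Set.mem_Ioo] at ha hb hab
              omega
            · intro i hi
              simp only [Finset.mem_Ioo] at hi ⊢
              omega
          have e3 : ∑ i ∈ Finset.Ioo i₀ k, (1 - (1 - f (k - i)) - (1 - f (i - i₀))) ≤
              ∑ i ∈ Finset.Ioo i₀ k, f (k - i) * f (i - i₀) := by
            refine Finset.sum_le_sum fun i _ => ?_
            have := hf1 (k - i)
            have := hf1 (i - i₀)
            nlinarith
          rw [Finset.sum_sub_distrib, Finset.sum_sub_distrib, Finset.sum_const, Nat.card_Ioo,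
            nsmul_eq_mul, mul_one] at e3
          have e4 : ((6 * v : ℕ) : ℝ) ≤ ((k - i₀ - 1 : ℕ) : ℝ) := by
            exact_mod_cast (by omega : 6 * v ≤ k - i₀ - 1)
          push_cast at e4
          linarith
      _ ≤ ∑ i₀ ∈ Finset.range k, b i₀ * ∑ i ∈ Finset.Ioo i₀ k, f (k - i) * f (i - i₀) := by
          refine Finset.sum_le_sum_of_subset_of_nonneg (Finset.range_mono (by omega))
            fun i₀ _ _ => ?_
          exact mul_nonneg (hc _) (Finset.sum_nonneg fun i _ => mul_nonneg (hf0 _) (hf0 _))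
      _ = ∑ i ∈ Finset.range k, f (k - i) * ∑ i₀ ∈ Finset.range i, f (i - i₀) * b i₀ := by
          simp_rw [Finset.mul_sum]
          rw [Finset.sum_comm' (t' := Finset.range k) (s' := fun y => Finset.range y) (by
            simp only [Finset.mem_range, Finset.mem_Ioo]
            omega)]
          exact Finset.sum_congr rfl fun i _ => Finset.sum_congr rfl fun j _ => by ring
      _ ≤ ∑ i ∈ Finset.range k, f (k - i) * (k * b i) := by
          refine Finset.sum_le_sum fun i hi => mul_le_mul_of_nonneg_left ?_ (hf0 _)
          refine (sum_range_le_natCast_mul hθ hf0 i).trans ?_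
          have := hc i
          have := Finset.mem_range.1 hi
          gcongr
      _ = k * ∑ i ∈ Finset.range k, f (k - i) * b i := by
          rw [Finset.mul_sum]
          exact Finset.sum_congr rfl fun i _ => by ring
      _ ≤ k * (k * b k) := by
          gcongr
          exact sum_range_le_natCast_mul hθ hf0 k
  rw [← Finset.sum_mul] at h1
  have hk2 : (k : ℝ) ≤ 16 * v := by exact_mod_cast hk'
  have h2 : k * (k * b k) ≤ 16 * v * (16 * v * b k) := by
    have := hc k
    gcongr
  rw [div_le_iff₀ (by positivity)]
  have h3 : 4 * (v : ℝ) * ∑ i ∈ Finset.range (4 * v + 1), b i ≤ 4 * v * (b k * (64 * v)) := by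
    linarith
  exact le_of_mul_le_mul_left h3 (by positivity)

/-- Each step lengthens the range of the lower bound by `2 v`. The recursion is restricted to the
last `4 v + 1` indices already treated; after the deficit `v` they carry weight at least `2 v`, so a
step costs the factor `2 v / m`. -/
lemma mulCoeff_ge_propagate (hθ : 1 ≤ θ) (hf0 : ∀ j, 0 ≤ f j) (hf1 : ∀ j, f j ≤ 1) {v m : ℕ}
    (hv : 1 ≤ v) (hD : ∑ j ∈ Finset.Icc 1 (16 * v), (1 - f j) ≤ v) {β : ℝ} (hβ : 0 ≤ β)
    (hm : 16 * v ≤ m)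
    (h0 : ∀ k, 12 * v ≤ k → k ≤ 16 * v → β ≤ mulCoeff θ f k) (i : ℕ) :
    ∀ k, 12 * v ≤ k → k ≤ 16 * v + 2 * v * i → k ≤ m →
      β * (2 * v / m) ^ i ≤ mulCoeff θ f k := by
  have hc := mulCoeff_nonneg (by linarith : 0 ≤ θ) hf0
  have hv' : (1 : ℝ) ≤ v := by exact_mod_cast hv
  have hm' : (16 : ℝ) * v ≤ m := by exact_mod_cast hm
  have hm0 : (0 : ℝ) < m := by linarith
  have hγ0 : (0 : ℝ) ≤ 2 * v / m := by positivity
  have hγ1 : (2 : ℝ) * v / m ≤ 1 := by rw [div_le_one hm0]; linarith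
  induction i with
  | zero => intro k h1 h2 _; simpa using h0 k h1 (by omega)
  | succ i ih =>
    intro k h1 h2 h3
    set q := 16 * v + 2 * v * i with hq
    have hq4 : β * (2 * v / m) ^ (i + 1) ≤ β * (2 * v / m) ^ i := by
      rw [pow_succ, ← mul_assoc]
      exact mul_le_of_le_one_right (by positivity) hγ1
    by_cases hkq : k ≤ q
    · exact hq4.trans (ih k h1 hkq h3)
    have hkq2 : k ≤ q + 2 * v := by rw [hq]; rw [mul_add, mul_one] at h2; omega
    push Not at hkq
    have hsub : Finset.Icc (q - 4 * v) q ⊆ Finset.range k := by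
      intro j hj
      simp only [Finset.mem_Icc, Finset.mem_range] at hj ⊢
      omega
    have e1 : ∑ j ∈ Finset.Icc (q - 4 * v) q, (1 - f (k - j)) ≤ v := by
      refine sum_one_sub_comp_le (φ := fun i => k - i) hf1 hD ?_ ?_
      · intro a ha b hb hab
        simp only [Finset.coe_Icc, Set.mem_Icc] at ha hb hab
        omega
      · intro i hi
        simp only [Finset.mem_Icc] at hi ⊢
        omega
    have e2 : β * (2 * v / m) ^ i * (2 * v) ≤ m * mulCoeff θ f k := by
      calc β * (2 * v / m) ^ i * (2 * v)
          ≤ β * (2 * v / m) ^ i * ∑ j ∈ Finset.Icc (q - 4 * v) q, f (k - j) := by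
            gcongr
            rw [Finset.sum_sub_distrib, Finset.sum_const, Nat.card_Icc, nsmul_eq_mul, mul_one,
              show q + 1 - (q - 4 * v) = 4 * v + 1 by omega] at e1
            push_cast at e1
            linarith
        _ ≤ ∑ j ∈ Finset.Icc (q - 4 * v) q, f (k - j) * mulCoeff θ f j := by
            rw [Finset.mul_sum]
            refine Finset.sum_le_sum fun j hj => ?_
            rw [mul_comm]
            refine mul_le_mul_of_nonneg_left (ih j ?_ ?_ ?_) (hf0 _) <;>
              simp only [Finset.mem_Icc] at hj <;> omega
        _ ≤ ∑ j ∈ Finset.range k, f (k - j) * mulCoeff θ f j :=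
            Finset.sum_le_sum_of_subset_of_nonneg hsub fun j _ _ => mul_nonneg (hf0 _) (hc j)
        _ ≤ k * mulCoeff θ f k := sum_range_le_natCast_mul hθ hf0 k
        _ ≤ m * mulCoeff θ f k := by
            have := hc k
            gcongr
    have e3 : β * (2 * v / m) ^ (i + 1) = β * (2 * v / m) ^ i * (2 * v) / m := by
      rw [pow_succ]; ring
    rw [e3, div_le_iff₀ hm0, mul_comm (mulCoeff θ f k)]
    exact e2

/-- A lower bound sieve: the permutations all of whose cycle lengths avoid a set with bounded
logarithmic weight have positive proportion. -/
theorem exists_le_mulCoeff (hθ : 1 ≤ θ) (C : ℝ) : ∃ c : ℝ, 0 < c ∧ ∃ m₀ : ℕ, ∀ m, m₀ ≤ m →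
    ∀ f : ℕ → ℝ, (∀ j, 0 ≤ f j) → (∀ j, f j ≤ 1) →
      ∑ j ∈ Finset.Icc 1 m, (1 - f j) / j ≤ C → c * mass θ m ≤ mulCoeff θ f m := by
  have hθ0 : 0 < θ := by linarith
  obtain ⟨T, hT⟩ := exists_nat_ge (32 * (C + 1))
  obtain ⟨Θ, hΘ⟩ := exists_nat_ge θ
  have hΘ1 : 1 ≤ Θ := by exact_mod_cast hθ.trans hΘ
  have hΘ1' : (1 : ℝ) ≤ Θ := by exact_mod_cast hΘ1
  obtain ⟨c₁, C₁, hc₁, hC₁, hb₁⟩ := exists_mass_bounds hθ0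
  -- The good scale will satisfy `m ≤ R v`, so `R` steps of length `2 v` reach `m` and cost at least
  -- `(2 / R) ^ R`, independently of `m`.
  obtain ⟨R, hR⟩ : ∃ R : ℕ, R = 2 * (16 * 32 ^ T) := ⟨_, rfl⟩
  have hR0 : (0 : ℝ) < R := by rw [hR]; positivity
  refine ⟨Real.exp (-(θ * C)) * (1 / (2 * Θ)) ^ θ / 2 / 64 * (2 / R) ^ R * (1 / R) ^ (θ - 1) /
    (C₁ * 2 ^ |θ - 1|), by positivity, 16 * 32 ^ T * Θ, fun m hm f hf0 hf1 hC => ?_⟩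
  obtain ⟨i, hi, hD⟩ := exists_scale_deficit_le hf0 hf1 hT (hC.trans_lt (lt_add_one _))
  have hc := mulCoeff_nonneg hθ0.le hf0
  set v := m / 16 / 32 ^ i with hv
  have hu : m / (16 * 32 ^ T) ≤ v := by
    rw [hv, Nat.div_div_eq_div_mul]
    apply Nat.div_le_div_left
    · gcongr
      · norm_num
    · positivity
  have huΘ : Θ ≤ m / (16 * 32 ^ T) := by
    rw [Nat.le_div_iff_mul_le (by positivity), mul_comm]; exact hm
  have hvΘ : Θ ≤ v := huΘ.trans hu
  have hv1 : 1 ≤ v := hΘ1.trans hvΘ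
  have hv16 : 16 * v ≤ m := by
    have : v ≤ m / 16 := Nat.div_le_self _ _
    omega
  have hmR : m ≤ R * v := by
    have h1 := Nat.lt_mul_div_succ m (show 0 < 16 * 32 ^ T by positivity)
    have h2 : 16 * 32 ^ T * (m / (16 * 32 ^ T) + 1) ≤ 16 * 32 ^ T * (2 * v) := by
      gcongr
      omega
    have h3 : 16 * 32 ^ T * (2 * v) = R * v := by rw [hR]; ring
    omega
  clear_value v
  have hv' : (1 : ℝ) ≤ v := by exact_mod_cast hv1
  have hm0 : (0 : ℝ) < m := by
    have : (16 : ℝ) * v ≤ m := by exact_mod_cast hv16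
    linarith
  have hmR' : (m : ℝ) ≤ R * v := by exact_mod_cast hmR
  -- Small enough that `2 θ y ≤ 4 v + 1`, as `le_sum_mulCoeff` requires, yet at least `v / (2 Θ)`.
  set y := v / Θ with hy
  have hy1 : 1 ≤ y := by rw [hy, Nat.one_le_div_iff (by omega)]; exact hvΘ
  have hyv : (v : ℝ) * (1 / (2 * Θ)) ≤ y := by
    have h1 := Nat.lt_mul_div_succ v (show 0 < Θ by omega)
    have h2 : (v : ℝ) ≤ Θ * (y + 1) := by exact_mod_cast h1.le
    have h3 : (1 : ℝ) ≤ y := by exact_mod_cast hy1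
    rw [mul_one_div, div_le_iff₀ (by positivity)]
    nlinarith
  have hyN : 2 * θ * y ≤ ((4 * v + 1 : ℕ) : ℝ) := by
    have h1 : ((y * Θ : ℕ) : ℝ) ≤ v := by exact_mod_cast Nat.div_mul_le_self v Θ
    push_cast at h1 ⊢
    have h3 : (1 : ℝ) ≤ y := by exact_mod_cast hy1
    nlinarith
  have hCy : ∑ j ∈ Finset.Icc 1 y, (1 - f j) / j ≤ C := by
    refine le_trans (Finset.sum_le_sum_of_subset_of_nonneg (Finset.Icc_subset_Icc le_rfl ?_)
      fun j _ _ => div_nonneg (by linarith [hf1 j]) (by positivity)) hC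
    have : y ≤ v := Nat.div_le_self _ _
    omega
  clear_value y
  have hW := le_sum_mulCoeff hθ0 hf0 hf1 hy1 hyN hCy
  set W := ∑ i ∈ Finset.range (4 * v + 1), mulCoeff θ f i
  have hW0 : 0 ≤ W := Finset.sum_nonneg fun i _ => hc i
  have hmain := mulCoeff_ge_propagate hθ hf0 hf1 hv1 hD (β := W / (64 * v)) (by positivity) hv16
    (fun k hk hk' => mulCoeff_ge_of_deficit_le hθ hf0 hf1 hv1 hD hk hk') R m (by omega)
    (by nlinarith) le_rfl
  have hγ : (2 : ℝ) / R ≤ 2 * v / m := by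
    rw [div_le_div_iff₀ hR0 hm0]
    nlinarith
  have hvθ : (v : ℝ) ^ (θ - 1) = (v : ℝ) ^ θ / v := Real.rpow_sub_one (by positivity) θ
  have hWv : Real.exp (-(θ * C)) * (1 / (2 * Θ)) ^ θ / 2 / 64 * (v : ℝ) ^ (θ - 1) ≤
      W / (64 * v) := by
    have h1 : ((v : ℝ) * (1 / (2 * Θ))) ^ θ ≤ (y : ℝ) ^ θ :=
      Real.rpow_le_rpow (by positivity) hyv hθ0.le
    rw [Real.mul_rpow (by positivity) (by positivity)] at h1
    rw [hvθ, le_div_iff₀ (by positivity)]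
    refine le_trans (le_of_eq ?_) (le_trans (by gcongr :
      Real.exp (-(θ * C)) * ((v : ℝ) ^ θ * (1 / (2 * Θ)) ^ θ) / 2 ≤ _) hW)
    field_simp
  have hmv : (1 / R : ℝ) ^ (θ - 1) * (m : ℝ) ^ (θ - 1) ≤ (v : ℝ) ^ (θ - 1) := by
    rw [← Real.mul_rpow (by positivity) hm0.le]
    refine Real.rpow_le_rpow (by positivity) ?_ (by linarith)
    rw [one_div_mul_eq_div, div_le_iff₀ hR0]
    linarith
  have hmass : mass θ m ≤ C₁ * 2 ^ |θ - 1| * (m : ℝ) ^ (θ - 1) := by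
    refine (hb₁ m).2.trans ?_
    rw [mul_assoc]
    gcongr
    exact add_one_rpow_le (by omega) _
  calc _ ≤ Real.exp (-(θ * C)) * (1 / (2 * Θ)) ^ θ / 2 / 64 * (2 / R) ^ R * (1 / R) ^ (θ - 1) /
        (C₁ * 2 ^ |θ - 1|) * (C₁ * 2 ^ |θ - 1| * (m : ℝ) ^ (θ - 1)) := by gcongr
    _ = Real.exp (-(θ * C)) * (1 / (2 * Θ)) ^ θ / 2 / 64 *
        ((1 / R : ℝ) ^ (θ - 1) * (m : ℝ) ^ (θ - 1)) * (2 / R) ^ R := by field_simp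
    _ ≤ Real.exp (-(θ * C)) * (1 / (2 * Θ)) ^ θ / 2 / 64 * (v : ℝ) ^ (θ - 1) *
        (2 * v / m) ^ R := by gcongr
    _ ≤ W / (64 * v) * (2 * v / m) ^ R := by gcongr
    _ ≤ _ := hmain

end Sieve

/-! ### Expectations and probabilities. -/

/-- The expectation under the Ewens measure of a function of the multiset of cycle lengths. -/
noncomputable def ewensMean (θ : ℝ) (n : ℕ) (G : Multiset ℕ → ℝ) : ℝ :=
  ewensSum θ n G / mass θ n

/-- The Ewens probability of a set of multisets of cycle lengths. -/
noncomputable def ewensProb (θ : ℝ) (n : ℕ) (A : Set (Multiset ℕ)) : ℝ :=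
  ewensMean θ n (A.indicator 1)

section Mean

variable {θ : ℝ}

lemma ewensMean_mono (hθ : 0 < θ) {n : ℕ} {G G' : Multiset ℕ → ℝ}
    (h : ∀ s : Multiset ℕ, s.sum = n → (∀ j ∈ s, 0 < j) → G s ≤ G' s) :
    ewensMean θ n G ≤ ewensMean θ n G' :=
  div_le_div_of_nonneg_right (ewensSum_mono hθ.le h) (mass_pos hθ n).le

lemma ewensMean_nonneg (hθ : 0 < θ) {n : ℕ} {G : Multiset ℕ → ℝ} (h : ∀ s, 0 ≤ G s) :
    0 ≤ ewensMean θ n G := div_nonneg (ewensSum_nonneg hθ.le h) (mass_pos hθ n).le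

lemma ewensMean_add (n : ℕ) (G G' : Multiset ℕ → ℝ) :
    ewensMean θ n (fun s => G s + G' s) = ewensMean θ n G + ewensMean θ n G' := by
  rw [ewensMean, ewensSum_add, add_div]; rfl

lemma ewensMean_const_mul (n : ℕ) (c : ℝ) (G : Multiset ℕ → ℝ) :
    ewensMean θ n (fun s => c * G s) = c * ewensMean θ n G := by
  rw [ewensMean, ewensSum_const_mul, mul_div_assoc]; rfl

lemma ewensMean_one (hθ : 0 < θ) (n : ℕ) : ewensMean θ n (fun _ => 1) = 1 := by
  have := mass_pos hθ n
  rw [ewensMean, ← mass, div_self this.ne']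

lemma ewensMean_sum {ι : Type*} (n : ℕ) (t : Finset ι) (G : ι → Multiset ℕ → ℝ) :
    ewensMean θ n (fun s => ∑ i ∈ t, G i s) = ∑ i ∈ t, ewensMean θ n (G i) := by
  rw [ewensMean, ewensSum_sum, Finset.sum_div]; rfl

lemma ewensProb_mono (hθ : 0 < θ) {n : ℕ} {A B : Set (Multiset ℕ)} (h : A ⊆ B) :
    ewensProb θ n A ≤ ewensProb θ n B :=
  ewensMean_mono hθ fun s _ _ =>
    Set.indicator_le_indicator_of_subset h (fun _ => zero_le_one) s

end Mean

/-! ### Characters of a cyclic group and rigidity of the coefficients. -/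

section Characters

/-- The mean square distance between the additive character `k ↦ exp (2 π i k b / L)` of `ℤ / L`
and the function `k ↦ w_k ^ d`. -/
noncomputable def charDist (L : ℕ) (w : ℕ → ℂ) (b : ℤ) (d : ℕ) : ℝ :=
  (∑ k ∈ Finset.range L,
    ‖Complex.exp ((2 * Real.pi * k / L : ℝ) * b * Complex.I) - w k ^ d‖ ^ 2) / L

variable {L : ℕ} {w : ℕ → ℂ}

lemma norm_exp_real_mul_int (x : ℝ) (b : ℤ) : ‖Complex.exp (x * b * Complex.I)‖ = 1 := by
  have : ((x : ℂ) * b * Complex.I) = ((x * b : ℝ) : ℂ) * Complex.I := by push_cast; ring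
  rw [this, Complex.norm_exp_ofReal_mul_I]

lemma norm_sq_sub_le (x y z : ℂ) : ‖x - z‖ ^ 2 ≤ 2 * ‖x - y‖ ^ 2 + 2 * ‖y - z‖ ^ 2 := by
  have h := norm_sub_le_norm_sub_add_norm_sub x y z
  nlinarith [norm_nonneg (x - z), sq_nonneg (‖x - y‖ - ‖y - z‖)]

lemma charDist_le_of_le {b₁ b₂ b₃ : ℤ} {d₁ d₂ d₃ : ℕ}
    (h : ∀ k : ℕ, ‖Complex.exp ((2 * Real.pi * k / L : ℝ) * b₃ * Complex.I) - w k ^ d₃‖ ^ 2 ≤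
      2 * ‖Complex.exp ((2 * Real.pi * k / L : ℝ) * b₁ * Complex.I) - w k ^ d₁‖ ^ 2 +
      2 * ‖Complex.exp ((2 * Real.pi * k / L : ℝ) * b₂ * Complex.I) - w k ^ d₂‖ ^ 2) :
    charDist L w b₃ d₃ ≤ 2 * charDist L w b₁ d₁ + 2 * charDist L w b₂ d₂ := by
  unfold charDist
  rw [mul_div_assoc', mul_div_assoc', ← add_div, Finset.mul_sum, Finset.mul_sum,
    ← Finset.sum_add_distrib]
  gcongr
  exact h _

/-- Both `exp (i x b)` and `w ^ d` are multiplicative and unimodular, so the errors of a product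
add; squaring costs the factors `2`. -/
lemma charDist_add_le (hw : ∀ k, ‖w k‖ = 1) (b b' : ℤ) (d d' : ℕ) :
    charDist L w (b + b') (d + d') ≤ 2 * charDist L w b d + 2 * charDist L w b' d' := by
  refine charDist_le_of_le fun k => ?_
  set x : ℝ := 2 * Real.pi * k / L
  have h1 : Complex.exp (x * ((b + b' : ℤ) : ℂ) * Complex.I) =
      Complex.exp (x * b * Complex.I) * Complex.exp (x * b' * Complex.I) := by
    rw [← Complex.exp_add]; congr 1; push_cast; ring
  have h := norm_sq_sub_le (Complex.exp (x * b * Complex.I) * Complex.exp (x * b' * Complex.I))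
    (w k ^ d * Complex.exp (x * b' * Complex.I)) (w k ^ d * w k ^ d')
  rw [← sub_mul, ← mul_sub, norm_mul, norm_mul, norm_exp_real_mul_int, norm_pow, hw, one_pow,
    one_mul, mul_one] at h
  rw [h1, pow_add]
  exact h

lemma charDist_sub_le (hw : ∀ k, ‖w k‖ = 1) (b b' : ℤ) (d d' : ℕ) :
    charDist L w (b' - b) d' ≤ 2 * charDist L w b' (d + d') + 2 * charDist L w b d := by
  refine charDist_le_of_le fun k => ?_
  set x : ℝ := 2 * Real.pi * k / L
  have h1 : Complex.exp (x * b' * Complex.I) =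
      Complex.exp (x * b * Complex.I) * Complex.exp (x * ((b' - b : ℤ) : ℂ) * Complex.I) := by
    rw [← Complex.exp_add]; congr 1; push_cast; ring
  have h2 : ‖Complex.exp (x * ((b' - b : ℤ) : ℂ) * Complex.I) - w k ^ d'‖ =
      ‖Complex.exp (x * b' * Complex.I) - Complex.exp (x * b * Complex.I) * w k ^ d'‖ := by
    rw [h1, ← mul_sub, norm_mul, norm_exp_real_mul_int, one_mul]
  have h := norm_sq_sub_le (Complex.exp (x * b' * Complex.I)) (w k ^ (d + d'))
    (Complex.exp (x * b * Complex.I) * w k ^ d')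
  have h3 : ‖w k ^ (d + d') - Complex.exp (x * b * Complex.I) * w k ^ d'‖ =
      ‖Complex.exp (x * b * Complex.I) - w k ^ d‖ := by
    rw [pow_add, ← sub_mul, norm_mul, norm_pow, hw, one_pow, mul_one, norm_sub_rev]
  rw [h3] at h
  rw [h2]
  exact h

/-- Distinct characters are far from each other. -/
lemma eq_of_charDist_lt (hL : 0 < L) {b b' : ℤ} {d : ℕ} (hb : |b - b'| < L)
    (h : charDist L w b d + charDist L w b' d < 1) : b = b' := by
  by_contra hne
  have hLc : (L : ℂ) ≠ 0 := by exact_mod_cast hL.ne'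
  have hL' : (0 : ℝ) < L := by exact_mod_cast hL
  set z : ℂ := Complex.exp (2 * Real.pi * (b - b' : ℤ) / L * Complex.I) with hz
  have hzL : z ^ L = 1 := by
    rw [hz, ← Complex.exp_nat_mul, Complex.exp_eq_one_iff]
    exact ⟨b - b', by field_simp⟩
  have hz1 : z ≠ 1 := by
    rw [hz, Ne, Complex.exp_eq_one_iff]
    rintro ⟨m, hm⟩
    have hpi : (Real.pi : ℂ) ≠ 0 := by exact_mod_cast Real.pi_ne_zero
    have h1 : ((b - b' : ℤ) : ℂ) = ((L * m : ℤ) : ℂ) := by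
      push_cast at hm ⊢
      have h2 : 2 * (Real.pi : ℂ) * Complex.I ≠ 0 := by simp [hpi]
      field_simp at hm
      linear_combination hm
    have h3 : b - b' = L * m := by exact_mod_cast h1
    have h4 : b - b' = 0 := Int.eq_zero_of_abs_lt_dvd ⟨m, h3⟩ hb
    omega
  -- Orthogonality: with `0 < |b - b'| < L`, `z` is a nontrivial `L`-th root of unity. The two
  -- characters are at mean square distance `2`, so they cannot both be close to `w ^ d`.
  have hgeom : ∑ k ∈ Finset.range L, z ^ k = 0 := by
    have := mul_neg_geom_sum z L
    rw [hzL, sub_self] at this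
    exact (mul_eq_zero.1 this).resolve_left (sub_ne_zero.2 hz1.symm)
  have hterm : ∀ k ∈ Finset.range L, 2 - 2 * (z ^ k).re ≤
      2 * ‖Complex.exp ((2 * Real.pi * k / L : ℝ) * b * Complex.I) - w k ^ d‖ ^ 2 +
      2 * ‖Complex.exp ((2 * Real.pi * k / L : ℝ) * b' * Complex.I) - w k ^ d‖ ^ 2 := by
    intro k _
    set x : ℝ := 2 * Real.pi * k / L with hx
    have h1 : z ^ k = Complex.exp (x * b * Complex.I) *
        (starRingEnd ℂ) (Complex.exp (x * b' * Complex.I)) := by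
      rw [← Complex.exp_conj, ← Complex.exp_add, hz, ← Complex.exp_nat_mul]
      congr 1
      simp only [map_mul, Complex.conj_ofReal, Complex.conj_I, map_intCast, hx]
      push_cast
      field_simp
      ring
    have h2 := norm_sq_sub_le (Complex.exp (x * b * Complex.I)) (w k ^ d)
      (Complex.exp (x * b' * Complex.I))
    rw [norm_sub_rev (w k ^ d)] at h2
    refine le_trans (le_of_eq ?_) h2
    rw [Complex.sq_norm, Complex.normSq_sub, ← Complex.sq_norm, ← Complex.sq_norm,
      norm_exp_real_mul_int, norm_exp_real_mul_int, h1]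
    ring
  have hsum := Finset.sum_le_sum hterm
  rw [Finset.sum_sub_distrib, ← Finset.mul_sum, ← Complex.re_sum, hgeom, Finset.sum_add_distrib,
    ← Finset.mul_sum, ← Finset.mul_sum] at hsum
  simp only [Finset.sum_const, Finset.card_range, nsmul_eq_mul, Complex.zero_re] at hsum
  unfold charDist at h
  rw [← add_div, div_lt_one hL'] at h
  linarith

end Characters

lemma sum_inv_Ioc_le {x n R : ℕ} (hx : 1 ≤ x) (hR : 1 ≤ R) (hn : n ≤ R * x) (hxn : x ≤ n) :
    ∑ j ∈ Finset.Ioc x n, 1 / (j : ℝ) ≤ 1 + Real.log R := by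
  have h1 : Real.log x ≤ ∑ j ∈ Finset.Icc 1 x, 1 / (j : ℝ) := by
    have := log_add_one_le_harmonic x
    rw [harmonic_eq_sum_Icc] at this
    push_cast at this
    simp only [one_div]
    exact (Real.log_le_log (by exact_mod_cast hx) (by linarith)).trans this
  have h2 := sum_inv_le_one_add_log (n := n)
  have h3 : ∑ j ∈ Finset.Icc 1 n, 1 / (j : ℝ) =
      ∑ j ∈ Finset.Icc 1 x, 1 / (j : ℝ) + ∑ j ∈ Finset.Ioc x n, 1 / (j : ℝ) := by
    rw [← Finset.sum_union]
    · congr 1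
      ext j
      simp only [Finset.mem_union, Finset.mem_Icc, Finset.mem_Ioc]
      omega
    · rw [Finset.disjoint_left]
      intro j
      simp only [Finset.mem_Icc, Finset.mem_Ioc]
      omega
  have h4 : Real.log n ≤ Real.log R + Real.log x := by
    rw [← Real.log_mul (by positivity) (by positivity)]
    apply Real.log_le_log
    · exact_mod_cast (by omega : 0 < n)
    · exact_mod_cast hn
  linarith

open Classical in
/-- If all the characters `j ↦ exp (i x a_j)` are close to functions `j ↦ w ^ j`, then `a` is
close to a linear function. -/
theorem exists_slope (C : ℝ) : ∃ C' : ℝ, ∃ n₀ : ℕ, ∀ n, n₀ ≤ n → ∀ a : ℕ → ℤ,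
    (∀ x : ℝ, 0 ≤ x → x ≤ 2 * Real.pi → ∃ w : ℂ, ‖w‖ = 1 ∧
      ∑ j ∈ Finset.Icc 1 n, ‖Complex.exp (x * a j * Complex.I) - w ^ j‖ ^ 2 / j ≤ C) →
    ∃ s : ℤ, ∑ j ∈ Finset.Icc 1 n, (if a j = s * j then (0 : ℝ) else 1) / j ≤ C' := by
  obtain ⟨T, hT⟩ := exists_nat_ge (32 * (25 * C + 1))
  refine ⟨25 * C + (1 + Real.log (2 * (16 * 32 ^ T) : ℕ)), 16 * 32 ^ T, fun n hn a ha => ?_⟩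
  set M : ℕ := ∑ j ∈ Finset.Icc 1 n, (a j).natAbs with hM
  have haM : ∀ j, 1 ≤ j → j ≤ n → |a j| ≤ M := by
    intro j h1 h2
    rw [Int.abs_eq_natAbs]
    exact_mod_cast Finset.single_le_sum (f := fun j => (a j).natAbs) (fun _ _ => Nat.zero_le _)
      (Finset.mem_Icc.2 ⟨h1, h2⟩)
  -- The differences `A d` below are at most `2 M` in absolute value, so `A (d + 1) - (A d + A 1)`
  -- is at most `6 M < L` and characters modulo `L` separate the integers concerned.
  set L : ℕ := 6 * M + 1 with hL
  have hL0 : (0 : ℝ) < L := by rw [hL]; positivity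
  have hx : ∀ k : ℕ, ∃ w : ℂ, ‖w‖ = 1 ∧ (k < L → ∑ j ∈ Finset.Icc 1 n,
      ‖Complex.exp ((2 * Real.pi * k / L : ℝ) * a j * Complex.I) - w ^ j‖ ^ 2 / j ≤ C) := by
    intro k
    by_cases hk : k < L
    · obtain ⟨w, hw, h⟩ := ha (2 * Real.pi * k / L) (by have := Real.pi_pos; positivity) (by
        rw [div_le_iff₀ hL0]
        have : (k : ℝ) ≤ L := by exact_mod_cast hk.le
        have := Real.pi_pos
        gcongr)
      exact ⟨w, hw, fun _ => h⟩
    · exact ⟨1, by simp, fun h => absurd h hk⟩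
  choose w hw1 hw using hx
  have hcd : ∀ b d, 0 ≤ charDist L w b d := fun b d => by unfold charDist; positivity
  have htot : ∑ j ∈ Finset.Icc 1 n, charDist L w (a j) j / j ≤ C := by
    have h1 : ∑ j ∈ Finset.Icc 1 n, charDist L w (a j) j / j =
        (∑ k ∈ Finset.range L, ∑ j ∈ Finset.Icc 1 n,
          ‖Complex.exp ((2 * Real.pi * k / L : ℝ) * a j * Complex.I) - w k ^ j‖ ^ 2 / j) / L := by
      rw [Finset.sum_comm, Finset.sum_div]
      refine Finset.sum_congr rfl fun j _ => ?_
      rw [charDist, ← Finset.sum_div]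
      ring
    rw [h1, div_le_iff₀ hL0]
    refine (Finset.sum_le_sum fun k hk => hw k (Finset.mem_range.1 hk)).trans (le_of_eq ?_)
    simp [mul_comm]
  -- The threshold leaves room for two uses of the triangle inequality: differences are within `4 /
  -- 25`, sums of two differences within `16 / 25`, and `16 / 25 + 4 / 25 < 1`. By Markov's
  -- inequality the bad indices have logarithmic weight at most `25 C`.
  set f : ℕ → ℝ := fun j => if charDist L w (a j) j ≤ 1 / 25 then 1 else 0 with hf
  have hf0 : ∀ j, 0 ≤ f j := fun j => by simp only [hf]; split_ifs <;> simp
  have hf1 : ∀ j, f j ≤ 1 := fun j => by simp only [hf]; split_ifs <;> simp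
  have hfgood : ∀ j, 0 < f j → charDist L w (a j) j ≤ 1 / 25 := by
    intro j h
    by_contra hcon
    simp only [hf, if_neg hcon, lt_self_iff_false] at h
  have hbad : ∑ j ∈ Finset.Icc 1 n, (1 - f j) / j ≤ 25 * C := by
    refine le_trans ?_ (mul_le_mul_of_nonneg_left htot (by norm_num : (0 : ℝ) ≤ 25))
    rw [Finset.mul_sum]
    refine Finset.sum_le_sum fun j _ => ?_
    rw [mul_div_assoc']
    gcongr
    have := hcd (a j) j
    simp only [hf]
    split_ifs with h
    · linarith
    · linarith
  obtain ⟨i, hi, hD⟩ := exists_scale_deficit_le hf0 hf1 hT (hbad.trans_lt (lt_add_one _))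
  set v := n / 16 / 32 ^ i with hv
  have hu : n / (16 * 32 ^ T) ≤ v := by
    rw [hv, Nat.div_div_eq_div_mul]
    apply Nat.div_le_div_left
    · gcongr
      · norm_num
    · positivity
  have hu1 : 1 ≤ n / (16 * 32 ^ T) := by
    rw [Nat.one_le_div_iff (by positivity)]; exact hn
  have hv16 : 16 * v ≤ n := by
    have : v ≤ n / 16 := Nat.div_le_self _ _
    omega
  have hnR : n ≤ 2 * (16 * 32 ^ T) * v := by
    have h1 := Nat.lt_mul_div_succ n (show 0 < 16 * 32 ^ T by positivity)
    have h2 : 16 * 32 ^ T * (n / (16 * 32 ^ T) + 1) ≤ 16 * 32 ^ T * (2 * v) := by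
      gcongr
      omega
    have h3 : 16 * 32 ^ T * (2 * v) = 2 * (16 * 32 ^ T) * v := by ring
    omega
  clear_value v
  have hv1 : 1 ≤ v := hu1.trans hu
  have hv' : (1 : ℝ) ≤ v := by exact_mod_cast hv1
  -- Among the `8 v` candidates `i`, at most `2 v` fail to have both `i` and `i + d` good. The
  -- difference `a (i + d) - a i` serves as the value at `d`, even when `d` itself is bad.
  have hdiff : ∀ d : ℕ, ∃ b : ℤ, 1 ≤ d → d ≤ 8 * v →
      |b| ≤ 2 * M ∧ charDist L w b d ≤ 4 / 25 := by
    intro d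
    by_cases hd : 1 ≤ d ∧ d ≤ 8 * v
    · obtain ⟨i, hi, hpos⟩ : ∃ i ∈ Finset.Icc 1 (8 * v), 0 < f i * f (i + d) := by
        by_contra! hcon
        have e1 : ∑ i ∈ Finset.Icc 1 (8 * v), (1 - f i) ≤ v := by
          refine sum_one_sub_comp_le (φ := fun i => i) hf1 hD (fun a _ b _ h => h) ?_
          intro i hi
          simp only [Finset.mem_Icc] at hi ⊢
          omega
        have e2 : ∑ i ∈ Finset.Icc 1 (8 * v), (1 - f (i + d)) ≤ v := by
          refine sum_one_sub_comp_le (φ := fun i => i + d) hf1 hD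
            (fun a _ b _ h => Nat.add_right_cancel h) ?_
          intro i hi
          simp only [Finset.mem_Icc] at hi ⊢
          omega
        have e3 : ∑ i ∈ Finset.Icc 1 (8 * v), (1 : ℝ) ≤
            ∑ i ∈ Finset.Icc 1 (8 * v), ((1 - f i) + (1 - f (i + d))) := by
          refine Finset.sum_le_sum fun i hi => ?_
          have := hcon i hi
          have := hf1 i
          have := hf1 (i + d)
          nlinarith
        rw [Finset.sum_add_distrib, Finset.sum_const, Nat.card_Icc, nsmul_eq_mul, mul_one,
          Nat.add_sub_cancel] at e3
        push_cast at e3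
        linarith
      rw [Finset.mem_Icc] at hi
      have hfi : 0 < f i := pos_of_mul_pos_left hpos (hf0 _)
      have hfd : 0 < f (i + d) := pos_of_mul_pos_right hpos (hf0 _)
      refine ⟨a (i + d) - a i, fun _ _ => ⟨?_, ?_⟩⟩
      · have h1 := haM (i + d) (by omega) (by omega)
        have h2 := haM i (by omega) (by omega)
        rw [abs_le] at h1 h2 ⊢
        omega
      · have h1 := charDist_sub_le (L := L) hw1 (a i) (a (i + d)) i d
        have h2 := hfgood _ hfi
        have h3 := hfgood _ hfd
        linarith
    · exact ⟨0, fun h1 h2 => absurd ⟨h1, h2⟩ hd⟩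
  choose A hA using hdiff
  -- `A d + A 1` and `A (d + 1)` are both close to `w ^ (d + 1)`, hence equal: approximate
  -- additivity becomes exact.
  have hlin : ∀ d : ℕ, 1 ≤ d → d ≤ 8 * v → A d = A 1 * d := by
    intro d hd
    induction d, hd using Nat.le_induction with
    | base => intro _; simp
    | succ d hd ih =>
      intro hdv
      have h0 := hA 1 le_rfl (by omega)
      have h1 := hA d hd (by omega)
      have h2 := hA (d + 1) (by omega) hdv
      have h3 := charDist_add_le (L := L) hw1 (A d) (A 1) d 1
      have h4 : A (d + 1) = A d + A 1 := by
        refine eq_of_charDist_lt (L := L) (w := w) (d := d + 1) (by omega) ?_ ?_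
        · have e0 := h0.1
          have e1 := h1.1
          have e2 := h2.1
          rw [abs_le] at e0 e1 e2
          rw [abs_lt]
          constructor <;> omega
        · linarith [h0.2, h1.2, h2.2]
      rw [h4, ih (by omega)]
      push_cast
      ring
  refine ⟨A 1, ?_⟩
  have hval : ∀ d : ℕ, 1 ≤ d → d ≤ 8 * v → 0 < f d → a d = A 1 * d := by
    intro d h1 h2 h3
    rw [← hlin d h1 h2]
    have hd := hA d h1 h2
    refine eq_of_charDist_lt (L := L) (w := w) (d := d) (by omega) ?_ ?_
    · have e0 := haM d h1 (by omega)
      have e1 := hd.1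
      rw [abs_le] at e0 e1
      rw [abs_lt]
      constructor <;> omega
    · linarith [hfgood d h3, hd.2]
  -- Exceptions are either bad or beyond `8 v`. Since `n / v` is bounded, the indices beyond `8 v`
  -- have bounded logarithmic weight.
  have hfin : ∀ j ∈ Finset.Icc 1 n, (if a j = A 1 * j then (0 : ℝ) else 1) / j ≤
      (1 - f j) / j + if 8 * v < j then 1 / (j : ℝ) else 0 := by
    intro j hj
    rw [Finset.mem_Icc] at hj
    have hj0 : (0 : ℝ) < j := by exact_mod_cast hj.1
    have h1 : 0 ≤ (1 - f j) / j := div_nonneg (by linarith [hf1 j]) hj0.le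
    split_ifs with h2 h3 h3
    · rw [zero_div]; positivity
    · rw [zero_div]; linarith
    · linarith
    · have : f j = 0 := by
        by_contra h4
        exact h2 (hval j hj.1 (by omega) (lt_of_le_of_ne (hf0 j) (Ne.symm h4)))
      rw [this]; simp
  refine (Finset.sum_le_sum hfin).trans ?_
  rw [Finset.sum_add_distrib, ← Finset.sum_filter]
  have hset : (Finset.Icc 1 n).filter (8 * v < ·) = Finset.Ioc (8 * v) n := by
    ext j
    simp only [Finset.mem_filter, Finset.mem_Icc, Finset.mem_Ioc]
    omega
  rw [hset]
  refine add_le_add hbad (sum_inv_Ioc_le (by omega) ?_ ?_ (by omega))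
  · exact Nat.one_le_iff_ne_zero.2 (by positivity)
  · refine hnR.trans ?_
    gcongr
    omega

/-! ### Consequences of tightness for the coefficients. -/

/-- The additive functions given by `a n` take values in a bounded interval `[0, K]` with
probability close to one. -/
def TightNonneg (θ : ℝ) (a : ℕ → ℕ → ℤ) : Prop :=
  ∀ δ : ℝ, 0 < δ → ∃ K : ℕ, ∀ᶠ n in atTop,
    ewensProb θ n {s | ¬(0 ≤ additiveSum (a n) s ∧ additiveSum (a n) s ≤ K)} ≤ δ

lemma prod_map_exp_eq (a : ℕ → ℤ) (t : ℝ) (s : Multiset ℕ) :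
    (s.map fun j => Complex.exp (t * a j * Complex.I)).prod =
      Complex.exp (t * additiveSum a s * Complex.I) := by
  induction s using Multiset.induction_on with
  | empty => simp [additiveSum]
  | cons j s ih =>
    rw [Multiset.map_cons, Multiset.prod_cons, ih, ← Complex.exp_add]
    congr 1
    simp only [additiveSum, Multiset.map_cons, Multiset.sum_cons]
    push_cast
    ring

lemma re_ewensSum (θ : ℝ) (n : ℕ) (G : Multiset ℕ → ℂ) :
    (ewensSum θ n G).re = ewensSum θ n fun s => (G s).re := by
  rw [ewensSum, ewensSum, Complex.re_sum]
  simp only [Complex.smul_re]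

lemma prod_map_ite_eq (p : ℕ → Prop) [DecidablePred p] (s : Multiset ℕ) :
    (s.map fun j => if p j then (1 : ℝ) else 0).prod = {s | ∀ j ∈ s, p j}.indicator 1 s := by
  induction s using Multiset.induction_on with
  | empty => simp
  | cons j s ih =>
    rw [Multiset.map_cons, Multiset.prod_cons, ih]
    by_cases h : p j <;> by_cases h' : ∀ i ∈ s, p i <;> simp [Set.indicator, h, h']

lemma ewensProb_forall (θ : ℝ) (n : ℕ) (p : ℕ → Prop) [DecidablePred p] :
    ewensProb θ n {s | ∀ j ∈ s, p j} =
      mulCoeff θ (fun j => if p j then (1 : ℝ) else 0) n / mass θ n := by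
  rw [ewensProb, ewensMean, mulCoeff]
  simp_rw [prod_map_ite_eq]

variable {θ : ℝ} {a : ℕ → ℕ → ℤ}

/-- For values in `[0, K]` the cosine of `t` times the value is at least `1 / 2`, elsewhere at least
`-1`; hence the real part of the mean is at least `1 / 2 - (3 / 2) (1 / 6) = 1 / 4`. -/
lemma norm_mulCoeff_exp_ge (hθ : 0 < θ) {n K : ℕ} {b : ℕ → ℤ}
    (h : ewensProb θ n {s | ¬(0 ≤ additiveSum b s ∧ additiveSum b s ≤ K)} ≤ 1 / 6) {t : ℝ}
    (ht : 0 ≤ t) (htK : t * K ≤ 1) :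
    1 / 4 * mass θ n ≤ ‖mulCoeff θ (fun j => Complex.exp (t * b j * Complex.I)) n‖ := by
  refine le_trans ?_ (Complex.re_le_norm _)
  have hm := mass_pos hθ n
  rw [mulCoeff, re_ewensSum, ← le_div_iff₀ hm]
  set A := {s | ¬(0 ≤ additiveSum b s ∧ additiveSum b s ≤ (K : ℤ))} with hA
  have h1 : ewensMean θ n (fun s => 1 / 2 * 1 + (-(3 / 2)) * A.indicator 1 s) ≤
      ewensMean θ n (fun s => ((s.map fun j => Complex.exp (t * b j * Complex.I)).prod).re) := by
    refine ewensMean_mono hθ fun s _ _ => ?_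
    rw [prod_map_exp_eq, show (t : ℂ) * additiveSum b s * Complex.I =
      ((t * additiveSum b s : ℝ) : ℂ) * Complex.I by push_cast; ring, Complex.exp_ofReal_mul_I_re]
    by_cases hs : s ∈ A
    · rw [Set.indicator_of_mem hs]
      simp only [Pi.one_apply]
      linarith [Real.neg_one_le_cos (t * additiveSum b s)]
    · rw [Set.indicator_of_notMem hs]
      simp only [hA, Set.mem_ofPred_eq, not_not] at hs
      have h0 : (0 : ℝ) ≤ additiveSum b s := by exact_mod_cast hs.1
      have h1 : (additiveSum b s : ℝ) ≤ K := by exact_mod_cast hs.2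
      have h2 : t * additiveSum b s ≤ 1 := le_trans (by gcongr) htK
      have h3 : 0 ≤ t * additiveSum b s := by positivity
      have := Real.one_sub_sq_div_two_le_cos (x := t * additiveSum b s)
      nlinarith
  rw [ewensMean_add, ewensMean_const_mul, ewensMean_const_mul, ewensMean_one hθ] at h1
  change ewensMean θ n (A.indicator 1) ≤ _ at h
  refine le_trans ?_ h1
  linarith

lemma norm_pow_sub_pow_le {u w : ℂ} (hu : ‖u‖ = 1) (hw : ‖w‖ = 1) (B : ℕ) :
    ‖u ^ B - w ^ B‖ ≤ B * ‖u - w‖ := by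
  induction B with
  | zero => simp
  | succ B ih =>
    have : u ^ (B + 1) - w ^ (B + 1) = u * (u ^ B - w ^ B) + (u - w) * w ^ B := by ring
    rw [this]
    refine (norm_add_le _ _).trans ?_
    rw [norm_mul, norm_mul, norm_pow, hu, hw, one_pow]
    push_cast
    linarith

/-- Tightness makes all the characters `j ↦ exp (i x a_j)` close to functions `j ↦ w ^ j`. -/
lemma exists_phases (hθ : 1 ≤ θ) (ha : TightNonneg θ a) : ∃ C : ℝ, ∀ᶠ n in atTop,
    ∀ x : ℝ, 0 ≤ x → x ≤ 2 * Real.pi → ∃ w : ℂ, ‖w‖ = 1 ∧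
      ∑ j ∈ Finset.Icc 1 n, ‖Complex.exp (x * a n j * Complex.I) - w ^ j‖ ^ 2 / j ≤ C := by
  have hθ0 : 0 < θ := by linarith
  obtain ⟨K, hK⟩ := ha (1 / 6) (by norm_num)
  obtain ⟨C, hC⟩ := exists_phase hθ (c := 1 / 4) (by norm_num)
  -- Every `x ≤ 2 π` becomes a frequency `x / B` with `(x / B) K ≤ 1`. The phase found there is
  -- raised to the power `B`, which multiplies distances by at most `B`; the `+ 1` keeps `B`
  -- positive.
  obtain ⟨B, hB⟩ := exists_nat_ge (2 * Real.pi * (K + 1))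
  have hpi := Real.pi_pos
  have hB0 : (0 : ℝ) < B := lt_of_lt_of_le (by positivity) hB
  refine ⟨(B : ℝ) ^ 2 * (2 * C), ?_⟩
  filter_upwards [hK, eventually_ge_atTop 1] with n hn hn1 x hx0 hx1
  have htK : x / B * K ≤ 1 := by
    rw [div_mul_eq_mul_div, div_le_one hB0]
    refine le_trans ?_ hB
    gcongr
    linarith
  have h1 := norm_mulCoeff_exp_ge hθ0 hn (t := x / B) (by positivity) htK
  obtain ⟨t, ht⟩ := hC n hn1 _ (fun j => (norm_exp_real_mul_int _ _).le) h1
  set z := Complex.exp (t * Complex.I) with hz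
  have hz1 : ‖z‖ = 1 := Complex.norm_exp_ofReal_mul_I t
  have hzinv : ‖z⁻¹‖ = 1 := by rw [norm_inv, hz1, inv_one]
  have hz0 : z ≠ 0 := Complex.exp_ne_zero _
  refine ⟨z⁻¹ ^ B, by rw [norm_pow, hzinv, one_pow], ?_⟩
  refine le_trans ?_ (mul_le_mul_of_nonneg_left (mul_le_mul_of_nonneg_left ht zero_le_two)
    (sq_nonneg (B : ℝ)))
  rw [Finset.mul_sum, Finset.mul_sum]
  refine Finset.sum_le_sum fun j _ => ?_
  rw [mul_div_assoc', mul_div_assoc']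
  gcongr
  set u := Complex.exp ((x / B : ℝ) * a n j * Complex.I) with hu
  have hu1 : ‖u‖ = 1 := norm_exp_real_mul_int _ _
  have huB : Complex.exp (x * a n j * Complex.I) = u ^ B := by
    rw [hu, ← Complex.exp_nat_mul]
    congr 1
    have : (B : ℂ) ≠ 0 := by exact_mod_cast hB0.ne'
    push_cast
    field_simp
  have h2 := norm_pow_sub_pow_le hu1 (w := z⁻¹ ^ j) (by rw [norm_pow, hzinv, one_pow]) B
  have h3 : ‖u - z⁻¹ ^ j‖ ^ 2 = 2 * (1 - (u * z ^ j).re) := by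
    have h4 : ‖u - z⁻¹ ^ j‖ = ‖u * z ^ j - 1‖ := by
      rw [← mul_one ‖u - z⁻¹ ^ j‖, ← one_pow j, ← hz1, ← norm_pow, ← norm_mul, sub_mul, ← mul_pow,
        inv_mul_cancel₀ hz0, one_pow]
    rw [h4, Complex.sq_norm, Complex.normSq_sub, ← Complex.sq_norm, ← Complex.sq_norm, norm_mul,
      norm_pow, hz1, hu1]
    simp
    ring
  rw [huB, ← pow_mul, mul_comm B j, pow_mul, ← h3, ← mul_pow]
  gcongr

lemma sum_map_mul_const (s : Multiset ℕ) (c : ℤ) :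
    (s.map fun j : ℕ => c * (j : ℤ)).sum = c * (s.sum : ℤ) := by
  rw [Multiset.sum_map_mul_left]
  congr 1
  exact sum_map_natCast s

/-- Tightness bounds the logarithmic weight of the cycle lengths with `a_j ≠ 0`. -/
theorem exists_support_bound (hθ : 1 ≤ θ) (ha : TightNonneg θ a) : ∃ C : ℝ, ∀ᶠ n in atTop,
    ∑ j ∈ Finset.Icc 1 n, (1 - if a n j = 0 then (1 : ℝ) else 0) / j ≤ C := by
  have hθ0 : 0 < θ := by linarith
  obtain ⟨C, hC⟩ := exists_phases hθ ha
  obtain ⟨C', n₀, hC'⟩ := exists_slope C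
  obtain ⟨c, hc, m₀, hm₀⟩ := exists_le_mulCoeff hθ C'
  obtain ⟨K, hK⟩ := ha (c / 2) (by positivity)
  refine ⟨C', ?_⟩
  filter_upwards [hC, hK, eventually_ge_atTop n₀, eventually_ge_atTop m₀,
    eventually_gt_atTop K] with n h1 h2 h3 h4 h5
  obtain ⟨s, hs⟩ := hC' n h3 (a n) h1
  have hs' : ∑ j ∈ Finset.Icc 1 n, (1 - if a n j = s * j then (1 : ℝ) else 0) / j ≤ C' := by
    refine le_trans (le_of_eq (Finset.sum_congr rfl fun j _ => ?_)) hs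
    split_ifs <;> simp
  -- The sieve gives probability at least `c` to the event that all cycles satisfy `a_j = s j`.
  -- There the value is `s n`, outside `[0, K]` if `s ≠ 0` and `n > K`, an event of probability at
  -- most `c / 2`.
  suffices hs0 : s = 0 by simpa [hs0] using hs'
  by_contra hne
  have h6 := hm₀ n h4 (fun j => if a n j = s * j then (1 : ℝ) else 0)
    (fun j => by split_ifs <;> simp) (fun j => by split_ifs <;> simp) hs'
  have h7 : ewensProb θ n {t | ∀ j ∈ t, a n j = s * j} ≤ c / 2 := by
    refine le_trans ?_ h2
    refine ewensMean_mono hθ0 fun t ht _ => ?_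
    by_cases hmem : t ∈ {t : Multiset ℕ | ∀ j ∈ t, a n j = s * j}
    · rw [Set.indicator_of_mem hmem, Set.indicator_of_mem]
      rintro ⟨h8, h9⟩
      have h10 : additiveSum (a n) t = s * n := by
        rw [additiveSum, Multiset.map_congr rfl hmem, sum_map_mul_const, ht]
      rw [h10] at h8 h9
      have hn0 : (0 : ℤ) < n := by exact_mod_cast (by omega : 0 < n)
      have h11 : 1 ≤ s := by
        rcases lt_trichotomy s 0 with h | h | h
        · nlinarith
        · exact absurd h hne
        · omega
      have h12 : (K : ℤ) < n := by exact_mod_cast h5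
      nlinarith
    · rw [Set.indicator_of_notMem hmem]
      exact Set.indicator_nonneg (fun _ _ => zero_le_one) _
  rw [ewensProb_forall θ n fun j => a n j = s * j] at h7
  have := mass_pos hθ0 n
  rw [div_le_iff₀ this] at h7
  nlinarith

/-- The expected number of cycles whose length lies in a given set. -/
lemma ewensMean_count (p : ℕ → Prop) [DecidablePred p] (n : ℕ) :
    ewensMean θ n (fun s => (s.map fun j => if p j then (1 : ℝ) else 0).sum) =
      ∑ j ∈ Finset.Icc 1 n, θ / j * (if p j then mass θ (n - j) / mass θ n else 0) := by
  rw [ewensMean, ewensSum_sum_erase θ n fun j _ => if p j then (1 : ℝ) else 0, Finset.sum_div]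
  refine Finset.sum_congr rfl fun j _ => ?_
  have h := ewensSum_const_mul (A := ℝ) θ (n - j) (if p j then 1 else 0) (fun _ => 1)
  simp only [mul_one] at h
  rw [h, ← mass, smul_eq_mul]
  split_ifs <;> simp [mul_div_assoc]

/-- The expected number of cycles with a negative coefficient tends to zero. -/
theorem tendsto_count_neg (hθ : 1 ≤ θ) (ha : TightNonneg θ a)
    (hneg : Tendsto (fun n => ewensProb θ n {s | additiveSum (a n) s < 0}) atTop (𝓝 0)) :
    Tendsto (fun n => ewensMean θ n fun s => (s.map fun j => if a n j < 0 then (1 : ℝ) else 0).sum)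
      atTop (𝓝 0) := by
  have hθ0 : 0 < θ := by linarith
  obtain ⟨C, hC⟩ := exists_support_bound hθ ha
  obtain ⟨c, hc, m₀, hm₀⟩ := exists_le_mulCoeff hθ C
  have hlim : Tendsto (fun n : ℕ => c⁻¹ * ewensProb θ n {s | additiveSum (a n) s < 0} +
      m₀ * (2 * θ) * (n : ℝ)⁻¹) atTop (𝓝 0) := by
    have h1 := hneg.const_mul c⁻¹
    have h2 := (tendsto_inv_atTop_nhds_zero_nat (𝕜 := ℝ)).const_mul (m₀ * (2 * θ))
    simpa using h1.add h2
  refine squeeze_zero' (Eventually.of_forall fun n => ewensMean_nonneg hθ0 fun s => ?_) ?_ hlim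
  · refine Multiset.sum_nonneg fun x hx => ?_
    obtain ⟨j, _, rfl⟩ := Multiset.mem_map.1 hx
    split_ifs <;> simp
  filter_upwards [hC, eventually_ge_atTop (2 * m₀), eventually_ge_atTop 1] with n h1 h2 h3
  have hn0 : (0 : ℝ) < n := by exact_mod_cast h3
  have hmn := mass_pos hθ0 n
  set f : ℕ → ℝ := fun j => if a n j = 0 then 1 else 0 with hf
  have hf0 : ∀ j, 0 ≤ f j := fun j => by simp only [hf]; split_ifs <;> simp
  have hf1 : ∀ j, f j ≤ 1 := fun j => by simp only [hf]; split_ifs <;> simp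
  -- The left side sums over permutations with one negative cycle and all other coefficients zero.
  -- Such a permutation has a negative value, and only one of its cycles can be the negative one, so
  -- nothing is counted twice.
  have hkey : ∑ j ∈ Finset.Icc 1 n, θ / j * (if a n j < 0 then mulCoeff θ f (n - j) else 0) ≤
      ewensSum θ n ({s | additiveSum (a n) s < 0}.indicator 1) := by
    have h4 := ewensSum_sum_erase θ n fun j s =>
      (if a n j < 0 then (1 : ℝ) else 0) * (s.map f).prod
    simp_rw [ewensSum_const_mul, smul_eq_mul] at h4
    have h5 : ∀ j, (if a n j < 0 then mulCoeff θ f (n - j) else 0) =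
        (if a n j < 0 then (1 : ℝ) else 0) * ewensSum θ (n - j) fun s => (s.map f).prod := by
      intro j
      rw [mulCoeff]
      split_ifs <;> simp
    simp_rw [h5]
    rw [← h4]
    refine ewensSum_mono hθ0.le fun s _ _ => ?_
    simp_rw [hf, prod_map_ite_eq]
    by_cases hex : ∃ j ∈ s, a n j < 0 ∧ ∀ i ∈ s.erase j, a n i = 0
    · obtain ⟨j, hj, hj1, hj2⟩ := hex
      obtain ⟨t, rfl⟩ := Multiset.exists_cons_of_mem hj
      rw [Multiset.erase_cons_head] at hj2
      have hsum : additiveSum (a n) (j ::ₘ t) = a n j := by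
        rw [additiveSum, Multiset.map_cons, Multiset.sum_cons,
          Multiset.sum_eq_zero (by simpa using hj2), add_zero]
      rw [Set.indicator_of_mem (by rw [Set.mem_ofPred_eq, hsum]; exact hj1), Multiset.map_cons,
        Multiset.sum_cons, Multiset.sum_eq_zero, add_zero]
      · rw [if_pos hj1, one_mul]
        exact Set.indicator_le_self' (fun _ _ => zero_le_one) _
      · intro x hx
        obtain ⟨i, hi, rfl⟩ := Multiset.mem_map.1 hx
        rw [if_neg (by rw [hj2 i hi]; simp), zero_mul]
    · rw [Multiset.sum_eq_zero]
      · exact Set.indicator_nonneg (fun _ _ => zero_le_one) _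
      · intro x hx
        obtain ⟨i, hi, rfl⟩ := Multiset.mem_map.1 hx
        by_cases hi1 : a n i < 0
        · rw [Set.indicator_of_notMem, mul_zero]
          exact fun h => hex ⟨i, hi, hi1, h⟩
        · rw [if_neg hi1, zero_mul]
  rw [ewensMean_count]
  -- The sieve applies to the remaining `n - j` points once `n - j ≥ m₀`. The at most `m₀` other
  -- lengths satisfy `j ≥ n / 2` and cost at most `2 θ / n` each.
  have hterm : ∀ j ∈ Finset.Icc 1 n,
      θ / j * (if a n j < 0 then mass θ (n - j) / mass θ n else 0) ≤
        c⁻¹ * (θ / j * (if a n j < 0 then mulCoeff θ f (n - j) else 0) / mass θ n) +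
          if n - m₀ < j then 2 * θ * (n : ℝ)⁻¹ else 0 := by
    intro j hj
    rw [Finset.mem_Icc] at hj
    have hj0 : (0 : ℝ) < j := by exact_mod_cast hj.1
    have hb := mulCoeff_nonneg hθ0.le hf0 (n - j)
    by_cases hneg : a n j < 0
    · rw [if_pos hneg, if_pos hneg]
      split_ifs with hjm
      · have h4 : mass θ (n - j) / mass θ n ≤ 1 := by
          rw [div_le_one hmn]
          exact mass_mono hθ (Nat.sub_le _ _)
        have h5 : θ / j * (mass θ (n - j) / mass θ n) ≤ 2 * θ * (n : ℝ)⁻¹ := by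
          refine (mul_le_of_le_one_right (by positivity) h4).trans ?_
          rw [← div_eq_mul_inv, div_le_div_iff₀ hj0 hn0]
          have : (n : ℝ) ≤ 2 * j := by exact_mod_cast (by omega : n ≤ 2 * j)
          nlinarith
        have : 0 ≤ c⁻¹ * (θ / j * mulCoeff θ f (n - j) / mass θ n) := by positivity
        linarith
      · have h4 := hm₀ (n - j) (by omega) f hf0 hf1 (by
          refine le_trans (Finset.sum_le_sum_of_subset_of_nonneg
            (Finset.Icc_subset_Icc le_rfl (Nat.sub_le _ _)) fun i _ _ => ?_) h1
          exact div_nonneg (by linarith [hf1 i]) (by positivity))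
        rw [add_zero]
        calc θ / j * (mass θ (n - j) / mass θ n)
            = c⁻¹ * (θ / j * (c * mass θ (n - j)) / mass θ n) := by field_simp
          _ ≤ _ := by gcongr
    · rw [if_neg hneg, if_neg hneg, mul_zero, zero_div, mul_zero, zero_add]
      split_ifs <;> positivity
  refine (Finset.sum_le_sum hterm).trans ?_
  rw [Finset.sum_add_distrib, ← Finset.mul_sum, ← Finset.sum_div]
  refine add_le_add ?_ ?_
  · rw [ewensProb, ewensMean]
    gcongr
  · rw [← Finset.sum_filter, Finset.sum_const, nsmul_eq_mul, mul_assoc (m₀ : ℝ)]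
    gcongr
    refine (Finset.card_le_card (t := Finset.Ioc (n - m₀) n) fun j hj => ?_).trans ?_
    · simp only [Finset.mem_filter, Finset.mem_Icc, Finset.mem_Ioc] at hj ⊢
      omega
    · rw [Nat.card_Ioc]
      omega

lemma exists_rpow_le_mass_ratio (hθ : 1 ≤ θ) : ∃ D : ℝ, 0 < D ∧ ∀ n k : ℕ, 1 ≤ n → k ≤ n →
    ((k : ℝ) / n) ^ (θ - 1) ≤ D * (mass θ k / mass θ n) := by
  have hθ0 : 0 < θ := by linarith
  obtain ⟨c₁, C₁, hc₁, hC₁, hb⟩ := exists_mass_bounds hθ0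
  refine ⟨C₁ * 2 ^ |θ - 1| / c₁, by positivity, fun n k hn _ => ?_⟩
  have hn0 : (0 : ℝ) < n := by exact_mod_cast hn
  have hmn := mass_pos hθ0 n
  have h1 : mass θ n ≤ C₁ * 2 ^ |θ - 1| * (n : ℝ) ^ (θ - 1) := by
    refine (hb n).2.trans ?_
    rw [mul_assoc]
    gcongr
    exact add_one_rpow_le hn _
  have h2 : c₁ * (k : ℝ) ^ (θ - 1) ≤ mass θ k := by
    refine le_trans ?_ (hb k).1
    gcongr
    linarith
  have hmk := mass_pos hθ0 k
  rw [Real.div_rpow (by positivity) hn0.le, div_mul_div_comm, div_le_div_iff₀ (by positivity)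
    (by positivity)]
  have h3 : 0 ≤ (k : ℝ) ^ (θ - 1) := by positivity
  have h4 : 0 < (n : ℝ) ^ (θ - 1) := by positivity
  calc (k : ℝ) ^ (θ - 1) * (c₁ * mass θ n) = (c₁ * (k : ℝ) ^ (θ - 1)) * mass θ n := by ring
    _ ≤ mass θ k * (C₁ * 2 ^ |θ - 1| * (n : ℝ) ^ (θ - 1)) := by gcongr
    _ = _ := by ring

/-- The logarithmic weight of the cycle lengths with a negative coefficient tends to zero. -/
theorem tendsto_weight_neg (hθ : 1 ≤ θ) (ha : TightNonneg θ a)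
    (hneg : Tendsto (fun n => ewensProb θ n {s | additiveSum (a n) s < 0}) atTop (𝓝 0)) :
    Tendsto (fun n : ℕ => ∑ j ∈ Finset.Ico 1 n with a n j ≤ -1,
        1 / (j : ℝ) * (1 - (j : ℝ) / (n : ℝ)) ^ (θ - 1)) atTop (𝓝 0) := by
  have hθ0 : 0 < θ := by linarith
  obtain ⟨D, hD, hDb⟩ := exists_rpow_le_mass_ratio hθ
  have h1 := (tendsto_count_neg hθ ha hneg).const_mul (D / θ)
  rw [mul_zero] at h1
  refine squeeze_zero (fun n => Finset.sum_nonneg fun j hj => ?_) (fun n => ?_) h1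
  · simp only [Finset.mem_filter, Finset.mem_Ico] at hj
    have h2 : (j : ℝ) / n ≤ 1 := div_le_one_of_le₀ (by exact_mod_cast hj.1.2.le) (by positivity)
    have : (0 : ℝ) ≤ 1 - j / n := by linarith
    positivity
  · rw [ewensMean_count, Finset.mul_sum, Finset.sum_filter]
    have hpos : ∀ j, 0 ≤ D / θ * (θ / j * if a n j < 0 then mass θ (n - j) / mass θ n else 0) := by
      intro j
      have := mass_pos hθ0 n
      have := mass_pos hθ0 (n - j)
      split_ifs <;> positivity
    refine le_trans (Finset.sum_le_sum fun j hj => ?_)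
      (Finset.sum_le_sum_of_subset_of_nonneg (s := Finset.Ico 1 n) ?_ fun j _ _ => hpos j)
    · rw [Finset.mem_Ico] at hj
      have hj0 : (0 : ℝ) < j := by exact_mod_cast hj.1
      have hn0 : (0 : ℝ) < n := by exact_mod_cast (by omega : 0 < n)
      split_ifs with h2 h3
      · have h4 := hDb n (n - j) (by omega) (Nat.sub_le _ _)
        rw [Nat.cast_sub hj.2.le, sub_div, div_self hn0.ne'] at h4
        calc _ ≤ 1 / (j : ℝ) * (D * (mass θ (n - j) / mass θ n)) := by gcongr
          _ = _ := by field_simp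
      · omega
      · omega
      · simp
    · intro j hj
      simp only [Finset.mem_Ico, Finset.mem_Icc] at hj ⊢
      omega

/-! ### Factorial moments, and `upsilon` as a solution of the same recursion. -/

section Moments

lemma add_descFactorial (x y n : ℕ) : (x + y).descFactorial n =
    ∑ k ∈ Finset.range (n + 1), n.choose k * x.descFactorial k * y.descFactorial (n - k) := by
  rw [Nat.descFactorial_eq_factorial_mul_choose, Nat.add_choose_eq,
    Finset.Nat.sum_antidiagonal_eq_sum_range_succ (fun i j => x.choose i * y.choose j),
    Finset.mul_sum]
  refine Finset.sum_congr rfl fun k hk => ?_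
  have hk : k ≤ n := by simpa [Nat.lt_succ_iff] using hk
  rw [Nat.descFactorial_eq_factorial_mul_choose, Nat.descFactorial_eq_factorial_mul_choose,
    ← Nat.choose_mul_factorial_mul_factorial hk]
  ring

/-- With `S` the sum, the falling factorial of order `l + 1` is `∑_j b_j` times that of `S - 1` of
order `l`. Split `S - 1` as `b_j - 1` plus the rest, apply Vandermonde, and absorb `b_j` into the
falling factorial of `b_j - 1`. -/
lemma descFactorial_sum_map (b : ℕ → ℕ) (l : ℕ) (s : Multiset ℕ) :
    (s.map b).sum.descFactorial (l + 1) = (s.map fun j => ∑ r ∈ Finset.range (l + 1),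
      l.choose r * (b j).descFactorial (r + 1) *
        ((s.erase j).map b).sum.descFactorial (l - r)).sum := by
  have h : ∀ j ∈ s, ∑ r ∈ Finset.range (l + 1), l.choose r * (b j).descFactorial (r + 1) *
      ((s.erase j).map b).sum.descFactorial (l - r) =
      b j * ((s.map b).sum - 1).descFactorial l := by
    intro j hj
    have hsum : (s.map b).sum = b j + ((s.erase j).map b).sum := by
      rw [← Multiset.sum_cons, ← Multiset.map_cons, Multiset.cons_erase hj]
    rcases Nat.eq_zero_or_pos (b j) with h0 | h0
    · simp [h0]
    · obtain ⟨c, hc⟩ : ∃ c, b j = c + 1 := ⟨b j - 1, by omega⟩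
      rw [hsum, hc, show c + 1 + ((s.erase j).map b).sum - 1 = c + ((s.erase j).map b).sum by omega,
        add_descFactorial, Finset.mul_sum]
      refine Finset.sum_congr rfl fun r _ => ?_
      rw [Nat.succ_descFactorial_succ]
      ring
  rw [Multiset.map_congr rfl h, Multiset.sum_map_mul_right]
  rcases Nat.eq_zero_or_pos (s.map b).sum with h0 | h0
  · simp [h0]
  · obtain ⟨c, hc⟩ : ∃ c, (s.map b).sum = c + 1 := ⟨(s.map b).sum - 1, by omega⟩
    rw [show (s.map fun j => b j).sum = (s.map b).sum from rfl, hc, Nat.succ_descFactorial_succ,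
      Nat.add_sub_cancel]

/-- The recursion satisfied by the factorial moments of an additive function with coefficients
`b`, as a functional of the weight `w` of the permutations without marked cycles. -/
noncomputable def facRec (θ : ℝ) (b : ℕ → ℕ) (w : ℕ → ℝ) : ℕ → ℕ → ℝ
  | 0, n => w n
  | l + 1, n => ∑ r : Fin (l + 1), (l.choose r : ℝ) * ∑ j ∈ Finset.Icc 1 n,
      θ / j * (b j).descFactorial (r + 1) * facRec θ b w (l - r) (n - j)
termination_by l => l

variable {θ : ℝ} {b : ℕ → ℕ} {w : ℕ → ℝ}

lemma facRec_zero (n : ℕ) : facRec θ b w 0 n = w n := by rw [facRec]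

lemma facRec_succ (l n : ℕ) : facRec θ b w (l + 1) n =
    ∑ r ∈ Finset.range (l + 1), (l.choose r : ℝ) * ∑ j ∈ Finset.Icc 1 n,
      θ / j * (b j).descFactorial (r + 1) * facRec θ b w (l - r) (n - j) := by
  rw [facRec, Finset.sum_range]

/-- The factorial moments of an additive function with coefficients `b`. -/
lemma ewensSum_descFactorial (l n : ℕ) :
    ewensSum θ n (fun s => ((s.map b).sum.descFactorial l : ℝ)) = facRec θ b (mass θ) l n := by
  induction l using Nat.strong_induction_on generalizing n with
  | _ l ih =>
  cases l with
  | zero => rw [facRec_zero, mass]; simp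
  | succ l =>
    have h := ewensSum_sum_erase θ n fun j s => ∑ r ∈ Finset.range (l + 1),
      ((l.choose r : ℝ) * (b j).descFactorial (r + 1)) * ((s.map b).sum.descFactorial (l - r) : ℝ)
    rw [facRec_succ]
    simp_rw [Finset.mul_sum]
    rw [Finset.sum_comm]
    convert h using 1
    · refine ewensSum_congr fun s _ _ => ?_
      rw [descFactorial_sum_map, Nat.cast_multiset_sum, Multiset.map_map]
      simp only [Function.comp_def]
      push_cast
      rfl
    · refine Finset.sum_congr rfl fun j _ => ?_
      rw [ewensSum_sum, Finset.smul_sum]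
      refine Finset.sum_congr rfl fun r hr => ?_
      rw [ewensSum_const_mul, ih (l - r) (by omega), smul_eq_mul]
      ring

lemma sum_piFinset_succ {M : Type*} [AddCommMonoid M] {u : ℕ} (s : Finset ℕ)
    (g : (Fin (u + 1) → ℕ) → M) :
    ∑ r ∈ Fintype.piFinset (fun _ : Fin (u + 1) => s), g r =
      ∑ x ∈ s, ∑ r ∈ Fintype.piFinset (fun _ : Fin u => s), g (Fin.cons x r) := by
  rw [← Finset.sum_product']
  refine Finset.sum_bij' (fun r _ => (r 0, Fin.tail r)) (fun p _ => Fin.cons p.1 p.2) ?_ ?_ ?_ ?_ ?_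
  · intro r hr
    rw [Fintype.mem_piFinset] at hr
    rw [Finset.mem_product, Fintype.mem_piFinset]
    exact ⟨hr 0, fun i => hr i.succ⟩
  · intro p hp
    rw [Finset.mem_product, Fintype.mem_piFinset] at hp
    rw [Fintype.mem_piFinset]
    intro i
    refine Fin.cases ?_ (fun i => ?_) i
    · exact hp.1
    · exact hp.2 i
  · intro r _
    exact Fin.cons_self_tail r
  · intro p _
    simp
  · intro r _
    simp only [Fin.cons_self_tail]

lemma sum_Iio_succ {u : ℕ} (x : ℕ) (r : Fin u → ℕ) (i : Fin u) :
    ∑ k ∈ Finset.Iio i.succ, (Fin.cons x r : Fin (u + 1) → ℕ) k = x + ∑ k ∈ Finset.Iio i, r k := by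
  have h1 : Finset.Iio i.succ = Finset.univ.filter fun k : Fin (u + 1) => k < i.succ := by
    ext k; simp
  have h2 : Finset.Iio i = Finset.univ.filter fun k : Fin u => k < i := by
    ext k; simp
  rw [h1, h2, Finset.sum_filter, Finset.sum_filter, Fin.sum_univ_succ]
  simp

/-- The product of binomial coefficients in the definition of `upsilon`. -/
def chooseProd {u : ℕ} (l : ℕ) (r : Fin u → ℕ) : ℝ :=
  ∏ i, ((l - (∑ k ∈ Finset.Iio i, r k) - 1).choose (r i - 1) : ℝ)

lemma chooseProd_cons {u : ℕ} (l x : ℕ) (r : Fin u → ℕ) :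
    chooseProd l (Fin.cons x r : Fin (u + 1) → ℕ) =
      ((l - 1).choose (x - 1) : ℝ) * chooseProd (l - x) r := by
  rw [chooseProd, Fin.prod_univ_succ]
  congr 1
  rw [chooseProd]
  refine Finset.prod_congr rfl fun i _ => ?_
  rw [sum_Iio_succ, Fin.cons_succ, ← Nat.sub_sub l x]

/-- The sum over `r_1 + ⋯ + r_u = l` and `j_1 + ⋯ + j_u ≤ k` occurring in `upsilon`, with a general
weight. -/
noncomputable def tupleSum (b : ℕ → ℕ) (w : ℕ → ℝ) (m N u l k : ℕ) : ℝ :=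
  ∑ r ∈ Fintype.piFinset (fun _ : Fin u => Finset.Icc 1 m),
    (if ∑ i, r i = l then chooseProd l r else 0) *
      ∑ j ∈ Fintype.piFinset (fun _ : Fin u => Finset.Icc 1 N),
        if ∑ i, j i ≤ k then
          (∏ i, ((b (j i)).descFactorial (r i) : ℝ) / (j i : ℝ)) * w (k - ∑ i, j i) else 0

lemma tupleSum_zero (m N l k : ℕ) :
    tupleSum b w m N 0 l k = if l = 0 then w k else 0 := by
  simp [tupleSum, chooseProd, eq_comm]

/-- The first entries of both tuples are split off. The constraint `r_i ≤ m` disappears because the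
falling factorial of order `x > m` of a number `b j ≤ m` is zero. -/
lemma tupleSum_succ (hb : ∀ j, b j ≤ m) {N k : ℕ} (hk : k ≤ N) (u l : ℕ) :
    tupleSum b w m N (u + 1) (l + 1) k = ∑ r ∈ Finset.range (l + 1), (l.choose r : ℝ) *
      ∑ j ∈ Finset.Icc 1 k, 1 / (j : ℝ) * (b j).descFactorial (r + 1) *
        tupleSum b w m N u (l - r) (k - j) := by
  rw [tupleSum, sum_piFinset_succ]
  have h1 : ∀ x ∈ Finset.Icc 1 m, (∑ r ∈ Fintype.piFinset (fun _ : Fin u => Finset.Icc 1 m),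
      (if ∑ i, (Fin.cons x r : Fin (u + 1) → ℕ) i = l + 1 then
        chooseProd (l + 1) (Fin.cons x r : Fin (u + 1) → ℕ) else 0) *
      ∑ j ∈ Fintype.piFinset (fun _ : Fin (u + 1) => Finset.Icc 1 N),
        if ∑ i, j i ≤ k then (∏ i, ((b (j i)).descFactorial
          ((Fin.cons x r : Fin (u + 1) → ℕ) i) : ℝ) / (j i : ℝ)) * w (k - ∑ i, j i) else 0) =
      if x ≤ l + 1 then (l.choose (x - 1) : ℝ) * ∑ j ∈ Finset.Icc 1 k,
        1 / (j : ℝ) * (b j).descFactorial x * tupleSum b w m N u (l + 1 - x) (k - j) else 0 := by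
    intro x hx
    have hinner : ∀ r : Fin u → ℕ, (∑ j ∈ Fintype.piFinset (fun _ : Fin (u + 1) => Finset.Icc 1 N),
        if ∑ i, j i ≤ k then (∏ i, ((b (j i)).descFactorial
          ((Fin.cons x r : Fin (u + 1) → ℕ) i) : ℝ) / (j i : ℝ)) * w (k - ∑ i, j i) else 0) =
        ∑ y ∈ Finset.Icc 1 k, 1 / (y : ℝ) * (b y).descFactorial x *
          ∑ j ∈ Fintype.piFinset (fun _ : Fin u => Finset.Icc 1 N), if ∑ i, j i ≤ k - y then
            (∏ i, ((b (j i)).descFactorial (r i) : ℝ) / (j i : ℝ)) * w (k - y - ∑ i, j i)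
              else 0 := by
      intro r
      rw [sum_piFinset_succ]
      refine (Finset.sum_subset (Finset.Icc_subset_Icc le_rfl hk) fun y hy hy' => ?_).symm.trans
        (Finset.sum_congr rfl fun y hy => ?_)
      · simp only [Finset.mem_Icc] at hy hy'
        refine Finset.sum_eq_zero fun j _ => ?_
        rw [Fin.sum_univ_succ, Fin.cons_zero, if_neg (by omega)]
      · rw [Finset.mem_Icc] at hy
        rw [Finset.mul_sum]
        refine Finset.sum_congr rfl fun j _ => ?_
        simp_rw [Fin.sum_univ_succ, Fin.prod_univ_succ, Fin.cons_zero, Fin.cons_succ,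
          show ∀ c : ℕ, y + c ≤ k ↔ c ≤ k - y by omega, Nat.sub_sub]
        split_ifs
        · ring
        · rw [mul_zero]
    simp_rw [hinner, chooseProd_cons, Fin.sum_univ_succ, Fin.cons_zero, Fin.cons_succ,
      Nat.add_sub_cancel]
    split_ifs with hxl
    · simp_rw [show ∀ c : ℕ, x + c = l + 1 ↔ c = l + 1 - x by omega, tupleSum, Finset.mul_sum]
      rw [Finset.sum_comm]
      refine Finset.sum_congr rfl fun y _ => Finset.sum_congr rfl fun r _ =>
        Finset.sum_congr rfl fun j _ => ?_
      split_ifs <;> ring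
    · refine Finset.sum_eq_zero fun r _ => ?_
      rw [if_neg (by omega), zero_mul]
  rw [Finset.sum_congr rfl h1, ← Finset.sum_filter]
  have h2 : ∑ r ∈ Finset.range (l + 1), (l.choose r : ℝ) *
      ∑ j ∈ Finset.Icc 1 k, 1 / (j : ℝ) * (b j).descFactorial (r + 1) *
        tupleSum b w m N u (l - r) (k - j) = ∑ x ∈ Finset.Icc 1 (l + 1), (l.choose (x - 1) : ℝ) *
      ∑ j ∈ Finset.Icc 1 k, 1 / (j : ℝ) * (b j).descFactorial x *
        tupleSum b w m N u (l + 1 - x) (k - j) := by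
    refine Finset.sum_bij' (fun r _ => r + 1) (fun x _ => x - 1) ?_ ?_ ?_ ?_ ?_
    · intro r hr; simp at hr ⊢; omega
    · intro r hr; simp at hr ⊢; omega
    · intro r hr; simp
    · intro r hr; simp at hr ⊢; omega
    · intro r _
      simp only [Nat.add_sub_cancel, Nat.add_sub_add_right]
  rw [h2]
  refine Finset.sum_subset ?_ ?_
  · intro x hx; simp at hx ⊢; omega
  · intro x hx hx'
    simp only [Finset.mem_Icc, Finset.mem_filter] at hx hx'
    refine mul_eq_zero_of_right _ (Finset.sum_eq_zero fun j _ => ?_)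
    have := hb j
    rw [Nat.descFactorial_of_lt (by omega : b j < x)]
    simp

/-- Unrolling the recursion: `u` is the number of marked cycles. Tuples with `u > l` do not exist,
so the bound `U` may exceed `l`; the induction needs this freedom since the orders `l - r` vary. -/
lemma facRec_eq_sum_tupleSum (hb : ∀ j, b j ≤ m) {N : ℕ} (l U k : ℕ) (hU : l ≤ U) (hk : k ≤ N) :
    facRec θ b w l k = ∑ u ∈ Finset.range (U + 1), θ ^ u * tupleSum b w m N u l k := by
  induction U generalizing l k with
  | zero =>
    obtain rfl : l = 0 := by omega
    simp [facRec_zero, tupleSum_zero]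
  | succ U ih =>
    cases l with
    | zero =>
      rw [facRec_zero, Finset.sum_eq_single_of_mem 0 (by simp)]
      · simp [tupleSum_zero]
      · intro u _ hu
        obtain ⟨u, rfl⟩ := Nat.exists_eq_succ_of_ne_zero hu
        rw [tupleSum, Finset.sum_eq_zero, mul_zero]
        intro r hr
        have h0 := (Finset.mem_Icc.1 (Fintype.mem_piFinset.1 hr 0)).1
        have h1 := Finset.single_le_sum (f := r) (fun _ _ => Nat.zero_le _) (Finset.mem_univ 0)
        rw [if_neg (by omega), zero_mul]
    | succ l =>
      rw [Finset.sum_range_succ', tupleSum_zero, if_neg (by omega), mul_zero, add_zero, facRec_succ]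
      simp_rw [tupleSum_succ hb hk, Finset.mul_sum]
      symm
      rw [Finset.sum_comm]
      refine Finset.sum_congr rfl fun r _ => ?_
      rw [Finset.sum_comm]
      refine Finset.sum_congr rfl fun j _ => ?_
      rw [ih (l - r) (k - j) (by omega) (by omega), Finset.mul_sum, Finset.mul_sum]
      refine Finset.sum_congr rfl fun u _ => ?_
      ring

/-- The weight is set to zero at `k = 0` because the sum requires `j_1 + ⋯ + j_u < n`. For `θ = 1`
this matters, as `0 ^ 0 = 1`. -/
lemma upsilon_eq_facRec (a : ℕ → ℤ) (n l m : ℕ) (hl : 1 ≤ l) :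
    upsilon θ a n l m = facRec θ (fun j => trunc m (a j))
      (fun k => if k = 0 then 0 else ((k : ℝ) / n) ^ (θ - 1)) l n := by
  rw [facRec_eq_sum_tupleSum (m := m) (N := n) (b := fun j => trunc m (a j))
      (fun j => min_le_right _ _) l l n le_rfl le_rfl,
    Finset.sum_range_succ', tupleSum_zero, if_neg (by omega), mul_zero, add_zero, upsilon]
  symm
  refine Finset.sum_bij' (fun u _ => u + 1) (fun u _ => u - 1) ?_ ?_ ?_ ?_ ?_
  · intro u hu; simp at hu ⊢; omega
  · intro u hu; simp at hu ⊢; omega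
  · intro u hu; simp
  · intro u hu; simp at hu ⊢; omega
  intro u _
  congr 1
  rw [tupleSum, Finset.sum_filter]
  refine Finset.sum_congr rfl fun r _ => ?_
  rw [ite_zero_mul]
  congr 1
  congr 1
  rw [Finset.sum_filter]
  refine Finset.sum_congr rfl fun j hj => ?_
  rcases lt_trichotomy (∑ i, j i) n with h | h | h
  · rw [if_pos h.le, if_pos h, if_neg (by omega), Nat.cast_sub h.le, sub_div, div_self]
    · push_cast; rfl
    · exact_mod_cast (by omega : n ≠ 0)
  · rw [if_pos h.le, if_pos (by omega), mul_zero, if_neg (by omega)]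
  · rw [if_neg (by omega), if_neg (by omega)]

end Moments

/-! ### Stability of the recursion under a change of weight. -/

section FacRecBounds

variable {θ : ℝ}

lemma facRec_add_mul (b : ℕ → ℕ) (w w' : ℕ → ℝ) (c : ℝ) (l n : ℕ) :
    facRec θ b (fun k => w k + c * w' k) l n = facRec θ b w l n + c * facRec θ b w' l n := by
  induction l using Nat.strong_induction_on generalizing n with
  | _ l ih =>
  cases l with
  | zero => simp [facRec_zero]
  | succ l =>
    simp_rw [facRec_succ]
    rw [Finset.mul_sum, ← Finset.sum_add_distrib]
    refine Finset.sum_congr rfl fun r _ => ?_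
    simp_rw [ih (l - r) (by omega)]
    rw [mul_left_comm, ← mul_add]
    congr 1
    rw [Finset.mul_sum, ← Finset.sum_add_distrib]
    exact Finset.sum_congr rfl fun j _ => by ring

lemma descFactorial_succ_le_pow {b m r l : ℕ} (hb : b ≤ m) (hr : r ≤ l) :
    (b.descFactorial (r + 1) : ℝ) ≤ ((m : ℝ) + 1) ^ (l + 1) := by
  calc (b.descFactorial (r + 1) : ℝ) ≤ ((b ^ (r + 1) : ℕ) : ℝ) := by
        exact_mod_cast Nat.descFactorial_le_pow b (r + 1)
    _ ≤ ((m : ℝ) + 1) ^ (r + 1) := by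
        push_cast
        have : (b : ℝ) ≤ m := by exact_mod_cast hb
        gcongr
        linarith
    _ ≤ _ := pow_le_pow_right₀ (by linarith [(Nat.cast_nonneg m : (0 : ℝ) ≤ m)]) (by omega)

/-- If the weights are bounded by `φ` and one summation costs at most a factor `Λ`, then the
recursion of order `l` is bounded by a multiple of `Λ ^ l φ`. -/
lemma exists_abs_facRec_le (hθ : 0 ≤ θ) (m l : ℕ) : ∃ D : ℝ, 0 ≤ D ∧ ∀ (n : ℕ) (b : ℕ → ℕ)
    (w φ : ℕ → ℝ) (Λ : ℝ), (∀ j, b j ≤ m) → 1 ≤ Λ → (∀ k, 0 ≤ φ k) → (∀ k ≤ n, |w k| ≤ φ k) →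
    (∀ k ≤ n, ∑ j ∈ Finset.Icc 1 k, (if b j = 0 then (0 : ℝ) else 1) / j * φ (k - j) ≤ Λ * φ k) →
    ∀ k ≤ n, ∀ l' ≤ l, |facRec θ b w l' k| ≤ D * (Λ ^ l' * φ k) := by
  induction l with
  | zero =>
    refine ⟨1, zero_le_one, fun n b w φ Λ _ _ _ hw _ k hk l' hl => ?_⟩
    obtain rfl : l' = 0 := by omega
    rw [facRec_zero, pow_zero, one_mul, one_mul]
    exact hw k hk
  | succ l ih =>
    obtain ⟨D, hD, h⟩ := ih
    refine ⟨D + 2 ^ l * (θ * ((m : ℝ) + 1) ^ (l + 1) * D), by positivity,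
      fun n b w φ Λ hb hΛ hφ hw hsum k hk l' hl => ?_⟩
    have hφk := hφ k
    rcases Nat.lt_or_ge l l' with hl' | hl'
    · obtain rfl : l' = l + 1 := by omega
      have hterm : ∀ r ∈ Finset.range (l + 1), |(l.choose r : ℝ) * ∑ j ∈ Finset.Icc 1 k,
          θ / j * (b j).descFactorial (r + 1) * facRec θ b w (l - r) (k - j)| ≤
          l.choose r * (θ * ((m : ℝ) + 1) ^ (l + 1) * D * (Λ ^ (l + 1) * φ k)) := by
        intro r hr
        have hr := Finset.mem_range.1 hr
        rw [abs_mul, Nat.abs_cast]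
        gcongr
        refine (Finset.abs_sum_le_sum_abs _ _).trans ?_
        have hj : ∀ j ∈ Finset.Icc 1 k,
            |θ / j * (b j).descFactorial (r + 1) * facRec θ b w (l - r) (k - j)| ≤
            θ * ((m : ℝ) + 1) ^ (l + 1) * D * Λ ^ l *
              ((if b j = 0 then (0 : ℝ) else 1) / j * φ (k - j)) := by
          intro j hj
          have hj := Finset.mem_Icc.1 hj
          split_ifs with hb0
          · simp [hb0]
          · rw [abs_mul, abs_mul, Nat.abs_cast, abs_of_nonneg (by positivity : 0 ≤ θ / (j : ℝ))]
            have h1 := h n b w φ Λ hb hΛ hφ hw hsum (k - j) (by omega) (l - r) (by omega)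
            have h2 := descFactorial_succ_le_pow (hb j) (by omega : r ≤ l)
            have h3 : Λ ^ (l - r) ≤ Λ ^ l := pow_le_pow_right₀ hΛ (by omega)
            have h4 := hφ (k - j)
            calc θ / j * ((b j).descFactorial (r + 1)) * |facRec θ b w (l - r) (k - j)|
                ≤ θ / j * ((m : ℝ) + 1) ^ (l + 1) * (D * (Λ ^ l * φ (k - j))) := by
                  gcongr
                  exact h1.trans (by gcongr)
              _ = _ := by ring
        refine (Finset.sum_le_sum hj).trans ?_
        rw [← Finset.mul_sum]
        calc _ ≤ θ * ((m : ℝ) + 1) ^ (l + 1) * D * Λ ^ l * (Λ * φ k) := by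
              gcongr
              exact hsum k hk
          _ = _ := by ring
      rw [facRec_succ]
      refine (Finset.abs_sum_le_sum_abs _ _).trans ((Finset.sum_le_sum hterm).trans ?_)
      rw [← Finset.sum_mul, ← Nat.cast_sum, Nat.sum_range_choose, add_mul]
      push_cast
      have : 0 ≤ D * (Λ ^ (l + 1) * φ k) := by positivity
      linarith
    · refine (h n b w φ Λ hb hΛ hφ hw hsum k hk l' hl').trans ?_
      gcongr
      exact le_add_of_nonneg_right (by positivity)

/-- Uniform bound of the recursion for a bounded weight and coefficients with bounded
logarithmic support. -/
lemma exists_abs_facRec_le_const (hθ : 0 ≤ θ) (m l : ℕ) {C : ℝ} (hC : 1 ≤ C) : ∃ D : ℝ, 0 ≤ D ∧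
    ∀ (n : ℕ) (b : ℕ → ℕ) (w : ℕ → ℝ) (W : ℝ), (∀ j, b j ≤ m) → 0 ≤ W → (∀ k ≤ n, |w k| ≤ W) →
    (∑ j ∈ Finset.Icc 1 n, (if b j = 0 then (0 : ℝ) else 1) / j ≤ C) →
    |facRec θ b w l n| ≤ D * W := by
  obtain ⟨D, hD, h⟩ := exists_abs_facRec_le hθ m l
  refine ⟨D * C ^ l, by positivity, fun n b w W hb hW hw hsum => ?_⟩
  refine (h n b w (fun _ => W) C hb hC (fun _ => hW) hw (fun k hk => ?_) n le_rfl l le_rfl).trans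
    (le_of_eq (by ring))
  rw [← Finset.sum_mul]
  gcongr
  refine le_trans (Finset.sum_le_sum_of_subset_of_nonneg (Finset.Icc_subset_Icc le_rfl hk)
    fun j _ _ => ?_) hsum
  split_ifs <;> positivity

/-- Partial fractions: `1 / (j (k - j)) = (1 / k) (1 / j + 1 / (k - j))`. The term `j = k`, where
the maximum is `1`, contributes one more `1 / k`. -/
lemma sum_inv_mul_inv_le {n k : ℕ} (hk : k ≤ n) :
    ∑ j ∈ Finset.Icc 1 k, 1 / (j : ℝ) * (1 / max ((k - j : ℕ) : ℝ) 1) ≤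
      3 * (1 + Real.log n) * (1 / max (k : ℝ) 1) := by
  rcases Nat.eq_zero_or_pos k with rfl | hk0
  · have : 0 ≤ Real.log n := Real.log_natCast_nonneg n
    simp
    positivity
  have hn0 : (1 : ℝ) ≤ n := by exact_mod_cast (by omega : 1 ≤ n)
  have hk1 : (1 : ℝ) ≤ k := by exact_mod_cast hk0
  have hH : ∑ j ∈ Finset.Icc 1 k, 1 / (j : ℝ) ≤ 1 + Real.log n := by
    refine sum_inv_le_one_add_log.trans ?_
    gcongr
  rw [max_eq_left hk1]
  have hterm : ∀ j ∈ Finset.Icc 1 k, 1 / (j : ℝ) * (1 / max ((k - j : ℕ) : ℝ) 1) ≤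
      1 / k * (1 / (j : ℝ) + if j < k then 1 / ((k - j : ℕ) : ℝ) else 0) +
        if j = k then 1 / (k : ℝ) else 0 := by
    intro j hj
    rw [Finset.mem_Icc] at hj
    have hj0 : (0 : ℝ) < j := by exact_mod_cast hj.1
    rcases eq_or_lt_of_le hj.2 with rfl | hlt
    · simp
      positivity
    · rw [if_pos hlt, if_neg hlt.ne, add_zero]
      have h1 : (1 : ℝ) ≤ ((k - j : ℕ) : ℝ) := by exact_mod_cast (by omega : 1 ≤ k - j)
      have h2 : (k : ℝ) = j + ((k - j : ℕ) : ℝ) := by rw [Nat.cast_sub hj.2]; ring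
      rw [max_eq_left h1, h2]
      apply le_of_eq
      have h3 : (0 : ℝ) < ((k - j : ℕ) : ℝ) := by linarith
      generalize ((k - j : ℕ) : ℝ) = y at h3
      field_simp
      ring
  refine (Finset.sum_le_sum hterm).trans ?_
  rw [Finset.sum_add_distrib, ← Finset.mul_sum, Finset.sum_add_distrib, Finset.sum_ite_eq' _ k,
    if_pos (Finset.mem_Icc.2 ⟨hk0, le_rfl⟩)]
  have hrefl : ∑ j ∈ Finset.Icc 1 k, (if j < k then 1 / ((k - j : ℕ) : ℝ) else 0) ≤
      ∑ j ∈ Finset.Icc 1 k, 1 / (j : ℝ) := by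
    have himage : ∑ j ∈ (Finset.Icc 1 k).filter (· < k), 1 / ((k - j : ℕ) : ℝ) =
        ∑ i ∈ ((Finset.Icc 1 k).filter (· < k)).image (fun j => k - j), 1 / (i : ℝ) := by
      refine (Finset.sum_image (f := fun i : ℕ => 1 / (i : ℝ)) (g := fun j : ℕ => k - j)
        fun x hx y hy hxy => ?_).symm
      have hx := Finset.mem_filter.1 hx
      have hy := Finset.mem_filter.1 hy
      simp only at hxy
      omega
    rw [← Finset.sum_filter, himage]
    refine Finset.sum_le_sum_of_subset_of_nonneg (fun i hi => ?_) fun _ _ _ => by positivity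
    simp only [Finset.mem_image, Finset.mem_filter, Finset.mem_Icc] at hi ⊢
    omega
  have hl : 0 ≤ Real.log n := Real.log_natCast_nonneg n
  have hk2 : 0 < 1 / (k : ℝ) := by positivity
  nlinarith

/-- The contribution of the permutations all of whose cycles are marked. -/
lemma exists_facRec_delta_le (hθ : 0 ≤ θ) (m l : ℕ) : ∃ D : ℝ, 0 ≤ D ∧ ∀ (n : ℕ) (b : ℕ → ℕ),
    1 ≤ n → (∀ j, b j ≤ m) →
    |facRec θ b (fun k => if k = 0 then 1 else 0) l n| ≤ D * ((1 + Real.log n) ^ l / n) := by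
  obtain ⟨D, hD, h⟩ := exists_abs_facRec_le hθ m l
  refine ⟨D * 3 ^ l, by positivity, fun n b hn hb => ?_⟩
  have hl : 0 ≤ Real.log n := Real.log_natCast_nonneg n
  -- The point mass at `0` is dominated by `1 / max k 1`, which each summation over a marked cycle
  -- reproduces up to a logarithm.
  refine (h n b _ (fun k => 1 / max (k : ℝ) 1) (3 * (1 + Real.log n)) hb (by linarith)
    (fun k => by positivity) (fun k _ => ?_) (fun k hk => ?_) n le_rfl l le_rfl).trans
    (le_of_eq ?_)
  · split_ifs with h0
    · simp [h0]
    · simp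
  · refine le_trans (Finset.sum_le_sum fun j _ => ?_) (sum_inv_mul_inv_le hk)
    gcongr
    split_ifs <;> simp
  · have : (1 : ℝ) ≤ n := by exact_mod_cast hn
    rw [max_eq_left this, mul_pow]
    ring

lemma mass_one (n : ℕ) : mass 1 n = 1 := by
  induction n with
  | zero => exact mass_zero 1
  | succ n ih =>
    have h := mass_succ 1 n
    rw [ih] at h
    have hn : (n : ℝ) + 1 ≠ 0 := by positivity
    have h' : ((n : ℝ) + 1) * mass 1 (n + 1) = (n + 1) * 1 := by linarith
    exact mul_left_cancel₀ hn h'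

/-- Uniform comparison of the ratios of the masses with powers. -/
lemma eventually_abs_rpow_sub_mass_ratio_le (hθ : 1 ≤ θ) {ε : ℝ} (hε : 0 < ε) :
    ∀ᶠ n : ℕ in atTop, ∀ k : ℕ, 1 ≤ k → k ≤ n →
      |((k : ℝ) / n) ^ (θ - 1) - mass θ k / mass θ n| ≤ ε := by
  -- For `θ = 1` both ratios are identically `1`; the argument for small `k` below needs `θ - 1 >
  -- 0`.
  rcases eq_or_lt_of_le hθ with rfl | hθ1
  · refine Eventually.of_forall fun n k _ _ => ?_
    simp [mass_one, hε.le]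
  have hθ0 : 0 < θ := by linarith
  set G := (Real.Gamma θ)⁻¹ with hG
  have hG0 : 0 < G := inv_pos.2 (Real.Gamma_pos_of_pos hθ0)
  have hlim := tendsto_mass_div_rpow hθ0
  -- The first bound keeps the normalized mass at `n` above `G / 2`; the second makes the normalized
  -- masses at `k` and `n` differ by at most `ε G / 2`.
  have hη : 0 < min (G / 2) (ε * G / 4) := by positivity
  obtain ⟨k₀, hk₀⟩ := Metric.tendsto_atTop.1 hlim _ hη
  obtain ⟨c₁, C₁, hc₁, hC₁, hb⟩ := exists_mass_bounds hθ0
  have hsmall : Tendsto (fun n : ℕ => ((k₀ : ℝ) / n) ^ (θ - 1)) atTop (𝓝 0) := by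
    have h1 : Tendsto (fun n : ℕ => (k₀ : ℝ) / n) atTop (𝓝 0) :=
      tendsto_const_div_atTop_nhds_zero_nat _
    have h2 := h1.rpow_const (p := θ - 1) (Or.inr (by linarith))
    rwa [Real.zero_rpow (by linarith)] at h2
  have hsmall2 : Tendsto (fun n : ℕ => mass θ k₀ / mass θ n) atTop (𝓝 0) := by
    have h1 : Tendsto (mass θ) atTop atTop := by
      have h2 : Tendsto (fun n : ℕ => c₁ * ((n : ℝ) + 1) ^ (θ - 1)) atTop atTop := by
        refine Tendsto.const_mul_atTop hc₁ ?_
        exact (tendsto_rpow_atTop (by linarith)).comp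
          (tendsto_atTop_add_const_right _ _ tendsto_natCast_atTop_atTop)
      exact tendsto_atTop_mono (fun n => (hb n).1) h2
    exact tendsto_const_nhds.div_atTop h1
  filter_upwards [hsmall.eventually_le_const hε, hsmall2.eventually_le_const hε,
    eventually_ge_atTop k₀, eventually_ge_atTop 1] with n h1 h2 h3 h4 k hk1 hkn
  have hn0 : (0 : ℝ) < n := by exact_mod_cast h4
  have hk0 : (0 : ℝ) < k := by exact_mod_cast hk1
  have hmn := mass_pos hθ0 n
  have hmk := mass_pos hθ0 k
  rcases Nat.lt_or_ge k k₀ with hk | hk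
  · have h5 : ((k : ℝ) / n) ^ (θ - 1) ≤ ε := by
      refine le_trans (Real.rpow_le_rpow (by positivity) ?_ (by linarith)) h1
      gcongr
    have h6 : mass θ k / mass θ n ≤ ε := by
      refine le_trans ?_ h2
      gcongr
      exact mass_mono hθ hk.le
    have h7 : 0 ≤ ((k : ℝ) / n) ^ (θ - 1) := by positivity
    have h8 : 0 ≤ mass θ k / mass θ n := by positivity
    rw [abs_le]
    constructor <;> linarith
  · have h5 := hk₀ n h3
    have h6 := hk₀ k hk
    rw [Real.dist_eq, abs_lt] at h5 h6
    have hkp : 0 < (k : ℝ) ^ (θ - 1) := by positivity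
    have hnp : 0 < (n : ℝ) ^ (θ - 1) := by positivity
    set x := mass θ k / (k : ℝ) ^ (θ - 1) with hx
    set y := mass θ n / (n : ℝ) ^ (θ - 1) with hy
    have hmx : mass θ k = x * (k : ℝ) ^ (θ - 1) := by rw [hx]; field_simp
    have hmy : mass θ n = y * (n : ℝ) ^ (θ - 1) := by rw [hy]; field_simp
    have hm1 := min_le_left (G / 2) (ε * G / 4)
    have hm2 := min_le_right (G / 2) (ε * G / 4)
    have hy0 : G / 2 < y := by linarith [h5.1]
    have hy1 : 0 < y := by linarith
    have heq : ((k : ℝ) / n) ^ (θ - 1) - mass θ k / mass θ n =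
        ((k : ℝ) / n) ^ (θ - 1) * ((y - x) / y) := by
      rw [hmx, hmy, Real.div_rpow hk0.le hn0.le]
      field_simp
    have h7 : ((k : ℝ) / n) ^ (θ - 1) ≤ 1 := by
      refine Real.rpow_le_one (by positivity) ?_ (by linarith)
      rw [div_le_one hn0]
      exact_mod_cast hkn
    have h8 : |(y - x) / y| ≤ ε := by
      rw [abs_div, abs_of_pos hy1, div_le_iff₀ hy1, abs_le]
      constructor <;> nlinarith [h5.1, h5.2, h6.1, h6.2]
    rw [heq, abs_mul, abs_of_nonneg (by positivity)]
    exact (mul_le_of_le_one_left (abs_nonneg _) h7).trans h8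

lemma tendsto_one_add_log_pow_div (l : ℕ) :
    Tendsto (fun n : ℕ => (1 + Real.log n) ^ l / n) atTop (𝓝 0) := by
  have h1 : Tendsto (fun n : ℕ => Real.exp 1 * (n : ℝ)) atTop atTop :=
    tendsto_natCast_atTop_atTop.const_mul_atTop (Real.exp_pos 1)
  have h2 := ((Real.isLittleO_pow_log_id_atTop (n := l)).tendsto_div_nhds_zero.comp h1).const_mul
    (Real.exp 1)
  rw [mul_zero] at h2
  refine h2.congr' ?_
  filter_upwards [eventually_gt_atTop 0] with n hn
  have hn' : (0 : ℝ) < n := by exact_mod_cast hn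
  simp only [Function.comp, id]
  rw [Real.log_mul (Real.exp_pos 1).ne' hn'.ne', Real.log_exp]
  field_simp

end FacRecBounds

section Limit

variable {θ : ℝ} {a : ℕ → ℕ → ℤ}

lemma ewensProb_union {A B : Set (Multiset ℕ)} (h : Disjoint A B) (n : ℕ) :
    ewensProb θ n (A ∪ B) = ewensProb θ n A + ewensProb θ n B := by
  rw [ewensProb, Set.indicator_union_of_disjoint h]
  exact ewensMean_add n _ _

lemma ewensProb_compl (hθ : 0 < θ) (n : ℕ) (A : Set (Multiset ℕ)) :
    ewensProb θ n Aᶜ = 1 - ewensProb θ n A := by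
  have h := ewensProb_union (θ := θ) (disjoint_compl_right (a := A)) n
  have h1 : ewensProb θ n Set.univ = 1 := by
    rw [ewensProb, Set.indicator_univ]
    exact ewensMean_one hθ n
  rw [Set.union_compl_self, h1] at h
  linarith

/-! ### Consequences of weak convergence. -/

section Weak

lemma hasSum_integral_comp_nat {Ω : Type*} [MeasurableSpace Ω] {P : Measure Ω} {Y : Ω → ℕ}
    {f : ℕ → ℝ} (hY : Measurable Y) (hf : Integrable (fun ω => f (Y ω)) P) :
    HasSum (fun k => f k * P.real {ω | Y ω = k}) (∫ ω, f (Y ω) ∂P) := by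
  have hm : ∀ k : ℕ, MeasurableSet (Y ⁻¹' {k}) := fun k => hY (measurableSet_singleton k)
  have hu : (⋃ k : ℕ, Y ⁻¹' {k}) = Set.univ := by
    ext ω
    simp
  have h := hasSum_integral_iUnion (f := fun ω => f (Y ω)) (μ := P) hm
    (fun i j hij => (Set.disjoint_singleton.2 hij).preimage Y) hf.integrableOn
  rw [hu, setIntegral_univ] at h
  have hk : ∀ k, ∫ ω in Y ⁻¹' {k}, f (Y ω) ∂P = f k * P.real {ω | Y ω = k} := by
    intro k
    rw [setIntegral_congr_fun (hm k) (g := fun _ => f k) fun ω hω => by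
      rw [Set.mem_preimage, Set.mem_singleton_iff] at hω
      simp only [hω], setIntegral_const, smul_eq_mul, mul_comm]
    rfl
  simpa only [hk] using h

variable {Ω : Type*} [MeasurableSpace Ω] {P : Measure Ω} {Y : Ω → ℕ}

/-- All variables are integer valued, so the limit distribution function is locally constant at `z +
1 / 2`, which is therefore a continuity point. -/
lemma tendsto_ewensProb_le (hconv : WeaklyConverges (fun n => distrFun θ n (a n))
    (limitDistrFun P Y)) (z : ℤ) :
    Tendsto (fun n => ewensProb θ n {s | additiveSum (a n) s ≤ z}) atTop
      (𝓝 (P.real {ω | (Y ω : ℤ) ≤ z})) := by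
  have key : ∀ x : ℝ, (z : ℝ) < x → x < z + 1 → ∀ k : ℤ, (k : ℝ) < x ↔ k ≤ z := by
    intro x h1 h2 k
    constructor
    · intro h
      have : (k : ℝ) < ((z + 1 : ℤ) : ℝ) := by push_cast; linarith
      exact Int.lt_add_one_iff.1 (Int.cast_lt.1 this)
    · intro h
      have : (k : ℝ) ≤ z := by exact_mod_cast h
      linarith
  have hF : ∀ x : ℝ, (z : ℝ) < x → x < z + 1 →
      limitDistrFun P Y x = P.real {ω | (Y ω : ℤ) ≤ z} := by
    intro x h1 h2
    rw [limitDistrFun]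
    congr 1
    ext ω
    simpa using key x h1 h2 (Y ω)
  have hx1 : (z : ℝ) < z + 1 / 2 := by linarith
  have hx2 : (z : ℝ) + 1 / 2 < z + 1 := by linarith
  have hcont : ContinuousAt (limitDistrFun P Y) (z + 1 / 2) := by
    refine (continuousAt_const (y := P.real {ω | (Y ω : ℤ) ≤ z})).congr ?_
    filter_upwards [Ioo_mem_nhds hx1 hx2] with x hx
    exact (hF x hx.1 hx.2).symm
  have h := hconv _ hcont
  rw [hF _ hx1 hx2] at h
  refine h.congr fun n => ?_
  refine (distrFun_eq θ n (a n) _).trans ?_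
  rw [ewensProb, ewensMean]
  congr 2
  ext s
  simp only [Set.indicator_apply, Set.mem_ofPred_eq, key _ hx1 hx2, Pi.one_apply]

lemma tendsto_ewensProb_neg
    (hconv : WeaklyConverges (fun n => distrFun θ n (a n)) (limitDistrFun P Y)) :
    Tendsto (fun n => ewensProb θ n {s | additiveSum (a n) s < 0}) atTop (𝓝 0) := by
  have h := tendsto_ewensProb_le hconv (-1)
  have hP : {ω | (Y ω : ℤ) ≤ -1} = ∅ := by
    ext ω
    simp only [Set.mem_ofPred_eq, Set.mem_empty_iff_false, iff_false]
    omega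
  rw [hP, measureReal_empty] at h
  refine h.congr fun n => ?_
  congr 1
  ext s
  simp only [Set.mem_ofPred_eq]
  omega

variable [IsProbabilityMeasure P]

lemma tendsto_ewensProb_eq (hY : Measurable Y)
    (hconv : WeaklyConverges (fun n => distrFun θ n (a n)) (limitDistrFun P Y)) (k : ℕ) :
    Tendsto (fun n => ewensProb θ n {s | additiveSum (a n) s = k}) atTop
      (𝓝 (P.real {ω | Y ω = k})) := by
  have h := (tendsto_ewensProb_le hconv k).sub (tendsto_ewensProb_le hconv (k - 1))
  have hP : P.real {ω | (Y ω : ℤ) ≤ k} =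
      P.real {ω | Y ω = k} + P.real {ω | (Y ω : ℤ) ≤ k - 1} := by
    rw [← measureReal_union]
    · congr 1
      ext ω
      simp only [Set.mem_ofPred_eq, Set.mem_union]
      omega
    · rw [Set.disjoint_left]
      intro ω h1 h2
      simp only [Set.mem_ofPred_eq] at h1 h2
      omega
    · exact hY (Set.to_countable {i : ℕ | (i : ℤ) ≤ k - 1}).measurableSet
  rw [hP, add_sub_cancel_right] at h
  refine h.congr fun n => ?_
  have hu : {s | additiveSum (a n) s ≤ k} =
      {s | additiveSum (a n) s = k} ∪ {s | additiveSum (a n) s ≤ k - 1} := by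
    ext s
    simp only [Set.mem_ofPred_eq, Set.mem_union]
    omega
  rw [hu, ewensProb_union, add_sub_cancel_right]
  rw [Set.disjoint_left]
  intro s h1 h2
  simp only [Set.mem_ofPred_eq] at h1 h2
  omega

lemma tendsto_ewensProb_gt (hθ : 0 < θ) (hY : Measurable Y)
    (hconv : WeaklyConverges (fun n => distrFun θ n (a n)) (limitDistrFun P Y)) (T : ℕ) :
    Tendsto (fun n => ewensProb θ n {s | (T : ℤ) < additiveSum (a n) s}) atTop
      (𝓝 (P.real {ω | T < Y ω})) := by
  have h := (tendsto_ewensProb_le hconv T).const_sub 1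
  have hP : P.real {ω | T < Y ω} = 1 - P.real {ω | (Y ω : ℤ) ≤ T} := by
    have hm : MeasurableSet {ω | (Y ω : ℤ) ≤ T} :=
      hY (Set.to_countable {i : ℕ | (i : ℤ) ≤ T}).measurableSet
    rw [← probReal_compl_eq_one_sub hm]
    congr 1
    ext ω
    simp
  rw [hP]
  refine h.congr fun n => ?_
  rw [← ewensProb_compl hθ]
  congr 1
  ext s
  simp

lemma tendsto_measureReal_gt (hY : Measurable Y) :
    Tendsto (fun T : ℕ => P.real {ω | T < Y ω}) atTop (𝓝 0) := by
  have h : Tendsto (fun T : ℕ => P {ω | T < Y ω}) atTop (𝓝 (P (⋂ T : ℕ, {ω | T < Y ω}))) := by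
    refine tendsto_measure_iInter_atTop (fun T => ?_) (fun S T hST ω hω => ?_)
      ⟨0, measure_ne_top _ _⟩
    · exact (hY (Set.to_countable {i : ℕ | T < i}).measurableSet).nullMeasurableSet
    · simp only [Set.mem_ofPred_eq] at hω ⊢
      omega
  have hempty : (⋂ T : ℕ, {ω | T < Y ω}) = ∅ := by
    ext ω
    simp only [Set.mem_iInter, Set.mem_ofPred_eq, Set.mem_empty_iff_false, iff_false, not_forall]
    exact ⟨Y ω, lt_irrefl _⟩
  rw [hempty, measure_empty] at h
  exact (ENNReal.tendsto_toReal ENNReal.zero_ne_top).comp h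

lemma tightNonneg_of_weaklyConverges (hθ : 0 < θ) (hY : Measurable Y)
    (hconv : WeaklyConverges (fun n => distrFun θ n (a n)) (limitDistrFun P Y)) :
    TightNonneg θ a := by
  intro δ hδ
  obtain ⟨K, hK⟩ := ((tendsto_measureReal_gt (P := P) hY).eventually_lt_const
    (half_pos hδ)).exists
  refine ⟨K, ?_⟩
  filter_upwards [(tendsto_ewensProb_gt hθ hY hconv K).eventually_lt_const hK,
    (tendsto_ewensProb_neg hconv).eventually_lt_const (half_pos hδ)] with n h1 h2
  have hu : {s | ¬(0 ≤ additiveSum (a n) s ∧ additiveSum (a n) s ≤ K)} ⊆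
      {s | additiveSum (a n) s < 0} ∪ {s | (K : ℤ) < additiveSum (a n) s} := by
    intro s hs
    simp only [Set.mem_ofPred_eq, Set.mem_union] at hs ⊢
    omega
  refine (ewensProb_mono hθ hu).trans ?_
  rw [ewensProb_union]
  · linarith
  · rw [Set.disjoint_left]
    intro s h1 h2
    simp only [Set.mem_ofPred_eq] at h1 h2
    omega

lemma integrable_descFactorial {α : ℝ} {l : ℕ} (hY : Measurable Y) (hl : (l : ℝ) ≤ α)
    (hmom : Integrable (fun ω => (Y ω : ℝ) ^ α) P) :
    Integrable (fun ω => ((Y ω).descFactorial l : ℝ)) P := by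
  refine ((integrable_const (1 : ℝ)).add hmom).mono' ?_ (Eventually.of_forall fun ω => ?_)
  · exact ((measurable_of_countable (fun k : ℕ => (k.descFactorial l : ℝ))).comp
      hY).aestronglyMeasurable
  · rw [Real.norm_eq_abs, Nat.abs_cast]
    have h1 : ((Y ω).descFactorial l : ℝ) ≤ (Y ω : ℝ) ^ l := by
      exact_mod_cast Nat.descFactorial_le_pow _ _
    refine h1.trans ?_
    simp only [Pi.add_apply]
    rcases Nat.eq_zero_or_pos (Y ω) with h0 | h0
    · have h2 : (0 : ℝ) ≤ (Y ω : ℝ) ^ α := by positivity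
      have h3 : ((Y ω : ℕ) : ℝ) ^ l ≤ 1 := pow_le_one₀ (by positivity) (by rw [h0]; simp)
      linarith
    · have h2 : (1 : ℝ) ≤ Y ω := by exact_mod_cast h0
      rw [← Real.rpow_natCast]
      have := Real.rpow_le_rpow_of_exponent_le h2 hl
      linarith

end Weak

/-! ### Pointwise comparison of the truncated and the original function. -/

section Pointwise

/-- The value of the truncated additive function. -/
def truncSum (m : ℕ) (a : ℕ → ℤ) (s : Multiset ℕ) : ℕ := (s.map fun j => trunc m (a j)).sum

/-- The number of the negative summands of an additive function. -/
noncomputable def negCount (a : ℕ → ℤ) (s : Multiset ℕ) : ℝ :=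
  (s.map fun j => if a j < 0 then (1 : ℝ) else 0).sum

/-- The falling factorial of an additive function, cut off outside `[0, T]`. -/
noncomputable def cutDescFactorial (l T : ℕ) (a : ℕ → ℤ) (s : Multiset ℕ) : ℝ :=
  ∑ k ∈ Finset.range (T + 1), (k.descFactorial l : ℝ) *
    ({s | additiveSum a s = (k : ℤ)} : Set (Multiset ℕ)).indicator 1 s

variable {a : ℕ → ℤ} {s : Multiset ℕ} {l m T : ℕ}

lemma negCount_nonneg : 0 ≤ negCount a s := by
  refine Multiset.sum_nonneg fun x hx => ?_
  obtain ⟨j, _, rfl⟩ := Multiset.mem_map.1 hx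
  split_ifs <;> simp

lemma one_le_negCount {j : ℕ} (hj : j ∈ s) (h : a j < 0) : 1 ≤ negCount a s := by
  have h1 : (1 : ℝ) ∈ s.map fun j => if a j < 0 then (1 : ℝ) else 0 :=
    Multiset.mem_map.2 ⟨j, hj, if_pos h⟩
  refine Multiset.single_le_sum (fun x hx => ?_) _ h1
  obtain ⟨j, _, rfl⟩ := Multiset.mem_map.1 hx
  split_ifs <;> simp

lemma truncSum_le (h : ∀ j ∈ s, 0 ≤ a j) : (truncSum m a s : ℤ) ≤ additiveSum a s := by
  rw [truncSum, additiveSum, Nat.cast_multiset_sum, Multiset.map_map]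
  refine Multiset.sum_map_le_sum_map _ _ fun j hj => ?_
  have := h j hj
  simp only [Function.comp, trunc]
  omega

lemma truncSum_eq (h : ∀ j ∈ s, 0 ≤ a j) (hm : additiveSum a s ≤ m) :
    (truncSum m a s : ℤ) = additiveSum a s := by
  have hle : ∀ j ∈ s, a j ≤ m := fun j hj => by
    refine le_trans (Multiset.single_le_sum (fun x hx => ?_) _ (Multiset.mem_map_of_mem a hj)) hm
    obtain ⟨j, hj, rfl⟩ := Multiset.mem_map.1 hx
    exact h j hj
  rw [truncSum, additiveSum, Nat.cast_multiset_sum, Multiset.map_map]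
  congr 1
  refine Multiset.map_congr rfl fun j hj => ?_
  have := h j hj
  have := hle j hj
  simp only [Function.comp, trunc]
  omega

lemma cutDescFactorial_of_eq {k : ℕ} (h : additiveSum a s = k) (hk : k ≤ T) :
    cutDescFactorial l T a s = k.descFactorial l := by
  rw [cutDescFactorial, Finset.sum_eq_single k]
  · simp [h]
  · intro i _ hi
    have : additiveSum a s ≠ i := by rw [h]; exact_mod_cast hi.symm
    simp [this]
  · intro hk'
    exact absurd (Finset.mem_range.2 (by omega)) hk'

lemma cutDescFactorial_nonneg : 0 ≤ cutDescFactorial l T a s :=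
  Finset.sum_nonneg fun _ _ => mul_nonneg (by positivity)
    (Set.indicator_nonneg (fun _ _ => zero_le_one) _)

lemma cutDescFactorial_of_not (h : ¬(0 ≤ additiveSum a s ∧ additiveSum a s ≤ T)) :
    cutDescFactorial l T a s = 0 := by
  refine Finset.sum_eq_zero fun k hk => ?_
  have hk := Finset.mem_range.1 hk
  have : additiveSum a s ≠ k := by omega
  simp [this]

lemma cutDescFactorial_le_pow : cutDescFactorial l T a s ≤ (T : ℝ) ^ l := by
  by_cases h : 0 ≤ additiveSum a s ∧ additiveSum a s ≤ T
  · obtain ⟨k, hk⟩ := Int.eq_ofNat_of_zero_le h.1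
    have hkT : k ≤ T := by omega
    rw [cutDescFactorial_of_eq hk hkT]
    exact_mod_cast (Nat.descFactorial_le_pow k l).trans (Nat.pow_le_pow_left hkT l)
  · rw [cutDescFactorial_of_not h]
    positivity

/-- Without negative summands, a value at most `T ≤ m` has all its summands at most `m`, so
truncation changes nothing. A negative summand is paid for by `negCount`. -/
lemma cutDescFactorial_le (hT : T ≤ m) : cutDescFactorial l T a s ≤
    ((truncSum m a s).descFactorial l : ℝ) + (T : ℝ) ^ l * negCount a s := by
  have hN := negCount_nonneg (a := a) (s := s)
  by_cases hneg : ∃ j ∈ s, a j < 0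
  · obtain ⟨j, hj, hj0⟩ := hneg
    have h1 := one_le_negCount hj hj0
    have h2 : (T : ℝ) ^ l ≤ (T : ℝ) ^ l * negCount a s := le_mul_of_one_le_right (by positivity) h1
    have h3 := cutDescFactorial_le_pow (l := l) (T := T) (a := a) (s := s)
    have h4 : (0 : ℝ) ≤ ((truncSum m a s).descFactorial l : ℝ) := by positivity
    linarith
  · push Not at hneg
    by_cases h : 0 ≤ additiveSum a s ∧ additiveSum a s ≤ T
    · have h1 := truncSum_eq hneg (by omega : additiveSum a s ≤ m)
      rw [cutDescFactorial_of_eq h1.symm (by omega)]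
      exact le_add_of_nonneg_right (by positivity)
    · rw [cutDescFactorial_of_not h]
      positivity

/-- Above `l + β` the next falling factorial is larger by a factor at least `β`. Below it the left
side is at most `(l + β) ^ l`, a bound spent only on a negative summand or a value above `T`;
otherwise truncation can only decrease the value. -/
lemma descFactorial_truncSum_le (m T : ℕ) {β : ℕ} (hβ : 0 < β) :
    ((truncSum m a s).descFactorial l : ℝ) ≤ cutDescFactorial l T a s +
      (((l + β : ℕ) : ℝ) ^ l * ({s | (T : ℤ) < additiveSum a s} : Set (Multiset ℕ)).indicator 1 s +
      (((l + β : ℕ) : ℝ) ^ l * negCount a s +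
        1 / (β : ℝ) * ((truncSum m a s).descFactorial (l + 1) : ℝ))) := by
  set B : ℝ := ((l + β : ℕ) : ℝ) ^ l with hB
  have hB0 : 0 ≤ B := by positivity
  set I : ℝ := ({s | (T : ℤ) < additiveSum a s} : Set (Multiset ℕ)).indicator 1 s with hI
  have hI0 : 0 ≤ B * I := mul_nonneg hB0 (Set.indicator_nonneg (fun _ _ => zero_le_one) _)
  have hN : 0 ≤ B * negCount a s := mul_nonneg hB0 negCount_nonneg
  have hc := cutDescFactorial_nonneg (l := l) (T := T) (a := a) (s := s)
  have hl : 0 ≤ 1 / (β : ℝ) * ((truncSum m a s).descFactorial (l + 1) : ℝ) := by positivity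
  rcases Nat.lt_or_ge (l + β) (truncSum m a s) with h | h
  · have h1 : β * (truncSum m a s).descFactorial l ≤ (truncSum m a s).descFactorial (l + 1) := by
      rw [Nat.descFactorial_succ]
      exact Nat.mul_le_mul_right _ (by omega)
    have h2 : (β : ℝ) * ((truncSum m a s).descFactorial l : ℝ) ≤
        ((truncSum m a s).descFactorial (l + 1) : ℝ) := by exact_mod_cast h1
    have h3 : ((truncSum m a s).descFactorial l : ℝ) ≤
        1 / (β : ℝ) * ((truncSum m a s).descFactorial (l + 1) : ℝ) := by
      have hβ' : (0 : ℝ) < β := by exact_mod_cast hβ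
      rw [one_div, ← div_eq_inv_mul, le_div_iff₀ hβ']
      linarith
    linarith
  · have h1 : ((truncSum m a s).descFactorial l : ℝ) ≤ B := by
      rw [hB]
      exact_mod_cast (Nat.descFactorial_le_pow _ l).trans (Nat.pow_le_pow_left h l)
    by_cases hneg : ∃ j ∈ s, a j < 0
    · obtain ⟨j, hj, hj0⟩ := hneg
      have h2 := le_mul_of_one_le_right hB0 (one_le_negCount hj hj0)
      linarith
    · push Not at hneg
      have h2 := truncSum_le (m := m) hneg
      by_cases h3 : additiveSum a s ≤ T
      · obtain ⟨k, hk⟩ := Int.eq_ofNat_of_zero_le (by omega : 0 ≤ additiveSum a s)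
        rw [cutDescFactorial_of_eq hk (by omega)]
        have h4 : ((truncSum m a s).descFactorial l : ℝ) ≤ (k.descFactorial l : ℝ) := by
          exact_mod_cast Nat.descFactorial_le l (by omega : truncSum m a s ≤ k)
        linarith
      · have h4 : I = 1 := by
          rw [hI, Set.indicator_of_mem (by simpa using h3)]
          rfl
        rw [h4, mul_one] at hI0 ⊢
        linarith

end Pointwise

/-! ### Convergence of the truncated moments. -/

section Moments

variable {l m : ℕ}

lemma ewensMean_truncSum (a : ℕ → ℤ) (n l m : ℕ) :
    ewensMean θ n (fun s => ((truncSum m a s).descFactorial l : ℝ)) =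
      facRec θ (fun j => trunc m (a j)) (mass θ) l n / mass θ n := by
  rw [ewensMean, ← ewensSum_descFactorial]
  rfl

lemma exists_trunc_support_bound (hθ : 1 ≤ θ) (ha : TightNonneg θ a) : ∃ C : ℝ, 1 ≤ C ∧
    ∀ᶠ n in atTop, ∀ m, ∑ j ∈ Finset.Icc 1 n,
      (if trunc m (a n j) = 0 then (0 : ℝ) else 1) / j ≤ C := by
  obtain ⟨C, hC⟩ := exists_support_bound hθ ha
  refine ⟨max C 1, le_max_right _ _, hC.mono fun n hn m => ?_⟩
  refine le_trans (Finset.sum_le_sum fun j _ => ?_) (hn.trans (le_max_left _ _))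
  gcongr
  by_cases h : a n j = 0
  · simp [h, trunc]
  · rw [if_neg h]
    split_ifs <;> norm_num

lemma exists_moment_bound (hθ : 1 ≤ θ) (ha : TightNonneg θ a) (l m : ℕ) : ∃ D : ℝ, 0 ≤ D ∧
    ∀ᶠ n in atTop, ewensMean θ n (fun s => ((truncSum m (a n) s).descFactorial l : ℝ)) ≤ D := by
  have hθ0 : 0 < θ := by linarith
  obtain ⟨C, hC1, hC⟩ := exists_trunc_support_bound hθ ha
  obtain ⟨D, hD, h⟩ := exists_abs_facRec_le_const hθ0.le m l hC1
  refine ⟨D, hD, hC.mono fun n hn => ?_⟩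
  have hm := mass_pos hθ0 n
  rw [ewensMean_truncSum, div_le_iff₀ hm]
  refine (le_abs_self _).trans (h n _ _ _ (fun _ => min_le_right _ _) hm.le (fun k hk => ?_) (hn m))
  rw [abs_of_pos (mass_pos hθ0 k)]
  exact mass_mono hθ hk

/-- By linearity only the difference of the weights matters. For `k ≥ 1` it is uniformly small, and
the bounded support keeps it small. At `k = 0` it is `-1 / mass θ n`, a multiple of the point mass,
whose contribution is of order `(1 + log n) ^ l / n`. -/
lemma tendsto_upsilon_sub_moment (hθ : 1 ≤ θ) (ha : TightNonneg θ a) (hl : 1 ≤ l) (m : ℕ) :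
    Tendsto (fun n => upsilon θ (a n) n l m -
      ewensMean θ n (fun s => ((truncSum m (a n) s).descFactorial l : ℝ))) atTop (𝓝 0) := by
  have hθ0 : 0 < θ := by linarith
  obtain ⟨C, hC1, hC⟩ := exists_trunc_support_bound hθ ha
  obtain ⟨D, hD, h⟩ := exists_abs_facRec_le_const hθ0.le m l hC1
  obtain ⟨D', hD', h'⟩ := exists_facRec_delta_le hθ0.le m l
  rw [Metric.tendsto_nhds]
  intro ε hε
  have hη : 0 < ε / (2 * (D + 1)) := by positivity
  have hlog := (tendsto_one_add_log_pow_div l).const_mul D'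
  rw [mul_zero] at hlog
  filter_upwards [hC, eventually_abs_rpow_sub_mass_ratio_le hθ hη, eventually_ge_atTop 1,
    hlog.eventually_lt_const (half_pos hε)] with n hn hr hn1 hlog
  have hm := mass_pos hθ0 n
  have hm1 : 1 ≤ mass θ n := by
    rw [← mass_zero θ]
    exact mass_mono hθ (Nat.zero_le n)
  set b : ℕ → ℕ := fun j => trunc m (a n j) with hb
  set c : ℝ := -(1 / mass θ n) with hc
  set v : ℕ → ℝ := fun k => if k = 0 then 0 else ((k : ℝ) / n) ^ (θ - 1) with hv
  set d : ℕ → ℝ := fun k => if k = 0 then 0 else v k + c * mass θ k with hd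
  have h1 : facRec θ b (fun k => v k + c * mass θ k) l n =
      facRec θ b v l n + c * facRec θ b (mass θ) l n := facRec_add_mul _ _ _ _ _ _
  have h2 : facRec θ b (fun k => d k + c * if k = 0 then 1 else 0) l n =
      facRec θ b d l n + c * facRec θ b (fun k => if k = 0 then 1 else 0) l n :=
    facRec_add_mul _ _ _ _ _ _
  have h3 : (fun k => v k + c * mass θ k) = fun k => d k + c * if k = 0 then 1 else 0 := by
    ext k
    by_cases hk : k = 0
    · simp [hd, hv, hk, mass_zero]
    · simp [hd, hk]
  have h4 : |facRec θ b d l n| ≤ D * (ε / (2 * (D + 1))) := by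
    refine h n b d _ (fun _ => min_le_right _ _) hη.le (fun k hk => ?_) (hn m)
    by_cases hk0 : k = 0
    · simp [hd, hk0, hη.le]
    · have h5 := hr k (by omega) hk
      have h6 : d k = ((k : ℝ) / n) ^ (θ - 1) - mass θ k / mass θ n := by
        simp only [hd, hv, if_neg hk0, hc]
        ring
      rwa [h6]
  have h5 := h' n b hn1 fun _ => min_le_right _ _
  have h6 : |c| ≤ 1 := by
    rw [hc, abs_neg, abs_of_pos (by positivity)]
    exact (div_le_one hm).2 hm1
  have h7 : D * (ε / (2 * (D + 1))) ≤ ε / 2 := by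
    rw [mul_div_assoc', div_le_div_iff₀ (by positivity) (by positivity)]
    nlinarith
  rw [Real.dist_eq, sub_zero, upsilon_eq_facRec _ _ _ _ hl, ewensMean_truncSum]
  have h8 : facRec θ b v l n - facRec θ b (mass θ) l n / mass θ n =
      facRec θ b d l n + c * facRec θ b (fun k => if k = 0 then 1 else 0) l n := by
    rw [← h2, ← h3, h1, hc]
    ring
  rw [h8]
  refine (abs_add_le _ _).trans_lt ?_
  rw [abs_mul]
  have h9 := mul_le_mul h6 h5 (abs_nonneg _) zero_le_one
  linarith

variable {Ω : Type*} [MeasurableSpace Ω] {P : Measure Ω} [IsProbabilityMeasure P] {Y : Ω → ℕ}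

lemma tendsto_ewensMean_cutDescFactorial (hY : Measurable Y)
    (hconv : WeaklyConverges (fun n => distrFun θ n (a n)) (limitDistrFun P Y)) (l T : ℕ) :
    Tendsto (fun n => ewensMean θ n (cutDescFactorial l T (a n))) atTop
      (𝓝 (∑ k ∈ Finset.range (T + 1), (k.descFactorial l : ℝ) * P.real {ω | Y ω = k})) := by
  have h : ∀ n, ewensMean θ n (cutDescFactorial l T (a n)) = ∑ k ∈ Finset.range (T + 1),
      (k.descFactorial l : ℝ) * ewensProb θ n {s | additiveSum (a n) s = k} := by
    intro n
    simp_rw [ewensProb, ← ewensMean_const_mul]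
    rw [← ewensMean_sum]
    rfl
  simp_rw [h]
  exact tendsto_finsetSum _ fun k _ => (tendsto_ewensProb_eq hY hconv k).const_mul _

lemma eventually_moment_le (hθ : 1 ≤ θ) (hY : Measurable Y)
    (hconv : WeaklyConverges (fun n => distrFun θ n (a n)) (limitDistrFun P Y))
    (hint : Integrable (fun ω => ((Y ω).descFactorial l : ℝ)) P) (m : ℕ) {ε : ℝ} (hε : 0 < ε) :
    ∀ᶠ n in atTop, ewensMean θ n (fun s => ((truncSum m (a n) s).descFactorial l : ℝ)) ≤
      ∫ ω, ((Y ω).descFactorial l : ℝ) ∂P + ε := by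
  have hθ0 : 0 < θ := by linarith
  have ha := tightNonneg_of_weaklyConverges hθ0 hY hconv
  obtain ⟨D, hD, hDb⟩ := exists_moment_bound hθ ha (l + 1) m
  -- The order of choices matters: `β` makes the moment of order `l + 1` negligible, then `T`
  -- depends on `β` through `B = (l + β) ^ l`, and `n` comes last.
  obtain ⟨β, hβ⟩ := exists_nat_gt (4 * D / ε)
  have hβ0 : (0 : ℝ) < β := lt_of_le_of_lt (by positivity) hβ
  have hβ' : 0 < β := by exact_mod_cast hβ0
  have hsum := hasSum_integral_comp_nat (f := fun k => (k.descFactorial l : ℝ)) hY hint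
  set B : ℝ := ((l + β : ℕ) : ℝ) ^ l with hB
  have hgt := (tendsto_measureReal_gt (P := P) hY).const_mul B
  rw [mul_zero] at hgt
  obtain ⟨T, hT⟩ := (hgt.eventually_lt_const (by positivity : 0 < ε / 4)).exists
  have hcut := tendsto_ewensMean_cutDescFactorial hY hconv l T
  have hcut_le : ∑ k ∈ Finset.range (T + 1), (k.descFactorial l : ℝ) * P.real {ω | Y ω = k} ≤
      ∫ ω, ((Y ω).descFactorial l : ℝ) ∂P :=
    sum_le_hasSum _ (fun k _ => by positivity) hsum
  have hN := (tendsto_count_neg hθ ha (tendsto_ewensProb_neg hconv)).const_mul B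
  rw [mul_zero] at hN
  filter_upwards [hDb, hcut.eventually_lt_const (by linarith :
      _ < ∫ ω, ((Y ω).descFactorial l : ℝ) ∂P + ε / 4),
    ((tendsto_ewensProb_gt hθ0 hY hconv T).const_mul B).eventually_lt_const hT,
    hN.eventually_lt_const (by positivity : 0 < ε / 4)] with n h1 h2 h3 h4
  refine (ewensMean_mono hθ0 fun s _ _ => descFactorial_truncSum_le m T hβ').trans ?_
  rw [ewensMean_add, ewensMean_add, ewensMean_add, ewensMean_const_mul, ewensMean_const_mul,
    ewensMean_const_mul]
  have h5 : 1 / (β : ℝ) * ewensMean θ n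
      (fun s => ((truncSum m (a n) s).descFactorial (l + 1) : ℝ)) ≤ ε / 4 := by
    rw [one_div, ← div_eq_inv_mul, div_le_iff₀ hβ0]
    rw [div_lt_iff₀ hε] at hβ
    linarith
  have h3' : B * ewensMean θ n (fun s =>
    ({s | (T : ℤ) < additiveSum (a n) s} : Set (Multiset ℕ)).indicator 1 s) < ε / 4 := h3
  have h4' : B * ewensMean θ n (fun s => negCount (a n) s) < ε / 4 := h4
  linarith

lemma eventually_le_moment (hθ : 1 ≤ θ) (hY : Measurable Y)
    (hconv : WeaklyConverges (fun n => distrFun θ n (a n)) (limitDistrFun P Y))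
    (hint : Integrable (fun ω => ((Y ω).descFactorial l : ℝ)) P) {ε : ℝ} (hε : 0 < ε) :
    ∀ᶠ m in atTop, ∀ᶠ n in atTop, ∫ ω, ((Y ω).descFactorial l : ℝ) ∂P - ε ≤
      ewensMean θ n (fun s => ((truncSum m (a n) s).descFactorial l : ℝ)) := by
  have hθ0 : 0 < θ := by linarith
  have ha := tightNonneg_of_weaklyConverges hθ0 hY hconv
  have hsum := hasSum_integral_comp_nat (f := fun k => (k.descFactorial l : ℝ)) hY hint
  -- Finitely many values of `Y` already carry the moment up to `ε / 2`; any truncation level `m ≥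
  -- T` leaves those values intact.
  obtain ⟨T, hT⟩ := (((tendsto_add_atTop_iff_nat 1).2 hsum.tendsto_sum_nat).eventually_const_lt
    (by linarith : ∫ ω, ((Y ω).descFactorial l : ℝ) ∂P - ε / 2 < _)).exists
  have hN := (tendsto_count_neg hθ ha (tendsto_ewensProb_neg hconv)).const_mul ((T : ℝ) ^ l)
  rw [mul_zero] at hN
  filter_upwards [eventually_ge_atTop T] with m hm
  filter_upwards [(tendsto_ewensMean_cutDescFactorial hY hconv l T).eventually_const_lt hT,
    hN.eventually_lt_const (half_pos hε)] with n h1 h2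
  have h3 : ewensMean θ n (fun s => cutDescFactorial l T (a n) s) ≤ _ :=
    ewensMean_mono hθ0 fun s _ _ => cutDescFactorial_le (l := l) hm
  rw [ewensMean_add, ewensMean_const_mul] at h3
  have h2' : (T : ℝ) ^ l * ewensMean θ n (fun s => negCount (a n) s) < ε / 2 := h2
  linarith

end Moments

lemma isRho_of_eventually {ρ : ℕ → ℕ → ℝ}
    (h : ∀ ε : ℝ, 0 < ε → ∀ᶠ m in atTop, ∀ᶠ n in atTop, |ρ n m| ≤ ε) : IsRho ρ := by
  rw [IsRho, ENNReal.tendsto_nhds_zero]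
  intro ε hε
  obtain ⟨δ, hδ, hδε⟩ := ENNReal.lt_iff_exists_real_btwn.1 hε
  have hδ0 : 0 < δ := by simpa using hδε.1
  filter_upwards [h δ hδ0] with m hm
  refine (limsup_le_of_le (by isBoundedDefault) (hm.mono fun n hn => ?_)).trans hδε.2.le
  exact ENNReal.ofReal_le_ofReal hn

end Limit

end EwensAdditive

theorem theorem1 (θ : ℝ) (hθ : 1 ≤ θ) (a : ℕ → ℕ → ℤ)
    {Ω : Type*} [MeasurableSpace Ω] (P : Measure Ω) [IsProbabilityMeasure P]
    (Y : Ω → ℕ) (hY : Measurable Y)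
    (ε α : ℝ) (hε : 0 < ε) (hα : 2 + ε ≤ α)
    (hmom : Integrable (fun ω => (Y ω : ℝ) ^ α) P)
    (hconv : EwensAdditive.WeaklyConverges (fun n => EwensAdditive.distrFun θ n (a n))
      (EwensAdditive.limitDistrFun P Y)) :
    Tendsto (fun n : ℕ => ∑ j ∈ Finset.Ico 1 n with a n j ≤ -1,
        1 / (j : ℝ) * (1 - (j : ℝ) / (n : ℝ)) ^ (θ - 1)) atTop (𝓝 0) ∧
      ∀ l : ℕ, 1 ≤ l → (l : ℝ) ≤ α - 1 - ε →
        EwensAdditive.IsRho fun n m =>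
          EwensAdditive.upsilon θ (a n) n l m - ∫ ω, ((Y ω).descFactorial l : ℝ) ∂P := by
  have ha := EwensAdditive.tightNonneg_of_weaklyConverges (by linarith) hY hconv
  refine ⟨EwensAdditive.tendsto_weight_neg hθ ha (EwensAdditive.tendsto_ewensProb_neg hconv),
    fun l hl hlα => ?_⟩
  have hint := EwensAdditive.integrable_descFactorial hY (by linarith : (l : ℝ) ≤ α) hmom
  refine EwensAdditive.isRho_of_eventually fun δ hδ => ?_
  filter_upwards [EwensAdditive.eventually_le_moment hθ hY hconv hint (half_pos hδ)] with m hm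
  filter_upwards [hm, EwensAdditive.eventually_moment_le hθ hY hconv hint m (half_pos hδ),
    (EwensAdditive.tendsto_upsilon_sub_moment hθ ha hl m).eventually_lt_const (half_pos hδ),
    (EwensAdditive.tendsto_upsilon_sub_moment hθ ha hl m).eventually_const_lt
      (neg_lt_zero.2 (half_pos hδ))] with n h1 h2 h3 h4
  rw [abs_le]
  constructor <;> linarith
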